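/- \textbf{Setting.} Let $G$ be a countable group. A \emph{sofic approximation} to $G$ is a sequence $\Sigma=(\sigma_n:G\to\mathrm{Sym}(V_n))_n$ of maps, with each $V_n$ finite and nonempty, such that, as $n\to\infty$, for all $g,h\in G$ the proportion of $v\in V_n$ with $\sigma_n^g(\sigma_n^h(v))=\sigma_n^{gh}(v)$ tends to $1$, and for all $g\neq e$ the proportion of $v\in V_n$ with $\sigma_n^g(v)\neq v$ tends to $1$. A \emph{$G$-system} $(X,\mu,T)$ is a standard Borel probability space with a measurable, measure-preserving action $T$ of $G$. \textbf{Sofic entropy.} Let $(X,\mu,T)$ be a $G$-system, let $d$ be any compact metric on $X$ whose Borel sets are the measurable sets of $X$, and let $\hat\mu$ be the law on $X^G$ of $(T^h x)_{h\in G}$ for $x\sim\mu$. For $\mathbf{x}\in X^{V_n}$ put $P^{\sigma_n}_{\mathbf{x}}=\frac1{|V_n|}\sum_{v\in V_n}\delta_{(x_{\sigma_n^g(v)})_{g\in G}}$, and for a weak$^\ast$-neighbourhood $\mathcal{O}$ of $\hat\mu$ in $\Pr(X^G)$ put $\Omega(\mathcal{O},\sigma_n)=\{\mathbf{x}\in X^{V_n}:P^{\sigma_n}_{\mathbf{x}}\in\mathcal{O}\}$.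 Let $d^{(V_n)}(\mathbf{x},\mathbf{y})=\frac1{|V_n|}\sum_{v}d(x_v,y_v)$, and let $\mathrm{cov}_\delta(Z,d^{(V_n)})$ be the least cardinality of a set $F\subseteq Z$ such that every point of $Z$ is at distance less than $\delta$ from $F$. The sofic entropy and the lower sofic entropy are \[\mathrm{h}_\Sigma(\mu,T)=\sup_{\delta>0}\inf_{\mathcal{O}}\limsup_{n\to\infty}\frac1{|V_n|}\log\mathrm{cov}_\delta\big(\Omega(\mathcal{O},\sigma_n),d^{(V_n)}\big),\qquad \underline{\mathrm{h}}_\Sigma(\mu,T)=\sup_{\delta>0}\inf_{\mathcal{O}}\liminf_{n\to\infty}\frac1{|V_n|}\log\mathrm{cov}_\delta\big(\Omega(\mathcal{O},\sigma_n),d^{(V_n)}\big),\] with $\log 0=-\infty$, so that the values lie in $[-\infty,+\infty]$; they do not depend on the choice of $d$, and the identities below are asserted for every choice of these metrics on the spaces involved. Sums of extended reals are read as $-\infty$ if one of the terms is $-\infty$. \textbf{Co-induction.} Let $G$ and $H$ be countable groups with sofic approximations $\Sigma=(\sigma_n:G\to\mathrm{Sym}(V_n))_n$ and $\mathrm{T}=(\tau_n:H\to\mathrm{Sym}(W_n))_n$,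 and let $\Sigma\times\mathrm{T}$ be the sofic approximation $(g,h)\mapsto\sigma_n^g\times\tau_n^h\in\mathrm{Sym}(V_n\times W_n)$ to $G\times H$. Let $(X,\mu,T)$ be a $G$-system. The co-induced $(G\times H)$-system is $(X^H,\mu^{\times H},\mathrm{CInd}\,T)$, where $(\mathrm{CInd}\,T)^{(g,h)}\big((x_k)_{k\in H}\big)=(T^g x_{kh})_{k\in H}$. \textbf{Corollary E$'$.} Assume that $H$ is infinite. \begin{enumerate} \item If $(Y,\nu,S)$ is a $(G\times H)$-system such that $\mathrm{h}_{\Sigma\times\mathrm{T}}(\nu,S)=\underline{\mathrm{h}}_{\Sigma\times\mathrm{T}}(\nu,S)$, then \[\mathrm{h}_{\Sigma\times\mathrm{T}}\big(\mu^{\times H}\times\nu,\mathrm{CInd}\,T\times S\big)=\mathrm{h}_{\Sigma\times\mathrm{T}}\big(\mu^{\times H},\mathrm{CInd}\,T\big)+\mathrm{h}_{\Sigma\times\mathrm{T}}(\nu,S).\] \item If $(X,\mu,T)$ has a finite generating partition (a finite measurable partition of $X$ whose translates under $T$ generate the $\sigma$-algebra of $X$ modulo $\mu$-null sets), then for all $k\geq1$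 \[\mathrm{h}_{\Sigma\times\mathrm{T}}\big((\mu^{\times H})^{\times k},(\mathrm{CInd}\,T)^{\times k}\big)=k\cdot\mathrm{h}_{\Sigma\times\mathrm{T}}\big(\mu^{\times H},\mathrm{CInd}\,T\big).\] \end{enumerate} -/

import Mathlib

open MeasureTheory Filter Topology Set
open scoped ENNReal

/-! ### Sofic approximations -/

section Sofic

variable {G H : Type*} {V W : ℕ → Type*}

/-- A property `P n v` of the vertices `v : V n` of a sequence of finite sets holds with high
probability: the proportion of vertices satisfying it tends to `1`. -/
def WHP (P : ∀ n, V n → Prop) : Prop :=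
  Tendsto (fun n => (Nat.card {v : V n // P n v} : ℝ) / (Nat.card (V n) : ℝ)) atTop (𝓝 1)

/-- A sequence of maps `σ n : G → Sym (V n)` is a sofic approximation to the group `G`. The sets
`V n` are required to be finite and nonempty where this notion is used. -/
structure IsSoficApprox [Group G] (σ : ∀ n, G → Equiv.Perm (V n)) : Prop where
  mul : ∀ g h : G, WHP (fun n (v : V n) => σ n g (σ n h v) = σ n (g * h) v)
  free : ∀ g : G, g ≠ 1 → WHP (fun n (v : V n) => σ n g v ≠ v)

/-- The product `(σ n × τ n)` of two sequences of maps, from `G × H` to `Sym (V n × W n)`. -/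
def prodApprox (σ : ∀ n, G → Equiv.Perm (V n)) (τ : ∀ n, H → Equiv.Perm (W n)) :
    ∀ n, G × H → Equiv.Perm (V n × W n) :=
  fun n p => Equiv.prodCongr (σ n p.1) (τ n p.2)

end Sofic

/-! ### Sofic entropy of a shift-invariant measure on `𝒳 ^ G`, for a compact metric space `𝒳` -/

section ShiftProc

variable {G : Type*} {𝒳 : Type*} {V : Type*}

/-- The pullback name of `x` at the vertex `v`. -/
def pullbackName (σ : G → Equiv.Perm V) (v : V) (x : V → 𝒳) : G → 𝒳 :=
  fun g => x (σ g v)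

/-- The empirical distribution of `x`: the average over `v` of the point masses at the pullback
names of `x`. -/
noncomputable def empiricalDist [MeasurableSpace 𝒳] [Fintype V] [Nonempty V]
    (σ : G → Equiv.Perm V) (x : V → 𝒳) : ProbabilityMeasure (G → 𝒳) :=
  ⟨(Fintype.card V : ℝ≥0∞)⁻¹ • ∑ v : V, Measure.dirac (pullbackName σ v x), ⟨by
    simp only [Measure.smul_apply, Measure.coe_finsetSum, Finset.sum_apply, measure_univ,
      Finset.sum_const, Finset.card_univ, smul_eq_mul, nsmul_eq_mul, mul_one]
    exact ENNReal.inv_mul_cancel (by simp) (by simp)⟩⟩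

/-- The set of good models: configurations whose empirical distribution lies in `O`. -/
def goodModels [MeasurableSpace 𝒳] [Fintype V] [Nonempty V]
    (O : Set (ProbabilityMeasure (G → 𝒳))) (σ : G → Equiv.Perm V) : Set (V → 𝒳) :=
  {x | empiricalDist σ x ∈ O}

/-- The Hamming average over `V` of the metric of `𝒳`. -/
noncomputable def hammingAvg [MetricSpace 𝒳] [Fintype V] (x y : V → 𝒳) : ℝ :=
  (∑ v : V, dist (x v) (y v)) / (Fintype.card V : ℝ)

/-- The `δ`-covering number of `Z` for the distance function `ρ`: the least cardinality of a
finite `F ⊆ Z` such that every point of `Z` is at distance less than `δ` from `F`. -/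
noncomputable def covNum {E : Type*} (ρ : E → E → ℝ) (δ : ℝ) (Z : Set E) : ℕ∞ :=
  ⨅ (F : Finset E) (_ : (F : Set E) ⊆ Z ∧ ∀ z ∈ Z, ∃ y ∈ F, ρ y z < δ), (F.card : ℕ∞)

end ShiftProc

section ProcEntropy

variable {G : Type*} {𝒳 : Type*} {V : ℕ → Type*}

/-- The exponential rate `(1 / |V n|) log cov_δ (Ω (O, σ n))`, with values in the extended reals;
it equals `-∞` if there are no good models. -/
noncomputable def covRate [MetricSpace 𝒳] [MeasurableSpace 𝒳]
    [∀ n, Fintype (V n)] [∀ n, Nonempty (V n)]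
    (σ : ∀ n, G → Equiv.Perm (V n)) (δ : ℝ) (O : Set (ProbabilityMeasure (G → 𝒳))) (n : ℕ) :
    EReal :=
  ENNReal.log (covNum hammingAvg δ (goodModels O (σ n)) : ℝ≥0∞) / (Fintype.card (V n) : EReal)

/-- The (upper) sofic entropy of a measure `m` on `𝒳 ^ G`; here `𝓝 m` is the filter of
neighbourhoods of `m` in the weak-star topology. -/
noncomputable def procEntropy [Countable G] [MetricSpace 𝒳] [CompactSpace 𝒳] [MeasurableSpace 𝒳]
    [BorelSpace 𝒳] [∀ n, Fintype (V n)] [∀ n, Nonempty (V n)]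
    (σ : ∀ n, G → Equiv.Perm (V n)) (m : ProbabilityMeasure (G → 𝒳)) : EReal :=
  ⨆ (δ : ℝ) (_ : 0 < δ), ⨅ (O : Set (ProbabilityMeasure (G → 𝒳))) (_ : O ∈ 𝓝 m),
    limsup (covRate σ δ O) atTop

/-- The lower sofic entropy of a measure `m` on `𝒳 ^ G`. -/
noncomputable def procLowerEntropy [Countable G] [MetricSpace 𝒳] [CompactSpace 𝒳]
    [MeasurableSpace 𝒳] [BorelSpace 𝒳] [∀ n, Fintype (V n)] [∀ n, Nonempty (V n)]
    (σ : ∀ n, G → Equiv.Perm (V n)) (m : ProbabilityMeasure (G → 𝒳)) : EReal :=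
  ⨆ (δ : ℝ) (_ : 0 < δ), ⨅ (O : Set (ProbabilityMeasure (G → 𝒳))) (_ : O ∈ 𝓝 m),
    liminf (covRate σ δ O) atTop

end ProcEntropy

/-! ### Probability-preserving systems, products, powers and co-induction -/

/-- A `G`-system on the measurable space `X`: a probability measure `μ` together with an action
`T` of `G` by measurable maps preserving `μ`. (`Function.End X` is the monoid of self-maps of `X`
under composition, so `T` is an action of `G` on `X`.) -/
structure PMPSystem (G : Type*) [Group G] (X : Type*) [MeasurableSpace X] where
  μ : Measure X
  isProb : IsProbabilityMeasure μ
  T : G →* Function.End X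
  measurePreserving : ∀ g, MeasurePreserving (T g : X → X) μ μ

namespace PMPSystem

variable {G : Type*} [Group G] {X Y : Type*} [MeasurableSpace X] [MeasurableSpace Y]

instance (A : PMPSystem G X) : IsProbabilityMeasure A.μ := A.isProb

/-- The product system `(X × Y, μ × ν, T × S)`. -/
noncomputable def prod (A : PMPSystem G X) (B : PMPSystem G Y) : PMPSystem G (X × Y) where
  μ := A.μ.prod B.μ
  isProb := inferInstance
  T :=
    { toFun := fun g p => (A.T g p.1, B.T g p.2)
      map_one' := by simp only [map_one]; rfl
      map_mul' := fun g h => by simp only [map_mul]; rfl }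
  measurePreserving := fun g => (A.measurePreserving g).prod (B.measurePreserving g)

/-- The Cartesian power `(X ^ k, μ ^ k, T ^ k)`. -/
noncomputable def pow (A : PMPSystem G X) (k : ℕ) : PMPSystem G (Fin k → X) where
  μ := Measure.pi (fun _ => A.μ)
  isProb := inferInstance
  T :=
    { toFun := fun g x i => A.T g (x i)
      map_one' := by simp only [map_one]; rfl
      map_mul' := fun g h => by simp only [map_mul]; rfl }
  measurePreserving := fun g => measurePreserving_pi _ _ (fun _ => A.measurePreserving g)

/-- The co-induced `(G × H)`-system `(X ^ H, μ ^ H, CInd T)`: the measure is the product measure,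
`G` acts diagonally through `T`, and `H` acts by the right shift
`(x k)_k ↦ (x (k * h))_k`. -/
noncomputable def coind (H : Type*) [Group H] (A : PMPSystem G X) :
    PMPSystem (G × H) (H → X) where
  μ := Measure.infinitePi (fun _ => A.μ)
  isProb := inferInstance
  T :=
    { toFun := fun p x k => A.T p.1 (x (k * p.2))
      map_one' := by
        funext x k
        simp only [Prod.fst_one, Prod.snd_one, map_one, mul_one]; rfl
      map_mul' := fun p q => by
        funext x k
        simp only [Prod.fst_mul, Prod.snd_mul, map_mul, ← mul_assoc]
        rfl }
  measurePreserving := fun p => by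
    have h1 : MeasurePreserving (fun (x : H → X) (k : H) => x (k * p.2))
        (Measure.infinitePi fun _ => A.μ) (Measure.infinitePi fun _ => A.μ) :=
      ⟨by fun_prop, Measure.map_infinitePi_infinitePi_of_inj (P := fun _ : H => A.μ)
        (mul_left_injective p.2)⟩
    have hT : ∀ _ : H, Measurable (A.T p.1 : X → X) :=
      fun _ => (A.measurePreserving p.1).measurable
    have h2 : MeasurePreserving (fun (x : H → X) (k : H) => (A.T p.1 : X → X) (x k))
        (Measure.infinitePi fun _ => A.μ) (Measure.infinitePi fun _ => A.μ) := by
      refine ⟨measurable_pi_lambda _ fun k => (hT k).comp (measurable_pi_apply k), ?_⟩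
      rw [Measure.infinitePi_map_pi (μ := fun _ : H => A.μ) (f := fun _ => (A.T p.1 : X → X)) hT,
        (A.measurePreserving p.1).map_eq]
    exact h2.comp h1

/-- The map `x ↦ (T ^ h x)_h` that identifies a system with a shift-system over the
state space `X`. -/
def orbitMap (A : PMPSystem G X) : X → G → X := fun x h => A.T h x

theorem measurable_orbitMap (A : PMPSystem G X) : Measurable A.orbitMap :=
  measurable_pi_lambda _ (fun h => (A.measurePreserving h).measurable)

/-- The law on `X ^ G` of the shift-system associated to `A`. -/
noncomputable def processLaw (A : PMPSystem G X) : ProbabilityMeasure (G → X) :=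
  ⟨A.μ.map A.orbitMap, Measure.isProbabilityMeasure_map A.measurable_orbitMap.aemeasurable⟩

/-- `A` has a finite generating partition: there is a finite measurable partition of `X` (given by
a map `f` to a finite set) whose translates under `G` generate, modulo null sets, the whole
`σ`-algebra of `X`. -/
def HasFiniteGeneratingPartition (A : PMPSystem G X) : Prop :=
  ∃ (m : ℕ) (f : X → Fin m), Measurable f ∧
    ∀ D : Set X, MeasurableSet D →
      ∃ E : Set X, MeasurableSet[⨆ g : G, MeasurableSpace.comap (fun x => f (A.T g x)) ⊤] E ∧
        E =ᵐ[A.μ] D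

end PMPSystem

/-! ### Sofic entropy of systems -/

/-- A compact generating metric on a measurable space `X`: a compact metric whose Borel sets are
the measurable sets of `X`. -/
structure CompactGenMetric (X : Type*) [MeasurableSpace X] where
  metric : MetricSpace X
  compact : CompactSpace X
  borel : BorelSpace X
theorem CompactGenMetric.ofEquiv {X K : Type*} [MeasurableSpace X] [mK : MetricSpace K]
    [CompactSpace K] [MeasurableSpace K] [bK : BorelSpace K] (e : X ≃ᵐ K) :
    Nonempty (CompactGenMetric X) := by
  let m : MetricSpace X := MetricSpace.induced e e.injective mK
  have hind : Topology.IsInducing e := ⟨rfl⟩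
  have hemb : Topology.IsClosedEmbedding e :=
    ⟨⟨hind, e.injective⟩, by rw [e.surjective.range_eq]; exact isClosed_univ⟩
  refine ⟨⟨m, hemb.compactSpace, ⟨?_⟩⟩⟩
  have h1 := e.measurableEmbedding.comap_eq
  have h2 : MeasurableSpace.comap e (_root_.borel K) = _root_.borel X := by
    rw [hind.eq_induced, borel_comap]
  rw [← h1, ← h2, ← bK.measurable_eq]

/-- Every standard Borel space has a compact generating metric. -/
theorem CompactGenMetric.exists_metric (X : Type*) [MeasurableSpace X] [StandardBorelSpace X] :
    Nonempty (CompactGenMetric X) := by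
  by_cases hc : Countable X
  · have key : ∀ K : Set ℝ, IsCompact K → K.Countable → Nonempty (X ≃ K) →
        Nonempty (CompactGenMetric X) := by
      rintro K hK hK' ⟨e⟩
      have : CompactSpace K := isCompact_iff_compactSpace.mp hK
      have : Countable K := hK'.to_subtype
      exact ofEquiv (K := K) ⟨e, measurable_of_countable _, measurable_of_countable _⟩
    cases finite_or_infinite X
    · obtain ⟨n, ⟨e⟩⟩ := Finite.exists_equiv_fin X
      have hinj : Function.Injective (fun i : Fin n => ((i : ℕ) : ℝ)) :=
        Nat.cast_injective.comp Fin.val_injective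
      exact key _ (finite_range _).isCompact (countable_range _)
        ⟨e.trans (Equiv.ofInjective _ hinj)⟩
    · let K : Set ℝ := insert 0 (range (fun n : ℕ => 1 / ((n : ℝ) + 1)))
      have hK : IsCompact K :=
        (tendsto_one_div_add_atTop_nhds_zero_nat (𝕜 := ℝ)).isCompact_insert_range
      have hK' : K.Countable := (countable_range _).insert 0
      have : Countable K := hK'.to_subtype
      have : Infinite K := by
        rw [Set.infinite_coe_iff]
        refine (infinite_range_of_injective ?_).mono (subset_insert _ _)
        intro a b h
        simpa using h
      exact key K hK hK'
        ⟨(nonempty_denumerable X).some.eqv.trans (nonempty_denumerable K).some.eqv.symm⟩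
  · refine ofEquiv (K := Icc (0 : ℝ) 1) (PolishSpace.measurableEquivOfNotCountable hc ?_)
    rw [Set.countable_coe_iff]
    intro h
    have := Set.Countable.measure_zero h volume
    simp at this

section SystemEntropy

variable {G : Type*} [Group G] [Countable G] {X : Type*} [MeasurableSpace X]
  {V : ℕ → Type*} [∀ n, Fintype (V n)] [∀ n, Nonempty (V n)]

/-- The sofic entropy of the system `A` along `σ`, computed through the shift-system of `A` and the
compact generating metric `d` on `X`. (Its value does not depend on `d`.) -/
noncomputable def soficEntropy (σ : ∀ n, G → Equiv.Perm (V n)) (d : CompactGenMetric X)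
    (A : PMPSystem G X) : EReal :=
  letI := d.metric
  haveI := d.compact
  haveI := d.borel
  procEntropy σ A.processLaw

/-- The lower sofic entropy of the system `A` along `σ`. -/
noncomputable def lowerSoficEntropy (σ : ∀ n, G → Equiv.Perm (V n)) (d : CompactGenMetric X)
    (A : PMPSystem G X) : EReal :=
  letI := d.metric
  haveI := d.compact
  haveI := d.borel
  procLowerEntropy σ A.processLaw

end SystemEntropy

/-! ### Frequencies of events in finite sets -/

section Freq

open scoped Classical BigOperators

variable {V : Type*} [Fintype V]

/-- The proportion of the elements of a finite set that satisfy `P`. -/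
noncomputable def freq (P : V → Prop) : ℝ := 𝔼 v, if P v then (1 : ℝ) else 0

theorem freq_eq_expect (P : V → Prop) [DecidablePred P] :
    freq P = 𝔼 v, if P v then (1 : ℝ) else 0 := by
  unfold freq; congr; funext v; congr

theorem freq_mono {P Q : V → Prop} (h : ∀ v, P v → Q v) : freq P ≤ freq Q := by
  refine Finset.expect_le_expect fun v _ => ?_
  by_cases hP : P v
  · simp [hP, h v hP]
  · simp only [hP, if_false]; split_ifs <;> norm_num

theorem freq_le_one (P : V → Prop) : freq P ≤ 1 := by
  rcases isEmpty_or_nonempty V with h | h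
  · simp [freq]
  · exact Finset.expect_le Finset.univ_nonempty fun v _ => by split_ifs <;> norm_num

theorem freq_or_le (P Q : V → Prop) : freq (fun v => P v ∨ Q v) ≤ freq P + freq Q := by
  rw [freq, freq, freq, ← Finset.expect_add_distrib]
  refine Finset.expect_le_expect fun v _ => ?_
  by_cases h1 : P v <;> by_cases h2 : Q v <;> simp [h1, h2]

theorem freq_not [Nonempty V] (P : V → Prop) : freq (fun v => ¬ P v) = 1 - freq P := by
  rw [eq_sub_iff_add_eq, freq, freq, ← Finset.expect_add_distrib]
  rw [← Fintype.expect_const (ι := V) (1 : ℝ)]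
  refine Finset.expect_congr rfl fun v _ => ?_
  by_cases h : P v <;> simp [h]

theorem freq_exists_le {ι : Type*} (s : Finset ι) (P : ι → V → Prop) :
    freq (fun v => ∃ i ∈ s, P i v) ≤ ∑ i ∈ s, freq (P i) := by
  induction s using Finset.induction_on with
  | empty => simp [freq]
  | insert a s ha ih =>
    rw [Finset.sum_insert ha]
    refine le_trans (le_trans (freq_mono (Q := fun v => P a v ∨ ∃ i ∈ s, P i v) ?_)
      (freq_or_le _ _)) (by gcongr)
    rintro v ⟨i, hi, h⟩
    rcases Finset.mem_insert.mp hi with rfl | hi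
    · exact Or.inl h
    · exact Or.inr ⟨i, hi, h⟩

theorem freq_comp_equiv {W : Type*} [Fintype W] (e : V ≃ W) (P : W → Prop) :
    freq (fun v => P (e v)) = freq P :=
  Fintype.expect_equiv e _ _ fun _ => rfl

theorem freq_eq_card_div (P : V → Prop) :
    freq P = (Nat.card {v : V // P v} : ℝ) / (Nat.card V : ℝ) := by
  rw [freq, Fintype.expect_eq_sum_div_card, Finset.sum_boole, Nat.card_eq_fintype_card,
    Nat.card_eq_fintype_card, Fintype.card_subtype]

theorem freq_fst {W : Type*} [Fintype W] [Nonempty W] (P : V → Prop) :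
    freq (fun p : V × W => P p.1) = freq P := by
  rw [freq, ← Finset.univ_product_univ, Finset.expect_product]
  exact Finset.expect_congr rfl fun v _ =>
    Finset.expect_const (Finset.univ_nonempty (α := W)) (if P v then (1 : ℝ) else 0)

theorem freq_snd {W : Type*} [Fintype W] [Nonempty W] (P : V → Prop) :
    freq (fun p : W × V => P p.2) = freq P := by
  rw [freq, ← Finset.univ_product_univ, Finset.expect_product]
  exact Finset.expect_const (Finset.univ_nonempty (α := W)) (freq P)

/-- The laws of two functions on a finite set that mostly agree are close. -/
theorem sum_abs_freq_sub_le {K : Type*} [Fintype K] (P Q : V → K) :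
    ∑ k, |freq (fun v => P v = k) - freq (fun v => Q v = k)| ≤ 2 * freq (fun v => P v ≠ Q v) := by
  calc _ ≤ ∑ k, 𝔼 v, |(if P v = k then (1 : ℝ) else 0) - (if Q v = k then (1 : ℝ) else 0)| := by
        refine Finset.sum_le_sum fun k _ => ?_
        rw [freq, freq, ← Finset.expect_sub_distrib]
        exact Finset.abs_expect_le _ _
    _ = 𝔼 v, ∑ k, |(if P v = k then (1 : ℝ) else 0) - (if Q v = k then (1 : ℝ) else 0)| := by
        rw [Finset.expect_sum_comm]
    _ ≤ 𝔼 v, 2 * (if P v ≠ Q v then (1 : ℝ) else 0) := by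
        refine Finset.expect_le_expect fun v _ => ?_
        by_cases h : P v = Q v
        · simp [h]
        · simp only [ne_eq, h, not_false_eq_true, if_true, mul_one]
          calc _ ≤ ∑ k, ((if P v = k then (1 : ℝ) else 0) + (if Q v = k then (1 : ℝ) else 0)) := by
                refine Finset.sum_le_sum fun k _ => ?_
                split_ifs <;> norm_num
            _ = 2 := by rw [Finset.sum_add_distrib]; simp; norm_num
    _ = _ := by rw [freq_eq_expect, Finset.mul_expect]

end Freq

/-- The laws of two random variables that mostly agree are close. -/
theorem sum_abs_measureReal_sub_le {Ω K : Type*} [MeasurableSpace Ω] (μ : Measure Ω)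
    [IsFiniteMeasure μ] [Fintype K] [MeasurableSpace K] [MeasurableSingletonClass K]
    {P Q : Ω → K} (hP : Measurable P) (hQ : Measurable Q) :
    ∑ k, |μ.real {x | P x = k} - μ.real {x | Q x = k}| ≤ 2 * μ.real {x | P x ≠ Q x} := by
  have hPk : ∀ k, MeasurableSet {x | P x = k} := fun k => hP (measurableSet_singleton k)
  have hQk : ∀ k, MeasurableSet {x | Q x = k} := fun k => hQ (measurableSet_singleton k)
  have hD : MeasurableSet {x | P x ≠ Q x} := (measurableSet_eq_fun hP hQ).compl
  have key : ∀ {R : Ω → K}, (∀ k, MeasurableSet {x | R x = k}) →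
      ∑ k, μ.real ({x | P x ≠ Q x} ∩ {x | R x = k}) = μ.real {x | P x ≠ Q x} := by
    intro R hR
    rw [← measureReal_biUnion_finset]
    · congr 1; ext x; simp
    · intro a _ b _ hab
      refine Set.disjoint_left.mpr ?_
      rintro x ⟨_, h1⟩ ⟨_, h2⟩
      exact hab (h1.symm.trans h2)
    · exact fun k _ => hD.inter (hR k)
  have hle : ∀ k, |μ.real {x | P x = k} - μ.real {x | Q x = k}| ≤
      μ.real ({x | P x ≠ Q x} ∩ {x | P x = k}) + μ.real ({x | P x ≠ Q x} ∩ {x | Q x = k}) := by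
    intro k
    have h1 := measureReal_inter_add_sdiff (μ := μ) (s := {x | P x = k}) hD
    have h2 := measureReal_inter_add_sdiff (μ := μ) (s := {x | Q x = k}) hD
    have h3 : {x | P x = k} \ {x | P x ≠ Q x} = {x | Q x = k} \ {x | P x ≠ Q x} := by
      ext x
      simp only [Set.mem_sdiff, mem_ofPred_eq, not_not]
      exact ⟨fun ⟨a, b⟩ => ⟨b ▸ a, b⟩, fun ⟨a, b⟩ => ⟨b ▸ a, b⟩⟩
    rw [inter_comm] at h1 h2
    rw [h3] at h1
    have h4 : 0 ≤ μ.real ({x | P x ≠ Q x} ∩ {x | P x = k}) := measureReal_nonneg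
    have h5 : 0 ≤ μ.real ({x | P x ≠ Q x} ∩ {x | Q x = k}) := measureReal_nonneg
    rw [abs_le]; constructor <;> linarith
  refine (Finset.sum_le_sum fun k _ => hle k).trans ?_
  rw [Finset.sum_add_distrib, key hPk, key hQk]; linarith

/-! ### Finite models of a system -/

section Models

open scoped Classical BigOperators

variable {Γ : Type*} {V : Type*} {A A' B : Type*}

/-- The pattern that `a` shows in the window `F` at the vertex `v`. -/
def pattern (s : Γ → Equiv.Perm V) (F : Finset Γ) (a : V → A) (v : V) : F → A :=
  fun g => a (s g v)

namespace PMPSystem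

variable [Group Γ] {X : Type*} [MeasurableSpace X]

/-- The pattern that the orbit of `x` shows in the window `F` through the observable `α`. -/
def orbitPattern (S : PMPSystem Γ X) (α : X → A) (F : Finset Γ) (x : X) : F → A :=
  fun g => α (S.T g x)

theorem T_mul (S : PMPSystem Γ X) (g h : Γ) (x : X) : S.T g (S.T h x) = S.T (g * h) x := by
  rw [map_mul]; rfl

theorem T_one (S : PMPSystem Γ X) (x : X) : S.T 1 x = x := by rw [map_one]; rfl

theorem measurable_T (S : PMPSystem Γ X) (g : Γ) : Measurable (S.T g : X → X) :=
  (S.measurePreserving g).measurable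

theorem measurable_orbitPattern (S : PMPSystem Γ X) [MeasurableSpace A] {α : X → A}
    (hα : Measurable α) (F : Finset Γ) : Measurable (S.orbitPattern α F) :=
  measurable_pi_lambda _ fun g => hα.comp (S.measurable_T g)

theorem measureReal_preimage_T (S : PMPSystem Γ X) (g : Γ) {D : Set X} (hD : MeasurableSet D) :
    S.μ.real {x | S.T g x ∈ D} = S.μ.real D :=
  (S.measurePreserving g).measureReal_preimage hD.nullMeasurableSet

end PMPSystem

variable [Group Γ] {X : Type*} [MeasurableSpace X] [Fintype V]

/-- The distance in total variation between the distribution of the `F`-patterns of `a` and the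
law of the `F`-patterns of the observable `α`. -/
noncomputable def defect (S : PMPSystem Γ X) (s : Γ → Equiv.Perm V) (α : X → A) [Fintype A]
    (F : Finset Γ) (a : V → A) : ℝ :=
  ∑ p : F → A, |freq (fun v => pattern s F a v = p) - S.μ.real {x | S.orbitPattern α F x = p}|

theorem defect_eq_sum (S : PMPSystem Γ X) (s : Γ → Equiv.Perm V) (α : X → A) [Fintype A]
    (F : Finset Γ) [Fintype (F → A)] (a : V → A) : defect S s α F a = ∑ p : F → A,
      |freq (fun v => pattern s F a v = p) - S.μ.real {x | S.orbitPattern α F x = p}| :=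
  Finset.sum_congr (by ext; simp) fun _ _ => rfl

theorem sum_freq_eq_mul {K : Type*} [Fintype K] (P : V → K) (f : K → ℝ) :
    ∑ k, freq (fun v => P v = k) * f k = 𝔼 v, f (P v) := by
  simp only [freq, Finset.expect_mul]
  rw [← Finset.expect_sum_comm]
  refine Finset.expect_congr rfl fun v _ => ?_
  simp

theorem sum_measureReal_eq_mul {Ω K : Type*} [MeasurableSpace Ω] (μ : Measure Ω)
    [IsFiniteMeasure μ] [Fintype K] [MeasurableSpace K] [MeasurableSingletonClass K]
    {P : Ω → K} (hP : Measurable P) (f : K → ℝ) :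
    ∑ k, μ.real {x | P x = k} * f k = ∫ x, f (P x) ∂μ := by
  have hf : Measurable f := measurable_of_countable f
  rw [← integral_map hP.aemeasurable hf.aestronglyMeasurable, integral_fintype]
  · refine Finset.sum_congr rfl fun k _ => ?_
    rw [map_measureReal_apply hP (measurableSet_singleton k)]; rfl
  · exact Integrable.of_finite

variable [Fintype A] [MeasurableSpace A] [MeasurableSingletonClass A]

/-- Empirical averages of a local function over a model approximate its integral. -/
theorem abs_expect_sub_integral_le (S : PMPSystem Γ X) (s : Γ → Equiv.Perm V) {α : X → A}
    (hα : Measurable α) (F : Finset Γ) (a : V → A) (f : (F → A) → ℝ) {M : ℝ}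
    (hf : ∀ p, |f p| ≤ M) :
    |𝔼 v, f (pattern s F a v) - ∫ x, f (S.orbitPattern α F x) ∂S.μ| ≤ M * defect S s α F a := by
  rw [← sum_freq_eq_mul, ← sum_measureReal_eq_mul S.μ (S.measurable_orbitPattern hα F),
    ← Finset.sum_sub_distrib, defect, Finset.mul_sum]
  refine (Finset.abs_sum_le_sum_abs _ _).trans (Finset.sum_le_sum fun p _ => ?_)
  rw [← sub_mul, abs_mul, mul_comm]
  exact mul_le_mul_of_nonneg_right (hf p) (abs_nonneg _)

theorem abs_freq_sub_measureReal_le (S : PMPSystem Γ X) (s : Γ → Equiv.Perm V) {α : X → A}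
    (hα : Measurable α) (F : Finset Γ) (a : V → A) (P : (F → A) → Prop) :
    |freq (fun v => P (pattern s F a v)) - S.μ.real {x | P (S.orbitPattern α F x)}| ≤
      defect S s α F a := by
  have h := abs_expect_sub_integral_le S s hα F a (fun p => if P p then (1 : ℝ) else 0) (M := 1)
    (fun p => by split_ifs <;> simp)
  rw [one_mul] at h
  have hm : MeasurableSet {x | P (S.orbitPattern α F x)} :=
    S.measurable_orbitPattern hα F (MeasurableSet.of_discrete (s := {p | P p}))
  have e : (fun x => if P (S.orbitPattern α F x) then (1 : ℝ) else 0) =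
      {x | P (S.orbitPattern α F x)}.indicator 1 := by
    ext x; simp [Set.indicator_apply]
  rwa [e, integral_indicator_one hm] at h

variable [Fintype A'] [MeasurableSpace A'] [MeasurableSingletonClass A']

/-- The defect of the image of a model under a local map that computes, up to small errors, the
patterns of another observable. -/
theorem defect_le_of_local (S : PMPSystem Γ X) [Nonempty V] (s : Γ → Equiv.Perm V) {α : X → A}
    {α' : X → A'} (hα : Measurable α) (hα' : Measurable α') (F F' : Finset Γ) (a : V → A)
    (a' : V → A') (Φ : (F → A) → (F' → A')) :
    defect S s α' F' a' ≤ defect S s α F a +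
      2 * freq (fun v => pattern s F' a' v ≠ Φ (pattern s F a v)) +
      2 * S.μ.real {x | S.orbitPattern α' F' x ≠ Φ (S.orbitPattern α F x)} := by
  have hp := S.measurable_orbitPattern hα F
  have hp' := S.measurable_orbitPattern hα' F'
  have hΦ : Measurable Φ := measurable_of_countable Φ
  have h1 := sum_abs_freq_sub_le (pattern s F' a') (fun v => Φ (pattern s F a v))
  have h2 := sum_abs_measureReal_sub_le S.μ hp' (hΦ.comp hp)
  have h3 : ∑ p', |freq (fun v => Φ (pattern s F a v) = p') -
      S.μ.real {x | Φ (S.orbitPattern α F x) = p'}| ≤ defect S s α F a := by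
    have e1 : ∀ p', freq (fun v => Φ (pattern s F a v) = p') =
        ∑ p, freq (fun v => pattern s F a v = p) * (if Φ p = p' then (1 : ℝ) else 0) :=
      fun p' => by rw [sum_freq_eq_mul (pattern s F a) fun p => if Φ p = p' then (1 : ℝ) else 0,
        freq_eq_expect]
    have e2 : ∀ p', S.μ.real {x | Φ (S.orbitPattern α F x) = p'} =
        ∑ p, S.μ.real {x | S.orbitPattern α F x = p} * (if Φ p = p' then (1 : ℝ) else 0) := by
      intro p'
      rw [sum_measureReal_eq_mul S.μ hp]
      have : (fun x => if Φ (S.orbitPattern α F x) = p' then (1 : ℝ) else 0) =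
          {x | Φ (S.orbitPattern α F x) = p'}.indicator 1 := by
        ext x; simp [Set.indicator_apply]
      rw [this, integral_indicator_one
        (show MeasurableSet {x | Φ (S.orbitPattern α F x) = p'} from
          (hΦ.comp hp) (measurableSet_singleton p'))]
    calc _ ≤ ∑ p', ∑ p, |freq (fun v => pattern s F a v = p) -
            S.μ.real {x | S.orbitPattern α F x = p}| * (if Φ p = p' then (1 : ℝ) else 0) := by
          refine Finset.sum_le_sum fun p' _ => ?_
          rw [e1, e2, ← Finset.sum_sub_distrib]
          refine (Finset.abs_sum_le_sum_abs _ _).trans (Finset.sum_le_sum fun p _ => ?_)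
          rw [← sub_mul, abs_mul]
          split_ifs <;> simp
      _ = defect S s α F a := by
          rw [Finset.sum_comm, defect]
          refine Finset.sum_congr rfl fun p _ => ?_
          rw [← Finset.mul_sum]; simp
  calc defect S s α' F' a' ≤ ∑ p', (|freq (fun v => pattern s F' a' v = p') -
          freq (fun v => Φ (pattern s F a v) = p')| +
        |freq (fun v => Φ (pattern s F a v) = p') -
          S.μ.real {x | Φ (S.orbitPattern α F x) = p'}| +
        |S.μ.real {x | S.orbitPattern α' F' x = p'} -
          S.μ.real {x | Φ (S.orbitPattern α F x) = p'}|) := by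
        refine Finset.sum_le_sum fun p' _ => ?_
        rw [abs_sub_comm (S.μ.real {x | S.orbitPattern α' F' x = p'})]
        refine (abs_sub_le _ (freq (fun v => Φ (pattern s F a v) = p')) _).trans ?_
        rw [add_assoc]
        gcongr
        exact abs_sub_le _ _ _
    _ ≤ _ := by
        rw [Finset.sum_add_distrib, Finset.sum_add_distrib]
        simp only [Function.comp_apply] at h2
        linarith

/-- Shrinking the window and coarsening the alphabet do not increase the defect. -/
theorem defect_comp_le (S : PMPSystem Γ X) [Nonempty V] (s : Γ → Equiv.Perm V) {α : X → A}
    (hα : Measurable α) (φ : A → A') {F F' : Finset Γ} (h : F' ⊆ F) (a : V → A) :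
    defect S s (fun x => φ (α x)) F' (fun v => φ (a v)) ≤ defect S s α F a := by
  have hφ : Measurable fun x => φ (α x) := (measurable_of_countable φ).comp hα
  refine (defect_le_of_local S s hα hφ F F' a _
    fun p (g : F') => φ (p ⟨g, h g.2⟩)).trans (le_of_eq ?_)
  have e1 : ∀ x, S.orbitPattern (fun x => φ (α x)) F' x =
    fun g : F' => φ (S.orbitPattern α F x ⟨g, h g.2⟩) := fun x => rfl
  have e2 : ∀ v, pattern s F' (fun v => φ (a v)) v =
    fun g : F' => φ (pattern s F a v ⟨g, h g.2⟩) := fun v => rfl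
  simp only [← e1, ← e2]
  simp [freq]

end Models

/-! ### Hamming balls -/

section Hamming

open scoped Classical BigOperators

theorem card_hamming_ball_le (B : Type*) [Fintype B] {η : ℝ} (hη : 0 < η) :
    ∃ κ > 0, ∀ (V : Type*) [Fintype V] (b₀ : V → B),
      (((Finset.univ : Finset (V → B)).filter fun b => freq (fun v => b v ≠ b₀ v) ≤ κ).card : ℝ) ≤
        Real.exp (η * Fintype.card V) := by
  set m : ℝ := (Fintype.card B : ℝ)
  have hm : 0 ≤ m := Nat.cast_nonneg _
  obtain ⟨c, hc, hc1⟩ : ∃ c : ℝ, 0 < c ∧ m * Real.exp (-c) ≤ η / 2 := by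
    have : Tendsto (fun c : ℝ => m * Real.exp (-c)) atTop (𝓝 (m * 0)) :=
      (Real.tendsto_exp_neg_atTop_nhds_zero).const_mul m
    rw [mul_zero] at this
    obtain ⟨c, h1, h2⟩ := ((this.eventually_lt_const (half_pos hη)).and
      (eventually_gt_atTop 0)).exists
    exact ⟨c, h2, h1.le⟩
  refine ⟨η / (2 * c), by positivity, fun V _ b₀ => ?_⟩
  set n : ℝ := (Fintype.card V : ℝ)
  have hsum : ∑ b : V → B, ∏ v, (if b v = b₀ v then (1 : ℝ) else Real.exp (-c)) ≤
      Real.exp (η / 2 * n) := by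
    have := (Finset.prod_univ_sum (fun _ : V => (Finset.univ : Finset B))
      (fun v y => if y = b₀ v then (1 : ℝ) else Real.exp (-c))).symm
    rw [Fintype.piFinset_univ] at this
    rw [this]
    calc _ ≤ ∏ _v : V, Real.exp (η / 2) := by
          refine Finset.prod_le_prod (fun v _ => Finset.sum_nonneg fun y _ => ?_) fun v _ => ?_
          · split_ifs <;> positivity
          · calc _ ≤ ∑ y : B, ((if y = b₀ v then (1 : ℝ) else 0) + Real.exp (-c)) := by
                  refine Finset.sum_le_sum fun y _ => ?_
                  split_ifs
                  · linarith [Real.exp_pos (-c)]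
                  · simp
              _ = 1 + m * Real.exp (-c) := by simp [Finset.sum_add_distrib, m]
              _ ≤ η / 2 + 1 := by linarith
              _ ≤ _ := Real.add_one_le_exp _
      _ = _ := by
          rw [Finset.prod_const, ← Real.exp_nat_mul, mul_comm]; rfl
  have hterm : ∀ b ∈ (Finset.univ : Finset (V → B)).filter
      fun b => freq (fun v => b v ≠ b₀ v) ≤ η / (2 * c),
      Real.exp (-(η / 2 * n)) ≤ ∏ v, (if b v = b₀ v then (1 : ℝ) else Real.exp (-c)) := by
    intro b hb
    have hb' := (Finset.mem_filter.mp hb).2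
    have e : ∏ v, (if b v = b₀ v then (1 : ℝ) else Real.exp (-c)) =
        Real.exp (∑ v, (-c) * (if b v ≠ b₀ v then (1 : ℝ) else 0)) := by
      rw [Real.exp_sum]
      refine Finset.prod_congr rfl fun v _ => ?_
      by_cases h : b v = b₀ v <;> simp [h]
    rw [e]
    apply Real.exp_le_exp.mpr
    rw [← Finset.mul_sum]
    rcases isEmpty_or_nonempty V with hV | hV
    · simp [n]
    have hn : 0 < n := by simp only [n]; exact_mod_cast Fintype.card_pos
    rw [freq_eq_expect, Fintype.expect_eq_sum_div_card, div_le_div_iff₀ hn (by positivity)] at hb'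
    nlinarith
  have := Finset.sum_le_sum hterm
  rw [Finset.sum_const, nsmul_eq_mul] at this
  have h2 := this.trans ((Finset.sum_le_sum_of_subset_of_nonneg (Finset.subset_univ _) fun b _ _ =>
    Finset.prod_nonneg fun v _ => by split_ifs <;> positivity).trans hsum)
  rw [Real.exp_neg, ← div_eq_mul_inv, div_le_iff₀ (Real.exp_pos _), ← Real.exp_add] at h2
  refine h2.trans (le_of_eq ?_)
  congr 1; ring

/-- A set of configurations lying in Hamming balls around the members of a family. -/
theorem exists_card_le_of_hamming_cover (B : Type*) [Fintype B] {η : ℝ} (hη : 0 < η) :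
    ∃ κ > 0, ∀ (V : Type*) [Fintype V] {ι : Type*} (S : Finset (V → B)) (R : Finset ι)
      (f : ι → V → B), (∀ b ∈ S, ∃ r ∈ R, freq (fun v => b v ≠ f r v) ≤ κ) →
      (S.card : ℝ) ≤ Real.exp (η * Fintype.card V) * R.card := by
  obtain ⟨κ, hκ, h⟩ := card_hamming_ball_le B hη
  refine ⟨κ, hκ, fun V _ ι S R f hS => ?_⟩
  have hsub : S ⊆ R.biUnion fun r => (Finset.univ : Finset (V → B)).filter
      fun b => freq (fun v => b v ≠ f r v) ≤ κ := by
    intro b hb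
    obtain ⟨r, hr, h⟩ := hS b hb
    exact Finset.mem_biUnion.mpr ⟨r, hr, by simpa using h⟩
  calc (S.card : ℝ) ≤ ∑ r ∈ R, (((Finset.univ : Finset (V → B)).filter
        fun b => freq (fun v => b v ≠ f r v) ≤ κ).card : ℝ) := by
        exact_mod_cast (Finset.card_le_card hsub).trans Finset.card_biUnion_le
    _ ≤ ∑ _r ∈ R, Real.exp (η * Fintype.card V) := Finset.sum_le_sum fun r _ => h V (f r)
    _ = _ := by rw [Finset.sum_const, nsmul_eq_mul, mul_comm]

end Hamming

/-! ### Exponential growth rates -/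

theorem log_div_le_add {a b : ℝ≥0∞} {η : ℝ} {c : ℕ} (hc : c ≠ 0)
    (h : a ≤ ENNReal.ofReal (Real.exp (η * c)) * b) :
    ENNReal.log a / (c : EReal) ≤ ENNReal.log b / (c : EReal) + (η : EReal) := by
  have h1 := ENNReal.log_le_log h
  rw [ENNReal.log_mul_add, ENNReal.log_ofReal_of_pos (Real.exp_pos _), Real.log_exp] at h1
  have hc0 : (0 : EReal) ≤ (c : EReal) := by exact_mod_cast Nat.zero_le c
  refine (EReal.div_le_div_right_of_nonneg hc0 h1).trans (le_of_eq ?_)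
  rw [EReal.add_div_of_nonneg_right hc0, add_comm]
  congr 1
  rw [← EReal.coe_coe_eq_natCast, ← EReal.coe_div, mul_div_cancel_right₀ _ (by exact_mod_cast hc)]

/-- The properties shared by `limsup` and `liminf` along a sequence. -/
structure IsLimitFunctional (L : (ℕ → EReal) → EReal) : Prop where
  mono : ∀ u v : ℕ → EReal, (∀ᶠ n in atTop, u n ≤ v n) → L u ≤ L v
  add_const : ∀ (u : ℕ → EReal) (c : ℝ), L (fun n => u n + (c : EReal)) ≤ L u + (c : EReal)

theorem isLimitFunctional_limsup : IsLimitFunctional (fun u => limsup u atTop) where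
  mono _ _ h := limsup_le_limsup h
  add_const u c := by
    have h := EReal.limsup_add_le (f := atTop) (u := u) (v := fun _ : ℕ => (c : EReal))
      (Or.inr (by simp)) (Or.inr (by simp))
    rwa [limsup_const] at h

theorem isLimitFunctional_liminf : IsLimitFunctional (fun u => liminf u atTop) where
  mono _ _ h := liminf_le_liminf h
  add_const u c := by
    have h := EReal.liminf_add_le (f := atTop) (u := fun _ : ℕ => (c : EReal)) (v := u)
      (Or.inl (by simp)) (Or.inl (by simp))
    rw [limsup_const, add_comm _ (liminf u atTop), add_comm _ u] at h
    exact h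

/-! ### Entropy through finite observables -/

section ObservableEntropy

open scoped Classical BigOperators

variable {Γ : Type*} [Group Γ] {X : Type*} [MeasurableSpace X] {V : Type*} [Fintype V]
  {A B : Type*} [Fintype A]

/-- The configurations whose `F`-patterns have almost the same distribution as the `F`-patterns
of the observable `α`. -/
noncomputable def models (S : PMPSystem Γ X) (s : Γ → Equiv.Perm V) (α : X → A) (F : Finset Γ)
    (ε : ℝ) : Finset (V → A) :=
  Finset.univ.filter fun a => defect S s α F a < ε

/-- The images of the models of `α` under a coarsening `π` of the alphabet. -/
noncomputable def modelImage (S : PMPSystem Γ X) (s : Γ → Equiv.Perm V) (α : X → A) (π : A → B)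
    (F : Finset Γ) (ε : ℝ) : Finset (V → B) :=
  (models S s α F ε).image fun a v => π (a v)

theorem mem_models {S : PMPSystem Γ X} {s : Γ → Equiv.Perm V} {α : X → A} {F : Finset Γ} {ε : ℝ}
    {a : V → A} : a ∈ models S s α F ε ↔ defect S s α F a < ε := by
  simp [models]

theorem mem_modelImage {S : PMPSystem Γ X} {s : Γ → Equiv.Perm V} {α : X → A} {π : A → B}
    {F : Finset Γ} {ε : ℝ} {b : V → B} :
    b ∈ modelImage S s α π F ε ↔ ∃ a, defect S s α F a < ε ∧ (fun v => π (a v)) = b := by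
  simp [modelImage, mem_models]

end ObservableEntropy

section ObservableEntropy

open scoped Classical BigOperators

variable {Γ : Type*} [Group Γ] {X : Type*} [MeasurableSpace X] {V : ℕ → Type*}
  [∀ n, Fintype (V n)] {A A' B B' : Type*} [Fintype A]

/-- The exponential rate of the number of images of models. -/
noncomputable def modelRate (S : PMPSystem Γ X) (s : ∀ n, Γ → Equiv.Perm (V n)) (α : X → A)
    (π : A → B) (F : Finset Γ) (ε : ℝ) (n : ℕ) : EReal :=
  ENNReal.log ((modelImage S (s n) α π F ε).card : ℝ≥0∞) / (Fintype.card (V n) : EReal)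

/-- The entropy of the finite observable `β` in the system `S`: the growth rate of the number of
`β`-names that come from good models of arbitrarily fine observables. -/
noncomputable def observableEntropy (L : (ℕ → EReal) → EReal) (S : PMPSystem Γ X)
    (s : ∀ n, Γ → Equiv.Perm (V n)) (β : X → B) : EReal :=
  ⨅ (m : ℕ) (α : X → Fin m) (π : Fin m → B) (F : Finset Γ) (ε : ℝ)
    (_ : Measurable α ∧ 0 < ε ∧ ∀ x, π (α x) = β x), L (modelRate S s α π F ε)

/-- The supremum of the entropies of the finite observables of the system `S`. -/
noncomputable def partitionEntropy (L : (ℕ → EReal) → EReal) (S : PMPSystem Γ X)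
    (s : ∀ n, Γ → Equiv.Perm (V n)) : EReal :=
  ⨆ (m : ℕ) (β : X → Fin m) (_ : Measurable β), observableEntropy L S s β

theorem modelRate_mono {S : PMPSystem Γ X} {Y : Type*} [MeasurableSpace Y] {Λ : Type*} [Group Λ]
    {S' : PMPSystem Λ Y} {s : ∀ n, Γ → Equiv.Perm (V n)} {s' : ∀ n, Λ → Equiv.Perm (V n)}
    [Fintype A'] {α : X → A} {α' : Y → A'} {π : A → B} {π' : A' → B'} {F : Finset Γ} {F' : Finset Λ}
    {ε ε' : ℝ} {n : ℕ}
    (h : (modelImage S (s n) α π F ε).card ≤ (modelImage S' (s' n) α' π' F' ε').card) :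
    modelRate S s α π F ε n ≤ modelRate S' s' α' π' F' ε' n := by
  refine EReal.div_le_div_right_of_nonneg (by exact_mod_cast Nat.zero_le _)
    (ENNReal.log_le_log (by exact_mod_cast h))

variable [∀ n, Nonempty (V n)]

theorem modelRate_le_add {S : PMPSystem Γ X} {Y : Type*} [MeasurableSpace Y] {Λ : Type*} [Group Λ]
    {S' : PMPSystem Λ Y} {s : ∀ n, Γ → Equiv.Perm (V n)} {s' : ∀ n, Λ → Equiv.Perm (V n)}
    [Fintype A'] {α : X → A} {α' : Y → A'} {π : A → B} {π' : A' → B'} {F : Finset Γ} {F' : Finset Λ}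
    {ε ε' η : ℝ} {n : ℕ}
    (h : ((modelImage S (s n) α π F ε).card : ℝ) ≤
      Real.exp (η * Fintype.card (V n)) * (modelImage S' (s' n) α' π' F' ε').card) :
    modelRate S s α π F ε n ≤ modelRate S' s' α' π' F' ε' n + (η : EReal) := by
  refine log_div_le_add Fintype.card_ne_zero ?_
  rw [← ENNReal.ofReal_natCast, ← ENNReal.ofReal_natCast,
    ← ENNReal.ofReal_mul (Real.exp_pos _).le]
  exact ENNReal.ofReal_le_ofReal h

theorem observableEntropy_le {L : (ℕ → EReal) → EReal} (hL : IsLimitFunctional L)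
    (S : PMPSystem Γ X) (s : ∀ n, Γ → Equiv.Perm (V n)) (β : X → B) [MeasurableSpace A]
    [MeasurableSingletonClass A] {α : X → A} (hα : Measurable α) {π : A → B}
    (hπ : ∀ x, π (α x) = β x) (F : Finset Γ) {ε : ℝ} (hε : 0 < ε) :
    observableEntropy L S s β ≤ L (modelRate S s α π F ε) := by
  set e := Fintype.equivFin A
  have hα' : Measurable fun x => e (α x) := (measurable_of_countable e).comp hα
  refine le_trans (b := L (modelRate S s (fun x => e (α x)) (fun i => π (e.symm i)) F ε))
    (iInf_le_of_le (Fintype.card A) (iInf_le_of_le (fun x => e (α x)) (iInf_le_of_le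
      (fun i => π (e.symm i)) (iInf_le_of_le F (iInf_le_of_le ε (iInf_le_of_le
        ⟨hα', hε, by simpa using hπ⟩ le_rfl)))))) ?_
  refine hL.mono _ _ (Eventually.of_forall fun n => modelRate_mono (Finset.card_le_card ?_))
  intro b hb
  obtain ⟨a, ha, rfl⟩ := mem_modelImage.mp hb
  refine mem_modelImage.mpr ⟨fun v => e.symm (a v), lt_of_le_of_lt ?_ ha, rfl⟩
  have h := defect_comp_le S (s n) hα' e.symm (Finset.Subset.refl F) a
  simpa using h

theorem observableEntropy_le_partitionEntropy {L : (ℕ → EReal) → EReal}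
    (hL : IsLimitFunctional L) (S : PMPSystem Γ X) (s : ∀ n, Γ → Equiv.Perm (V n))
    [MeasurableSpace A] [MeasurableSingletonClass A] {β : X → A} (hβ : Measurable β) :
    observableEntropy L S s β ≤ partitionEntropy L S s := by
  set e := Fintype.equivFin A
  have hβ' : Measurable fun x => e (β x) := (measurable_of_countable e).comp hβ
  refine le_trans ?_ (le_iSup_of_le (Fintype.card A) (le_iSup_of_le (fun x => e (β x))
    (le_iSup_of_le hβ' le_rfl)))
  refine le_iInf fun m => le_iInf fun α => le_iInf fun π => le_iInf fun F => le_iInf fun ε =>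
    le_iInf fun ⟨h1, h2, h3⟩ => ?_
  refine (observableEntropy_le hL S s β h1 (π := fun i => e.symm (π i))
    (fun x => by simp [h3]) F h2).trans ?_
  refine hL.mono _ _ (Eventually.of_forall fun n => modelRate_mono ?_)
  refine le_trans (Finset.card_le_card fun b hb => ?_)
    (Finset.card_image_le (s := modelImage S (s n) α π F ε) (f := fun b v => e.symm (b v)))
  obtain ⟨a, ha, rfl⟩ := mem_modelImage.mp hb
  exact Finset.mem_image.mpr ⟨_, mem_modelImage.mpr ⟨a, ha, rfl⟩, rfl⟩

end ObservableEntropy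

/-! ### Asymptotic multiplicativity and freeness -/

section SoficFacts

variable {Γ : Type*} [Group Γ] {V : ℕ → Type*} [∀ n, Fintype (V n)] [∀ n, Nonempty (V n)]
  {s : ∀ n, Γ → Equiv.Perm (V n)}

theorem WHP.eventually_freq_not_lt {P : ∀ n, V n → Prop} (h : WHP P) {κ : ℝ} (hκ : 0 < κ) :
    ∀ᶠ n in atTop, freq (fun v => ¬ P n v) < κ := by
  have h' : Tendsto (fun n => freq (P n)) atTop (𝓝 1) := by
    simp only [freq_eq_card_div]; exact h
  filter_upwards [h'.eventually_const_lt (show 1 - κ < 1 by linarith)] with n hn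
  rw [freq_not]; linarith

theorem IsSoficApprox.eventually_mul (hs : IsSoficApprox s) (g h : Γ) {κ : ℝ} (hκ : 0 < κ) :
    ∀ᶠ n in atTop, freq (fun v => s n g (s n h v) ≠ s n (g * h) v) < κ :=
  (hs.mul g h).eventually_freq_not_lt hκ

theorem IsSoficApprox.eventually_one (hs : IsSoficApprox s) {κ : ℝ} (hκ : 0 < κ) :
    ∀ᶠ n in atTop, freq (fun v => s n 1 v ≠ v) < κ := by
  filter_upwards [hs.eventually_mul 1 1 hκ] with n hn
  rw [← freq_comp_equiv (s n 1)]
  simpa using hn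

theorem IsSoficApprox.eventually_mul_finset (hs : IsSoficApprox s) (E F : Finset Γ) {κ : ℝ}
    (hκ : 0 < κ) :
    ∀ᶠ n in atTop,
      freq (fun v => ∃ p ∈ (E ×ˢ F : Finset (Γ × Γ)), s n p.1 (s n p.2 v) ≠
        s n (p.1 * p.2) v) < κ := by
  have hκ' : 0 < κ / ((E ×ˢ F).card + 1) := by positivity
  have : ∀ᶠ n in atTop, ∀ p ∈ E ×ˢ F,
      freq (fun v => s n p.1 (s n p.2 v) ≠ s n (p.1 * p.2) v) < κ / ((E ×ˢ F).card + 1) :=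
    (Finset.eventually_all _).mpr fun p _ => hs.eventually_mul p.1 p.2 hκ'
  filter_upwards [this] with n hn
  refine (freq_exists_le _ fun (p : Γ × Γ) v => s n p.1 (s n p.2 v) ≠ s n (p.1 * p.2) v).trans_lt ?_
  refine (Finset.sum_le_sum fun p hp => (hn p hp).le).trans_lt ?_
  rw [Finset.sum_const, nsmul_eq_mul, mul_div_assoc', div_lt_iff₀ (by positivity)]
  nlinarith

theorem IsSoficApprox.eventually_ne (hs : IsSoficApprox s) {g h : Γ} (hgh : g ≠ h) {κ : ℝ}
    (hκ : 0 < κ) : ∀ᶠ n in atTop, freq (fun v => s n g v = s n h v) < κ := by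
  have hne : h⁻¹ * g ≠ 1 := fun h1 => hgh (by rw [inv_mul_eq_one] at h1; exact h1.symm)
  have hκ4 : 0 < κ / 4 := by positivity
  filter_upwards [hs.eventually_mul h⁻¹ g hκ4, hs.eventually_mul h⁻¹ h hκ4,
    hs.eventually_one hκ4, (hs.free _ hne).eventually_freq_not_lt hκ4] with n h1 h2 h3 h4
  rw [inv_mul_cancel] at h2
  have : freq (fun v => s n g v = s n h v) ≤
      freq (fun v => ((s n h⁻¹ (s n g v) ≠ s n (h⁻¹ * g) v) ∨ (s n h⁻¹ (s n h v) ≠ s n 1 v)) ∨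
        ((s n 1 v ≠ v) ∨ ¬ (s n (h⁻¹ * g) v ≠ v))) := by
    refine freq_mono fun v hv => ?_
    by_contra hc
    simp only [not_or, not_not] at hc
    obtain ⟨⟨c1, c2⟩, c3, c4⟩ := hc
    exact c4 (by rw [← c1, hv, c2, c3])
  have h5 := freq_or_le (fun v => (s n h⁻¹ (s n g v) ≠ s n (h⁻¹ * g) v) ∨
    (s n h⁻¹ (s n h v) ≠ s n 1 v)) (fun v => (s n 1 v ≠ v) ∨ ¬ (s n (h⁻¹ * g) v ≠ v))
  have h6 := freq_or_le (fun v => s n h⁻¹ (s n g v) ≠ s n (h⁻¹ * g) v)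
    (fun v => s n h⁻¹ (s n h v) ≠ s n 1 v)
  have h7 := freq_or_le (fun v => s n 1 v ≠ v) (fun v => ¬ (s n (h⁻¹ * g) v ≠ v))
  linarith

end SoficFacts

section Comparison

open scoped Classical BigOperators

variable {Γ : Type*} [Group Γ] {X : Type*} [MeasurableSpace X] {V : ℕ → Type*}
  [∀ n, Fintype (V n)] [∀ n, Nonempty (V n)] {s : ∀ n, Γ → Equiv.Perm (V n)}
  {A B : Type*} [Fintype A] [MeasurableSpace A] [MeasurableSingletonClass A]
  [Fintype B]

/-- If a finite observable `β` is, up to a small error, a function of finitely many translates of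
`β'`, then its entropy exceeds that of `β'` only a little. -/
theorem exists_observableEntropy_le_add {L : (ℕ → EReal) → EReal} (hL : IsLimitFunctional L)
    (hs : IsSoficApprox s) (S : PMPSystem Γ X) [MeasurableSpace B] [MeasurableSingletonClass B]
    {β : X → B} (hβ : Measurable β) {η : ℝ}
    (hη : 0 < η) :
    ∃ κ > 0, ∀ {B' : Type*} (β' : X → B') (E : Finset Γ) (ρ : (E → B') → B),
      S.μ.real {x | β x ≠ ρ fun k => β' (S.T k x)} < κ →
        observableEntropy L S s β ≤ observableEntropy L S s β' + (η : EReal) := by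
  obtain ⟨κ, hκ, hball⟩ := exists_card_le_of_hamming_cover B hη
  refine ⟨κ / 3, by positivity, fun {B'} β' E ρ hρ => ?_⟩
  rw [← EReal.sub_le_iff_le_add (Or.inl (by simp)) (Or.inl (by simp))]
  refine le_iInf fun m => le_iInf fun α => le_iInf fun π => le_iInf fun F => le_iInf fun ε =>
    le_iInf fun ⟨h1, h2, h3⟩ => ?_
  rw [EReal.sub_le_iff_le_add (Or.inl (by simp)) (Or.inl (by simp))]
  have hα₂ : Measurable fun x => (α x, β x) := h1.prodMk hβ
  set F₂ : Finset Γ := F ∪ (E ∪ {1})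
  have hF : ∀ g : F, (g : Γ) ∈ F₂ := fun g => Finset.mem_union_left _ g.2
  have hE : ∀ g : E, (g : Γ) ∈ F₂ := fun g =>
    Finset.mem_union_right _ (Finset.mem_union_left _ g.2)
  have h₁ : (1 : Γ) ∈ F₂ := by simp [F₂]
  have hε₂ : 0 < min ε (κ / 3) := by positivity
  refine (observableEntropy_le hL S s β hα₂ (π := Prod.snd) (fun x => rfl) F₂ hε₂).trans ?_
  refine le_trans (hL.mono _ _ ?_) (hL.add_const _ _)
  filter_upwards [hs.eventually_one (show 0 < κ / 3 by positivity)] with n hn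
  refine modelRate_le_add (hball (V n) _ (modelImage S (s n) α π F ε)
    (fun r v => ρ fun k => r (s n k v)) fun b hb => ?_)
  obtain ⟨a, ha, rfl⟩ := mem_modelImage.mp hb
  refine ⟨fun v => π (a v).1, mem_modelImage.mpr ⟨fun v => (a v).1, ?_, rfl⟩, ?_⟩
  · refine lt_of_le_of_lt ?_ (ha.trans_le (min_le_left _ _))
    exact defect_comp_le S (s n) hα₂ Prod.fst Finset.subset_union_left a
  · have key := abs_freq_sub_measureReal_le S (s n) hα₂ F₂ a fun p =>
      (p ⟨1, h₁⟩).2 ≠ ρ fun k => π (p ⟨k, hE k⟩).1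
    have e : {x | (S.orbitPattern (fun x => (α x, β x)) F₂ x ⟨1, h₁⟩).2 ≠
        ρ fun k => π (S.orbitPattern (fun x => (α x, β x)) F₂ x ⟨k, hE k⟩).1} =
        {x | β x ≠ ρ fun k => β' (S.T k x)} := by
      simp only [PMPSystem.orbitPattern, h3, S.T_one]
    rw [e] at key
    have h5 := (abs_le.mp key).2
    have h6 := ha.trans_le (min_le_right _ _)
    have h7 : freq (fun v => (a v).2 ≠ ρ fun k => π (a (s n k v)).1) ≤
        freq (fun v => ((pattern (s n) F₂ a v ⟨1, h₁⟩).2 ≠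
          ρ fun k => π (pattern (s n) F₂ a v ⟨k, hE k⟩).1) ∨ s n 1 v ≠ v) := by
      refine freq_mono fun v hv => ?_
      by_cases hc : s n 1 v = v
      · left
        simpa [pattern, hc] using hv
      · exact Or.inr hc
    have h8 := h7.trans (freq_or_le _ _)
    linarith

/-- Models of an observable `α'` induce models of every observable `α` that is, up to a small
error, a function of finitely many translates of `α'`. -/
theorem exists_models_of_local (hs : IsSoficApprox s) (S : PMPSystem Γ X) {α : X → A}
    (hα : Measurable α) (F : Finset Γ) {ε : ℝ} (hε : 0 < ε) :
    ∃ κ > 0, ∀ {A' : Type*} [Fintype A'] [MeasurableSpace A'] [MeasurableSingletonClass A']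
      {α' : X → A'}, Measurable α' → ∀ (E : Finset Γ) (ρ : (E → A') → A),
      S.μ.real {x | α x ≠ ρ fun k => α' (S.T k x)} < κ →
        ∀ᶠ n in atTop, ∀ a : V n → A',
          defect S (s n) α' ((E ×ˢ F).image fun p => p.1 * p.2) a < ε / 4 →
          defect S (s n) α F (fun v => ρ fun k => a (s n k v)) < ε := by
  refine ⟨ε / (4 * (F.card + 1)), by positivity, ?_⟩
  intro A' _ _ _ α' hα' E ρ hρ
  set F' := (E ×ˢ F).image fun p => p.1 * p.2
  have hF' : ∀ (k : E) (g : F), (k : Γ) * g ∈ F' := fun k g =>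
    Finset.mem_image.mpr ⟨(k, g), Finset.mem_product.mpr ⟨k.2, g.2⟩, rfl⟩
  filter_upwards [hs.eventually_mul_finset E F (show 0 < ε / 8 by positivity)] with n hn a ha
  refine (defect_le_of_local S (s n) hα' hα F' F a _
    fun p (g : F) => ρ fun k : E => p ⟨k * g, hF' k g⟩).trans_lt ?_
  have h1 : freq (fun v => pattern (s n) F (fun v => ρ fun k => a (s n k v)) v ≠
      fun g : F => ρ fun k : E => pattern (s n) F' a v ⟨k * g, hF' k g⟩) ≤
      freq (fun v => ∃ p ∈ (E ×ˢ F : Finset (Γ × Γ)),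
        s n p.1 (s n p.2 v) ≠ s n (p.1 * p.2) v) := by
    refine freq_mono fun v hv => ?_
    by_contra hc
    push Not at hc
    refine hv (funext fun g => ?_)
    simp only [pattern]
    congr 1
    funext k
    rw [hc (k, g) (Finset.mem_product.mpr ⟨k.2, g.2⟩)]
  have h2 : S.μ.real {x | S.orbitPattern α F x ≠
      fun g : F => ρ fun k : E => S.orbitPattern α' F' x ⟨k * g, hF' k g⟩} ≤ ε / 4 := by
    set D := {x | α x ≠ ρ fun k => α' (S.T k x)}
    have hD : MeasurableSet D := by
      refine (measurableSet_eq_fun hα ?_).compl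
      exact (measurable_of_countable ρ).comp
        (measurable_pi_lambda _ fun k => hα'.comp (S.measurable_T k))
    calc _ ≤ S.μ.real (⋃ g ∈ F, {x | S.T g x ∈ D}) := by
          refine measureReal_mono (fun x hx => ?_) (measure_ne_top _ _)
          simp only [mem_ofPred_eq, ne_eq, funext_iff, not_forall] at hx
          obtain ⟨g, hg⟩ := hx
          simp only [mem_iUnion]
          refine ⟨g, g.2, ?_⟩
          simpa [D, PMPSystem.orbitPattern, S.T_mul] using hg
      _ ≤ ∑ g ∈ F, S.μ.real {x | S.T g x ∈ D} := measureReal_biUnion_finset_le _ _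
      _ = F.card * S.μ.real D := by
          simp [S.measureReal_preimage_T _ hD]
      _ ≤ F.card * (ε / (4 * (F.card + 1))) := by gcongr
      _ ≤ ε / 4 := by
          rw [mul_div_assoc', div_le_iff₀ (by positivity)]
          nlinarith
  linarith

/-- Comparison of the numbers of names coming from two refinements `α`, `α'` of one observable,
if `α` is, up to a small error, a function of finitely many translates of `α'`. -/
theorem exists_card_modelImage_le (hs : IsSoficApprox s) (S : PMPSystem Γ X) {α : X → A}
    (hα : Measurable α) (π : A → B) (F : Finset Γ) {ε η : ℝ} (hε : 0 < ε) (hη : 0 < η) :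
    ∃ κ > 0, ∀ {A' : Type*} [Fintype A'] [MeasurableSpace A'] [MeasurableSingletonClass A']
      {α' : X → A'} (π' : A' → B), Measurable α' → (∀ x, π' (α' x) = π (α x)) →
      ∀ (E : Finset Γ) (ρ : (E → A') → A),
      S.μ.real {x | α x ≠ ρ fun k => α' (S.T k x)} < κ →
        ∃ (F' : Finset Γ) (ε' : ℝ), 0 < ε' ∧ ∀ᶠ n in atTop,
          ((modelImage S (s n) α' π' F' ε').card : ℝ) ≤
            Real.exp (η * Fintype.card (V n)) * (modelImage S (s n) α π F ε).card := by
  obtain ⟨κ₁, hκ₁, hT⟩ := exists_models_of_local hs S hα F hε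
  obtain ⟨κ₂, hκ₂, hball⟩ := exists_card_le_of_hamming_cover B hη
  refine ⟨min κ₁ (κ₂ / 3), by positivity, ?_⟩
  intro A' _ _ _ α' π' hα' hππ E ρ hρ
  set F₁ := (E ×ˢ F).image fun p => p.1 * p.2
  set F' := F₁ ∪ (E ∪ {1})
  have hF : ∀ g : F₁, (g : Γ) ∈ F' := fun g => Finset.mem_union_left _ g.2
  have hE : ∀ g : E, (g : Γ) ∈ F' := fun g =>
    Finset.mem_union_right _ (Finset.mem_union_left _ g.2)
  have h₁ : (1 : Γ) ∈ F' := by simp [F']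
  refine ⟨F', min (ε / 4) (κ₂ / 3), by positivity, ?_⟩
  filter_upwards [hT hα' E ρ (hρ.trans_le (min_le_left _ _)),
    hs.eventually_one (show 0 < κ₂ / 3 by positivity)] with n hn hn1
  refine hball (V n) _ _ (fun r => r) fun b hb => ?_
  obtain ⟨a, ha, rfl⟩ := mem_modelImage.mp hb
  refine ⟨_, mem_modelImage.mpr ⟨_, hn a ?_, rfl⟩, ?_⟩
  · refine lt_of_le_of_lt ?_ (ha.trans_le (min_le_left _ _))
    exact defect_comp_le S (s n) hα' id Finset.subset_union_left a
  · have key := abs_freq_sub_measureReal_le S (s n) hα' F' a fun p =>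
      π' (p ⟨1, h₁⟩) ≠ π (ρ fun k => p ⟨k, hE k⟩)
    have e : S.μ.real {x | π' (S.orbitPattern α' F' x ⟨1, h₁⟩) ≠
        π (ρ fun k => S.orbitPattern α' F' x ⟨k, hE k⟩)} < κ₂ / 3 := by
      refine lt_of_le_of_lt (measureReal_mono fun x hx => ?_) (hρ.trans_le (min_le_right _ _))
      intro hc
      apply hx
      simp only [PMPSystem.orbitPattern, S.T_one, hππ]
      rw [hc]
    have h5 := (abs_le.mp key).2
    have h6 := ha.trans_le (min_le_right _ _)
    have h7 : freq (fun v => π' (a v) ≠ π (ρ fun k => a (s n k v))) ≤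
        freq (fun v => (π' (pattern (s n) F' a v ⟨1, h₁⟩) ≠
          π (ρ fun k => pattern (s n) F' a v ⟨k, hE k⟩)) ∨ s n 1 v ≠ v) := by
      refine freq_mono fun v hv => ?_
      by_cases hc : s n 1 v = v
      · left
        simpa [pattern, hc] using hv
      · exact Or.inr hc
    have h8 := h7.trans (freq_or_le _ _)
    linarith

end Comparison

/-! ### Product weights on finite powers -/

section ProductWeights

open scoped Classical BigOperators

variable {W Z K : Type*} [Fintype W] [Fintype Z] [Fintype K]

theorem sum_prod_weight_mul (θ : Z → ℝ) (f : W → Z → ℝ) :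
    ∑ x : W → Z, (∏ w, θ (x w)) * ∏ w, f w (x w) = ∏ w, ∑ z, θ z * f w z := by
  have := Finset.prod_univ_sum (fun _ : W => (Finset.univ : Finset Z)) (fun w z => θ z * f w z)
  rw [this, Fintype.piFinset_univ]
  exact Finset.sum_congr rfl fun x _ => Finset.prod_mul_distrib.symm

theorem sum_prod_weight {θ : Z → ℝ} (hθ : ∑ z, θ z = 1) :
    ∑ x : W → Z, ∏ w, θ (x w) = 1 := by
  have := sum_prod_weight_mul (W := W) θ (fun _ _ => 1)
  simpa [hθ] using this

/-- Distinct coordinates are independent under a product weight. -/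
theorem sum_prod_weight_mul_injective {θ : Z → ℝ} (hθ : ∑ z, θ z = 1) {ι : K → W}
    (hι : Function.Injective ι) (f : K → Z → ℝ) :
    ∑ x : W → Z, (∏ w, θ (x w)) * ∏ k, f k (x (ι k)) = ∏ k, ∑ z, θ z * f k z := by
  have h1 : ∀ x : W → Z, ∏ k, f k (x (ι k)) =
      ∏ w, ∏ k ∈ Finset.univ.filter (fun k => ι k = w), f k (x w) := by
    intro x
    rw [← Finset.prod_fiberwise Finset.univ ι]
    refine Finset.prod_congr rfl fun w _ => Finset.prod_congr rfl fun k hk => ?_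
    rw [(Finset.mem_filter.mp hk).2]
  simp only [h1]
  rw [sum_prod_weight_mul θ fun w z => ∏ k ∈ Finset.univ.filter (fun k => ι k = w), f k z]
  symm
  refine Fintype.prod_of_injective ι hι _ _ (fun w hw => ?_) fun k => ?_
  · have : (Finset.univ.filter fun k => ι k = w) = ∅ := by
      refine Finset.filter_eq_empty_iff.mpr fun k _ hk => hw ⟨k, hk⟩
    simp [this, hθ]
  · have : (Finset.univ.filter fun k' => ι k' = ι k) = {k} := by
      ext k'; simp [hι.eq_iff]
    simp [this]

theorem sum_prod_weight_filter {Z' : Type*} [Fintype Z'] [DecidableEq Z'] (θ : Z → ℝ)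
    (φ : Z → Z') (b : W → Z') :
    ∑ x ∈ Finset.univ.filter (fun x : W → Z => (fun w => φ (x w)) = b), ∏ w, θ (x w) =
      ∏ w, ∑ z ∈ Finset.univ.filter (fun z => φ z = b w), θ z := by
  rw [Finset.prod_univ_sum]
  refine Finset.sum_congr ?_ fun _ _ => rfl
  ext x
  simp [Fintype.mem_piFinset, funext_iff]

end ProductWeights

/-! ### Entropy of product weights -/

section Entropy

open scoped Classical BigOperators

/-- Gibbs' inequality for finite weights. -/
theorem neg_sum_mul_log_le {Ω : Type*} [Fintype Ω] {q r : Ω → ℝ} (hq : ∀ x, 0 ≤ q x)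
    (hr : ∀ x, 0 < r x) (h : ∑ x, r x ≤ ∑ x, q x) :
    -∑ x, q x * Real.log (q x) ≤ -∑ x, q x * Real.log (r x) := by
  rw [neg_le_neg_iff, ← sub_nonpos, ← Finset.sum_sub_distrib]
  calc _ ≤ ∑ x, (r x - q x) := by
        refine Finset.sum_le_sum fun x _ => ?_
        rcases (hq x).eq_or_lt with h0 | h0
        · rw [← h0]; simp [(hr x).le]
        · have := Real.log_le_sub_one_of_pos (div_pos (hr x) h0)
          rw [Real.log_div (hr x).ne' h0.ne'] at this
          have h2 := mul_le_mul_of_nonneg_left this h0.le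
          rw [mul_sub, mul_sub, mul_div_cancel₀ _ h0.ne', mul_one] at h2
          exact h2
    _ ≤ 0 := by rw [Finset.sum_sub_distrib]; linarith

/-- A set that carries most of the mass of a weight `q` has about `exp` of the entropy of `q`
elements at least. -/
theorem entropy_le_log_card {Ω : Type*} [Fintype Ω] {q : Ω → ℝ} (hq : ∀ x, 0 ≤ q x)
    (hq1 : ∑ x, q x = 1) (S : Finset Ω) (hS : S.Nonempty) {κ : ℝ}
    (hκ : 1 - κ ≤ ∑ x ∈ S, q x) :
    -∑ x, q x * Real.log (q x) ≤
      Real.log 2 + Real.log S.card + κ * Real.log (Fintype.card Ω) := by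
  have : Nonempty Ω := ⟨hS.choose⟩
  have hN : (0 : ℝ) < Fintype.card Ω := by exact_mod_cast Fintype.card_pos
  have hN1 : (1 : ℝ) ≤ Fintype.card Ω := by exact_mod_cast Fintype.card_pos
  have hc : (0 : ℝ) < S.card := by exact_mod_cast hS.card_pos
  have hc1 : (1 : ℝ) ≤ S.card := by exact_mod_cast hS.card_pos
  set r : Ω → ℝ := fun x => (if x ∈ S then (2 * (S.card : ℝ))⁻¹ else 0) + (2 * (Fintype.card Ω : ℝ))⁻¹
  have hr : ∀ x, 0 < r x := fun x => by
    simp only [r]; split_ifs <;> positivity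
  have hr1 : ∑ x, r x = 1 := by
    simp only [r, Finset.sum_add_distrib]
    rw [Finset.sum_ite_mem, Finset.univ_inter, Finset.sum_const, Finset.sum_const,
      Finset.card_univ, nsmul_eq_mul, nsmul_eq_mul]
    field_simp; norm_num
  refine (neg_sum_mul_log_le hq hr (by rw [hr1, hq1])).trans ?_
  have hlogN : 0 ≤ Real.log (Fintype.card Ω) := Real.log_nonneg hN1
  have hlogS : 0 ≤ Real.log S.card := Real.log_nonneg hc1
  have hterm : ∀ x, -(q x * Real.log (r x)) ≤ q x * (Real.log 2 + Real.log S.card) +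
      (if x ∈ S then 0 else q x) * Real.log (Fintype.card Ω) := by
    intro x
    rw [← mul_neg]
    by_cases hx : x ∈ S
    · simp only [hx, if_true, zero_mul, add_zero]
      refine mul_le_mul_of_nonneg_left ?_ (hq x)
      rw [← Real.log_mul two_ne_zero hc.ne', ← Real.log_inv]
      refine Real.log_le_log (inv_pos.mpr (hr x)) (inv_le_of_inv_le₀ (by positivity) ?_)
      simp only [r, hx, if_true]
      linarith [inv_pos.mpr (mul_pos two_pos hN)]
    · simp only [hx, if_false, ← mul_add]
      refine mul_le_mul_of_nonneg_left ?_ (hq x)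
      have : -Real.log (r x) = Real.log 2 + Real.log (Fintype.card Ω) := by
        rw [← Real.log_mul two_ne_zero hN.ne', ← Real.log_inv]
        simp [r, hx]
      linarith
  rw [← Finset.sum_neg_distrib]
  refine (Finset.sum_le_sum fun x _ => hterm x).trans ?_
  rw [Finset.sum_add_distrib, ← Finset.sum_mul, hq1, one_mul, ← Finset.sum_mul]
  have : ∑ x, (if x ∈ S then 0 else q x) ≤ κ := by
    have e : ∀ x, (if x ∈ S then 0 else q x) = q x - if x ∈ S then q x else 0 := fun x => by
      split_ifs <;> simp
    simp only [e]
    rw [Finset.sum_sub_distrib, Finset.sum_ite_mem, Finset.univ_inter]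
    linarith
  gcongr

variable {W Z : Type*} [Fintype W]

/-- The law of a random coordinate of a random member of the set `U`. -/
noncomputable def averageMarginal (U : Finset (W → Z)) (z : Z) : ℝ :=
  (∑ x ∈ U, ∑ w, if x w = z then (1 : ℝ) else 0) / (U.card * Fintype.card W)

theorem averageMarginal_nonneg (U : Finset (W → Z)) (z : Z) : 0 ≤ averageMarginal U z :=
  div_nonneg (Finset.sum_nonneg fun _ _ => Finset.sum_nonneg fun _ _ => by split_ifs <;> norm_num)
    (by positivity)

variable [Fintype Z]

theorem sum_averageMarginal_mul (U : Finset (W → Z)) (f : Z → ℝ) :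
    ∑ z, averageMarginal U z * f z = (∑ x ∈ U, ∑ w, f (x w)) / (U.card * Fintype.card W) := by
  simp only [averageMarginal, div_mul_eq_mul_div, ← Finset.sum_div]
  congr 1
  simp only [Finset.sum_mul]
  rw [Finset.sum_comm]
  refine Finset.sum_congr rfl fun x _ => ?_
  rw [Finset.sum_comm]
  refine Finset.sum_congr rfl fun w _ => ?_
  simp

theorem sum_averageMarginal [Nonempty W] {U : Finset (W → Z)} (hU : U.Nonempty) :
    ∑ z, averageMarginal U z = 1 := by
  have h := sum_averageMarginal_mul U fun _ => 1
  have hc : (0 : ℝ) < U.card := by exact_mod_cast hU.card_pos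
  have hW : (0 : ℝ) < Fintype.card W := by exact_mod_cast Fintype.card_pos
  simp only [mul_one, Finset.sum_const, Finset.card_univ, nsmul_eq_mul] at h
  rw [h, div_self (by positivity)]

/-- The product of the averaged marginals of `U` has at least the entropy `log |U|`; so every set
that carries most of its mass is not much smaller than `U`. -/
theorem log_card_le_of_averageMarginal [Nonempty W] {U : Finset (W → Z)} (hU : U.Nonempty)
    {S : Finset (W → Z)} (hS : S.Nonempty) {κ : ℝ}
    (hκ : 1 - κ ≤ ∑ x ∈ S, ∏ w, averageMarginal U (x w)) :
    Real.log U.card ≤ Real.log 2 + Real.log S.card +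
      κ * (Fintype.card W * Real.log (Fintype.card Z)) := by
  set θ := averageMarginal U
  set q : (W → Z) → ℝ := fun x => ∏ w, θ (x w)
  have hθ : ∀ z, 0 ≤ θ z := averageMarginal_nonneg U
  have hθ1 : ∑ z, θ z = 1 := sum_averageMarginal hU
  have hq : ∀ x, 0 ≤ q x := fun x => Finset.prod_nonneg fun w _ => hθ _
  have hq1 : ∑ x, q x = 1 := sum_prod_weight hθ1
  have hc : (0 : ℝ) < U.card := by exact_mod_cast hU.card_pos
  have hW : (0 : ℝ) < Fintype.card W := by exact_mod_cast Fintype.card_pos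
  have hpos : ∀ x ∈ U, ∀ w, 0 < θ (x w) := by
    intro x hx w
    refine div_pos (lt_of_lt_of_le zero_lt_one ?_) (by positivity)
    calc (1 : ℝ) = if x w = x w then (1 : ℝ) else 0 := by simp
      _ ≤ ∑ w', if x w' = x w then (1 : ℝ) else 0 :=
          Finset.single_le_sum (f := fun w' => if x w' = x w then (1 : ℝ) else 0)
            (fun w' _ => by split_ifs <;> norm_num) (Finset.mem_univ w)
      _ ≤ _ := Finset.single_le_sum
            (f := fun x' : W → Z => ∑ w', if x' w' = x w then (1 : ℝ) else 0)
            (fun x' _ => Finset.sum_nonneg fun w' _ => by split_ifs <;> norm_num) hx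
  have h1 : ∑ x, q x * Real.log (q x) = Fintype.card W * ∑ z, θ z * Real.log (θ z) := by
    have e : ∀ x, q x * Real.log (q x) = ∑ w, q x * Real.log (θ (x w)) := by
      intro x
      by_cases h0 : q x = 0
      · simp [h0]
      · rw [← Finset.mul_sum]
        congr 1
        exact Real.log_prod fun w _ hw => h0 (Finset.prod_eq_zero (Finset.mem_univ w) hw)
    simp only [e]
    rw [Finset.sum_comm]
    have : ∀ w, ∑ x : W → Z, q x * Real.log (θ (x w)) = ∑ z, θ z * Real.log (θ z) := by
      intro w
      have := sum_prod_weight_mul_injective hθ1 (ι := fun _ : Unit => w)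
        (fun _ _ _ => rfl) (fun _ z => Real.log (θ z))
      simpa using this
    simp [this]
  have h2 : Real.log U.card ≤ -(Fintype.card W * ∑ z, θ z * Real.log (θ z)) := by
    rw [sum_averageMarginal_mul U fun z => Real.log (θ z)]
    have e : ∀ x ∈ U, ∑ w, Real.log (θ (x w)) = Real.log (q x) := fun x hx =>
      (Real.log_prod fun w _ => (hpos x hx w).ne').symm
    rw [Finset.sum_congr rfl e]
    have hle : ∑ x ∈ U, (Real.log U.card + Real.log (q x)) ≤ 0 := by
      have hqx : ∀ x ∈ U, 0 < q x := fun x hx => Finset.prod_pos fun w _ => hpos x hx w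
      calc _ ≤ ∑ x ∈ U, (U.card * q x - 1) := by
            refine Finset.sum_le_sum fun x hx => ?_
            rw [← Real.log_mul hc.ne' (hqx x hx).ne']
            exact Real.log_le_sub_one_of_pos (mul_pos hc (hqx x hx))
        _ = U.card * (∑ x ∈ U, q x) - U.card := by
            rw [Finset.sum_sub_distrib, Finset.mul_sum]; simp
        _ ≤ U.card * 1 - U.card := by
            gcongr
            rw [← hq1]
            exact Finset.sum_le_sum_of_subset_of_nonneg (Finset.subset_univ _) fun x _ _ => hq x
        _ = 0 := by ring
    rw [Finset.sum_add_distrib, Finset.sum_const, nsmul_eq_mul] at hle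
    rw [mul_div_assoc', mul_comm (U.card : ℝ), mul_div_mul_left _ _ hW.ne', ← neg_div,
      le_div_iff₀ hc]
    linarith
  have h3 := entropy_le_log_card hq hq1 S hS hκ
  rw [h1] at h3
  refine h2.trans (h3.trans (le_of_eq ?_))
  rw [Fintype.card_fun, Nat.cast_pow, Real.log_pow]

end Entropy

/-! ### A second moment bound -/

section SecondMoment

open scoped Classical BigOperators

variable {V W Z K : Type*} [Fintype V] [Fintype W] [Fintype Z] [Fintype K]

theorem abs_sum_weight_le {Ω : Type*} [Fintype Ω] {q f : Ω → ℝ} (hq : ∀ x, 0 ≤ q x)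
    (hq1 : ∑ x, q x = 1) (hf : ∀ x, |f x| ≤ 1) : |∑ x, q x * f x| ≤ 1 := by
  refine (Finset.abs_sum_le_sum_abs _ _).trans (le_of_le_of_eq (Finset.sum_le_sum fun x _ => ?_) hq1)
  rw [abs_mul, abs_of_nonneg (hq x)]
  exact mul_le_of_le_one_right (hq x) (hf x)

theorem second_moment_le [Nonempty V] [Nonempty W] {θ : Z → ℝ} (hθ : ∀ z, 0 ≤ θ z)
    (hθ1 : ∑ z, θ z = 1)
    (t : K → W → W) (φ : V → K → Z → ℝ) (hφ : ∀ v k z, 0 ≤ φ v k z ∧ φ v k z ≤ 1) {m : ℝ}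
    (hm : 0 ≤ m ∧ m ≤ 1) (J : V → W → ℝ) (hJ : ∀ v w, 0 ≤ J v w ∧ J v w ≤ 1) :
    ∑ x : W → Z, (∏ w, θ (x w)) *
        (𝔼 p : V × W, J p.1 p.2 * ((∏ k, φ p.1 k (x (t k p.2))) - m)) ^ 2 ≤
      freq (fun p : W × W =>
        ¬ Function.Injective (Sum.elim (fun k => t k p.1) (fun k => t k p.2))) +
      𝔼 v, |(∏ k, ∑ z, θ z * φ v k z) - m| := by
  set q : (W → Z) → ℝ := fun x => ∏ w, θ (x w)
  have hq : ∀ x, 0 ≤ q x := fun x => Finset.prod_nonneg fun w _ => hθ _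
  have hq1 : ∑ x, q x = 1 := sum_prod_weight hθ1
  set P : V × W → (W → Z) → ℝ := fun p x => ∏ k, φ p.1 k (x (t k p.2))
  set a : V → ℝ := fun v => ∏ k, ∑ z, θ z * φ v k z
  set bad : W → W → Prop := fun w w' =>
    ¬ Function.Injective (Sum.elim (fun k => t k w) (fun k => t k w'))
  have hP : ∀ p x, 0 ≤ P p x ∧ P p x ≤ 1 := fun p x =>
    ⟨Finset.prod_nonneg fun k _ => (hφ _ _ _).1,
      Finset.prod_le_one (fun k _ => (hφ _ _ _).1) fun k _ => (hφ _ _ _).2⟩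
  have ha : ∀ v, 0 ≤ a v ∧ a v ≤ 1 := by
    intro v
    have : ∀ k, 0 ≤ ∑ z, θ z * φ v k z ∧ ∑ z, θ z * φ v k z ≤ 1 := fun k =>
      ⟨Finset.sum_nonneg fun z _ => mul_nonneg (hθ z) (hφ _ _ _).1,
        le_of_le_of_eq (Finset.sum_le_sum fun z _ => mul_le_of_le_one_right (hθ z) (hφ _ _ _).2) hθ1⟩
    exact ⟨Finset.prod_nonneg fun k _ => (this k).1,
      Finset.prod_le_one (fun k _ => (this k).1) fun k _ => (this k).2⟩
  have hJP : ∀ p x, |J p.1 p.2 * (P p x - m)| ≤ 1 := by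
    intro p x
    rw [abs_mul]
    refine mul_le_one₀ ?_ (abs_nonneg _) ?_
    · rw [abs_le]; constructor <;> linarith [(hJ p.1 p.2).1, (hJ p.1 p.2).2]
    · rw [abs_le]; constructor <;> linarith [(hP p x).1, (hP p x).2]
  have hc : ∀ p p' : V × W, ∑ x, q x * ((J p.1 p.2 * (P p x - m)) * (J p'.1 p'.2 * (P p' x - m))) ≤
      (if bad p.2 p'.2 then 1 else 0) + |a p.1 - m| := by
    intro p p'
    by_cases hb : bad p.2 p'.2
    · simp only [hb, if_true]
      have := abs_sum_weight_le hq hq1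
        (f := fun x => (J p.1 p.2 * (P p x - m)) * (J p'.1 p'.2 * (P p' x - m))) (fun x => by
          rw [abs_mul]
          exact mul_le_one₀ (hJP p x) (abs_nonneg _) (hJP p' x))
      linarith [(abs_le.mp this).2, abs_nonneg (a p.1 - m)]
    · simp only [hb, if_false, zero_add]
      have hinj : Function.Injective (Sum.elim (fun k => t k p.2) (fun k => t k p'.2)) := not_not.mp hb
      have e1 : ∑ x, q x * P p x = a p.1 :=
        sum_prod_weight_mul_injective hθ1 (hinj.comp Sum.inl_injective) (φ p.1)
      have e2 : ∑ x, q x * P p' x = a p'.1 :=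
        sum_prod_weight_mul_injective hθ1 (hinj.comp Sum.inr_injective) (φ p'.1)
      have e3 : ∑ x, q x * (P p x * P p' x) = a p.1 * a p'.1 := by
        have := sum_prod_weight_mul_injective hθ1 hinj
          (Sum.elim (φ p.1) (φ p'.1) : K ⊕ K → Z → ℝ)
        simpa [Fintype.prod_sum_type] using this
      have e4 : ∑ x, q x * ((J p.1 p.2 * (P p x - m)) * (J p'.1 p'.2 * (P p' x - m))) =
          J p.1 p.2 * J p'.1 p'.2 * ((a p.1 - m) * (a p'.1 - m)) := by
        have : ∀ x, q x * ((J p.1 p.2 * (P p x - m)) * (J p'.1 p'.2 * (P p' x - m))) =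
            J p.1 p.2 * J p'.1 p'.2 * (q x * (P p x * P p' x)) -
              J p.1 p.2 * J p'.1 p'.2 * m * (q x * P p x) -
              J p.1 p.2 * J p'.1 p'.2 * m * (q x * P p' x) +
              J p.1 p.2 * J p'.1 p'.2 * m ^ 2 * q x := fun x => by ring
        simp only [this, Finset.sum_add_distrib, Finset.sum_sub_distrib, ← Finset.mul_sum]
        rw [e1, e2, e3, hq1]; ring
      rw [e4]
      refine (le_abs_self _).trans ?_
      rw [abs_mul, abs_mul, abs_mul]
      have b1 : |J p.1 p.2 * J p'.1 p'.2| ≤ 1 := by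
        rw [abs_mul, abs_of_nonneg (hJ _ _).1, abs_of_nonneg (hJ _ _).1]
        exact mul_le_one₀ (hJ _ _).2 (hJ _ _).1 (hJ _ _).2
      have b2 : |a p'.1 - m| ≤ 1 := by
        rw [abs_le]; constructor <;> linarith [(ha p'.1).1, (ha p'.1).2]
      have b3 := mul_le_mul b1 (mul_le_of_le_one_right (abs_nonneg (a p.1 - m)) b2)
        (by positivity) zero_le_one
      rw [one_mul] at b3
      rwa [abs_mul (J p.1 p.2)] at b3
  calc _ = 𝔼 p : V × W, 𝔼 p' : V × W,
        ∑ x, q x * ((J p.1 p.2 * (P p x - m)) * (J p'.1 p'.2 * (P p' x - m))) := by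
        have : ∀ x, q x * (𝔼 p : V × W, J p.1 p.2 * (P p x - m)) ^ 2 =
            𝔼 p : V × W, 𝔼 p' : V × W,
              q x * ((J p.1 p.2 * (P p x - m)) * (J p'.1 p'.2 * (P p' x - m))) := by
          intro x
          rw [sq, Finset.expect_mul_expect, Finset.mul_expect]
          refine Finset.expect_congr rfl fun p _ => ?_
          rw [Finset.mul_expect]
        change ∑ x, q x * (𝔼 p : V × W, J p.1 p.2 * (P p x - m)) ^ 2 = _
        simp only [this]
        rw [← Finset.expect_sum_comm]
        refine Finset.expect_congr rfl fun p _ => ?_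
        rw [← Finset.expect_sum_comm]
    _ ≤ 𝔼 p : V × W, 𝔼 p' : V × W, ((if bad p.2 p'.2 then (1 : ℝ) else 0) + |a p.1 - m|) :=
        Finset.expect_le_expect fun p _ => Finset.expect_le_expect fun p' _ => hc p p'
    _ = _ := by
        have i1 : ∀ p : V × W, 𝔼 p' : V × W, ((if bad p.2 p'.2 then (1 : ℝ) else 0) + |a p.1 - m|) =
            (𝔼 w', if bad p.2 w' then (1 : ℝ) else 0) + |a p.1 - m| := by
          intro p
          rw [Finset.expect_add_distrib, Finset.expect_const Finset.univ_nonempty]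
          congr 1
          rw [← freq_eq_expect, ← freq_eq_expect]
          exact freq_snd (W := V) (fun w' => bad p.2 w')
        simp only [i1]
        rw [Finset.expect_add_distrib]
        congr 1
        · rw [freq, ← Finset.univ_product_univ, ← Finset.univ_product_univ, Finset.expect_product,
            Finset.expect_product]
          refine (Finset.expect_const (Finset.univ_nonempty (α := V))
            (𝔼 w, 𝔼 w', if bad w w' then (1 : ℝ) else 0)).trans ?_
          refine Finset.expect_congr rfl fun w _ => Finset.expect_congr rfl fun w' _ => ?_
          by_cases hb : bad w w'
          · rw [if_pos hb, if_pos hb]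
          · rw [if_neg hb, if_neg hb]
        · rw [← Finset.univ_product_univ, Finset.expect_product]
          refine Finset.expect_congr rfl fun v _ => ?_
          exact Finset.expect_const (Finset.univ_nonempty (α := W)) |a v - m|

theorem freq_not_injective_sum_le [Nonempty W] (t : K → Equiv.Perm W) :
    freq (fun p : W × W =>
        ¬ Function.Injective (Sum.elim (fun k => t k p.1) (fun k => t k p.2))) ≤
      2 * freq (fun w => ¬ Function.Injective fun k => t k w) +
        (Fintype.card K : ℝ) ^ 2 / Fintype.card W := by
  have h1 : freq (fun p : W × W =>
        ¬ Function.Injective (Sum.elim (fun k => t k p.1) (fun k => t k p.2))) ≤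
      freq (fun p : W × W => ((¬ Function.Injective fun k => t k p.1) ∨
        (¬ Function.Injective fun k => t k p.2)) ∨
        ∃ kk ∈ (Finset.univ : Finset (K × K)), t kk.1 p.1 = t kk.2 p.2) := by
    refine freq_mono fun p hp => ?_
    by_contra hc
    push Not at hc
    obtain ⟨⟨c1, c2⟩, c3⟩ := hc
    exact hp (c1.sumElim c2 fun k k' => c3 (k, k') (Finset.mem_univ _))
  have h2 := freq_or_le (fun p : W × W => (¬ Function.Injective fun k => t k p.1) ∨
        (¬ Function.Injective fun k => t k p.2))
        (fun p => ∃ kk ∈ (Finset.univ : Finset (K × K)), t kk.1 p.1 = t kk.2 p.2)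
  have h3 := freq_or_le (fun p : W × W => (¬ Function.Injective fun k => t k p.1))
    (fun p : W × W => (¬ Function.Injective fun k => t k p.2))
  rw [freq_fst (W := W) (fun w => ¬ Function.Injective fun k => t k w),
    freq_snd (W := W) (fun w => ¬ Function.Injective fun k => t k w)] at h3
  have h4 := freq_exists_le (Finset.univ : Finset (K × K))
    (fun kk (p : W × W) => t kk.1 p.1 = t kk.2 p.2)
  have h5 : ∀ kk : K × K, freq (fun p : W × W => t kk.1 p.1 = t kk.2 p.2) =
      1 / Fintype.card W := by
    intro kk
    rw [freq_eq_expect, ← Finset.univ_product_univ, Finset.expect_product,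
      ← Fintype.expect_const (ι := W) (1 / (Fintype.card W : ℝ))]
    refine Finset.expect_congr rfl fun w _ => ?_
    rw [Fintype.expect_eq_sum_div_card]
    congr 1
    have : ∀ w', (t kk.1 w = t kk.2 w') ↔ (w' = (t kk.2).symm (t kk.1 w)) := fun w' => by
      rw [Equiv.eq_symm_apply, eq_comm]
    simp [this]
  simp only [h5, Finset.sum_const, Finset.card_univ, Fintype.card_prod, nsmul_eq_mul] at h4
  have h6 : ((Fintype.card K * Fintype.card K : ℕ) : ℝ) * (1 / Fintype.card W) =
      (Fintype.card K : ℝ) ^ 2 / Fintype.card W := by push_cast; ring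
  rw [h6] at h4
  linarith

end SecondMoment

/-! ### Models of co-induced systems -/

section Coind

open scoped Classical BigOperators

variable {G H : Type*} {A : Type*}

/-- The part of a pattern in a product window that lies over the element `h` of `H`. -/
def patternRow {E : Finset G} {F : Finset H} (p : (E ×ˢ F : Finset (G × H)) → A) (h : F) : E → A :=
  fun g => p ⟨(g, h), Finset.mem_product.mpr ⟨g.2, h.2⟩⟩

theorem patternRow_injective {E : Finset G} {F : Finset H}
    {p q : (E ×ˢ F : Finset (G × H)) → A} : p = q ↔ ∀ h, patternRow p h = patternRow q h := by
  refine ⟨fun h _ => h ▸ rfl, fun h => funext fun ⟨⟨g, k⟩, hgk⟩ => ?_⟩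
  have hm := Finset.mem_product.mp hgk
  exact congrFun (h ⟨k, hm.2⟩) ⟨g, hm.1⟩

variable [Group G] [Group H] {X : Type*} [MeasurableSpace X]

theorem PMPSystem.coind_T (S : PMPSystem G X) (p : G × H) (x : H → X) (k : H) :
    (S.coind H).T p x k = S.T p.1 (x (k * p.2)) := rfl

theorem patternRow_orbitPattern (S : PMPSystem G X) (α : X → A) (E : Finset G) (F : Finset H)
    (x : H → X) (h : F) :
    patternRow ((S.coind H).orbitPattern (fun x => α (x 1)) (E ×ˢ F) x) h =
      S.orbitPattern α E (x h) := by
  funext g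
  simp [patternRow, PMPSystem.orbitPattern, PMPSystem.coind_T]

variable [MeasurableSpace A] [MeasurableSingletonClass A]

/-- Patterns over different elements of `H` are independent in a co-induced system. -/
theorem measureReal_coind_orbitPattern (S : PMPSystem G X) {α : X → A}
    (hα : Measurable α) (E : Finset G) (F : Finset H) (p : (E ×ˢ F : Finset (G × H)) → A) :
    (S.coind H).μ.real {x | (S.coind H).orbitPattern (fun x => α (x 1)) (E ×ˢ F) x = p} =
      ∏ h : F, S.μ.real {x | S.orbitPattern α E x = patternRow p h} := by
  have e : {x | (S.coind H).orbitPattern (fun x => α (x 1)) (E ×ˢ F) x = p} =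
      F.restrict ⁻¹' (univ.pi fun h : F => {x | S.orbitPattern α E x = patternRow p h}) := by
    ext x
    simp [patternRow_injective, patternRow_orbitPattern]
  have hm : ∀ h : F, MeasurableSet {x | S.orbitPattern α E x = patternRow p h} := fun h =>
    S.measurable_orbitPattern hα E (measurableSet_singleton _)
  rw [e, ← map_measureReal_apply (Finset.measurable_restrict F) (MeasurableSet.univ_pi hm)]
  change (Measure.map F.restrict (Measure.infinitePi fun _ : H => S.μ)).real _ = _
  rw [Measure.infinitePi_map_restrict, measureReal_def, Measure.pi_pi, ENNReal.toReal_prod]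
  rfl

/-- The variance of the frequency of a pattern over a finite subset of `H`. -/
theorem integral_coind_sq_le (S : PMPSystem G X) {α : X → A} (hα : Measurable α) (E : Finset G)
    {F : Finset H} (hF : F.Nonempty) (q : E → A) :
    ∫ x, ((𝔼 h : F, if S.orbitPattern α E (x h) = q then (1 : ℝ) else 0) -
      S.μ.real {x | S.orbitPattern α E x = q}) ^ 2 ∂(S.coind H).μ ≤ 1 / F.card := by
  set u : X → ℝ := fun x => if S.orbitPattern α E x = q then (1 : ℝ) else 0
  set m := S.μ.real {x | S.orbitPattern α E x = q}
  set P : Measure (H → X) := Measure.infinitePi fun _ => S.μ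
  have hms : MeasurableSet {x | S.orbitPattern α E x = q} :=
    S.measurable_orbitPattern hα E (measurableSet_singleton q)
  have hu : Measurable u := Measurable.ite hms measurable_const measurable_const
  have hu1 : ∀ x, u x ∈ Icc (0 : ℝ) 1 := fun x => by
    simp only [u]; split_ifs <;> simp
  have hum : ∫ x, u x ∂S.μ = m := by
    rw [show m = ∫ x, {x | S.orbitPattern α E x = q}.indicator 1 x ∂S.μ from
      (integral_indicator_one hms).symm]
    refine integral_congr_ae (Eventually.of_forall fun x => ?_)
    simp [u, Set.indicator_apply]
  have hY : ∀ h : H, Measurable fun x : H → X => u (x h) := fun h => hu.comp (measurable_pi_apply h)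
  have hYm : ∀ h : H, MemLp (fun x : H → X => u (x h)) 2 P := fun h =>
    MemLp.of_bound (hY h).aestronglyMeasurable 1 (Eventually.of_forall fun x => by
      rw [Real.norm_eq_abs, abs_le]; constructor <;> linarith [(hu1 (x h)).1, (hu1 (x h)).2])
  have hint : ∀ h : H, ∫ x, u (x h) ∂P = m := fun h => by
    rw [← hum, ← (measurePreserving_eval_infinitePi (fun _ : H => S.μ) h).map_eq,
      integral_map (measurable_pi_apply h).aemeasurable hu.aestronglyMeasurable]
  have hcard : (0 : ℝ) < F.card := by exact_mod_cast hF.card_pos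
  have hvar : ProbabilityTheory.variance (∑ h ∈ F, (fun x : H → X => u (x h))) P ≤ F.card := by
    rw [ProbabilityTheory.IndepFun.variance_sum (fun h _ => hYm h)]
    · refine (Finset.sum_le_sum fun h _ => ProbabilityTheory.variance_le_sq_of_bounded
        (a := 0) (b := 1) (Eventually.of_forall fun x => hu1 (x h)) (hY h).aemeasurable).trans ?_
      simp only [Finset.sum_const, nsmul_eq_mul]
      nlinarith
    · intro h _ h' _ hh
      exact (ProbabilityTheory.iIndepFun_infinitePi (P := fun _ : H => S.μ) (X := fun _ => u)
        fun _ => hu).indepFun hh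
  have hsum : AEMeasurable (∑ h ∈ F, (fun x : H → X => u (x h))) P := by
    rw [show (∑ h ∈ F, fun x : H → X => u (x h)) = fun x => ∑ h ∈ F, u (x h) by ext; simp]
    exact (Finset.measurable_sum F fun h _ => hY h).aemeasurable
  rw [ProbabilityTheory.variance_eq_integral hsum] at hvar
  have hmean : ∫ x, (∑ h ∈ F, (fun x : H → X => u (x h))) x ∂P = F.card * m := by
    simp only [Finset.sum_apply]
    rw [integral_finsetSum _ fun h _ => (hYm h).integrable (by norm_num)]
    simp [hint]
  rw [hmean] at hvar
  have hfin : ∀ x : H → X, ((𝔼 h : F, u (x h)) - m) ^ 2 =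
      ((∑ h ∈ F, (fun x : H → X => u (x h))) x - F.card * m) ^ 2 / (F.card : ℝ) ^ 2 := by
    intro x
    rw [Fintype.expect_eq_sum_div_card, Fintype.card_coe, Finset.sum_apply,
      Finset.sum_coe_sort F fun h => u (x h)]
    field_simp
  change ∫ x, ((𝔼 h : F, u (x h)) - m) ^ 2 ∂P ≤ _
  simp only [hfin]
  rw [integral_div, div_le_div_iff₀ (by positivity) hcard]
  nlinarith

variable [Fintype A]

theorem sq_expect_le {ι : Type*} [Fintype ι] [Nonempty ι] (f : ι → ℝ) :
    (𝔼 i, f i) ^ 2 ≤ 𝔼 i, f i ^ 2 := by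
  have h := Finset.expect_mul_sq_le_sq_mul_sq Finset.univ f fun _ => (1 : ℝ)
  simpa using h

variable {V W : Type*} [Fintype V] [Fintype W] [Nonempty W]

/-- In a model of a co-induced system, at most vertices `v` the patterns in the direction of `G`
have, averaged over `W`, almost the right law. -/
theorem expect_sq_le_of_coind_model (S : PMPSystem G X) {α : X → A} (hα : Measurable α)
    (s : G → Equiv.Perm V) (t : H → Equiv.Perm W) (E : Finset G) {F : Finset H} (hF : F.Nonempty)
    (q : E → A) (a : V × W → A) :
    𝔼 v, ((𝔼 w, if pattern s E (fun v => a (v, w)) v = q then (1 : ℝ) else 0) -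
      S.μ.real {x | S.orbitPattern α E x = q}) ^ 2 ≤
      1 / F.card + defect (S.coind H) (fun p : G × H => Equiv.prodCongr (s p.1) (t p.2))
        (fun x => α (x 1)) (E ×ˢ F) a := by
  have : Nonempty F := hF.to_subtype
  set m := S.μ.real {x | S.orbitPattern α E x = q}
  set u : V → W → ℝ := fun v w => if pattern s E (fun v => a (v, w)) v = q then (1 : ℝ) else 0
  set f : ((E ×ˢ F : Finset (G × H)) → A) → ℝ := fun p =>
    ((𝔼 h : F, if patternRow p h = q then (1 : ℝ) else 0) - m) ^ 2
  have hm : 0 ≤ m ∧ m ≤ 1 := ⟨measureReal_nonneg, measureReal_le_one⟩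
  have hf : ∀ p, |f p| ≤ 1 := by
    intro p
    have h0 : 0 ≤ 𝔼 h : F, (if patternRow p h = q then (1 : ℝ) else 0) :=
      Finset.expect_nonneg fun h _ => by split_ifs <;> norm_num
    have h1 : 𝔼 h : F, (if patternRow p h = q then (1 : ℝ) else 0) ≤ 1 :=
      Finset.expect_le Finset.univ_nonempty fun h _ => by split_ifs <;> norm_num
    rw [abs_of_nonneg (sq_nonneg _), sq_le_one_iff_abs_le_one, abs_le]
    constructor <;> linarith
  have hαe : Measurable fun x : H → X => α (x 1) := hα.comp (measurable_pi_apply 1)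
  have h1 := abs_expect_sub_integral_le (S.coind H)
    (fun p : G × H => Equiv.prodCongr (s p.1) (t p.2)) hαe (E ×ˢ F) a f hf
  have h2 := integral_coind_sq_le S hα E hF q
  have h3 : ∫ x, f ((S.coind H).orbitPattern (fun x => α (x 1)) (E ×ˢ F) x) ∂(S.coind H).μ ≤
      1 / F.card := by
    simpa only [f, patternRow_orbitPattern] using h2
  have h4 : 𝔼 v, ((𝔼 w, u v w) - m) ^ 2 ≤ 𝔼 p : V × W,
      f (pattern (fun p : G × H => Equiv.prodCongr (s p.1) (t p.2)) (E ×ˢ F) a p) := by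
    rw [← Finset.univ_product_univ, Finset.expect_product]
    refine Finset.expect_le_expect fun v _ => ?_
    have e : (𝔼 w, u v w) - m = 𝔼 w, ((𝔼 h : F, u v (t h w)) - m) := by
      rw [Finset.expect_sub_distrib, Finset.expect_const Finset.univ_nonempty, Finset.expect_comm]
      congr 1
      have : ∀ h : F, 𝔼 w, u v (t h w) = 𝔼 w, u v w := fun h =>
        Fintype.expect_equiv (t h) _ _ fun _ => rfl
      simp only [this]
      rw [Finset.expect_const Finset.univ_nonempty]
    rw [e]
    exact sq_expect_le _
  rw [one_mul] at h1
  linarith [(abs_le.mp h1).2]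

theorem abs_prod_sub_prod_le {ι : Type*} (s : Finset ι) {a b : ι → ℝ}
    (ha : ∀ i, 0 ≤ a i ∧ a i ≤ 1) (hb : ∀ i, 0 ≤ b i ∧ b i ≤ 1) :
    |∏ i ∈ s, a i - ∏ i ∈ s, b i| ≤ ∑ i ∈ s, |a i - b i| := by
  induction s using Finset.induction_on with
  | empty => simp
  | insert i s hi ih =>
    rw [Finset.prod_insert hi, Finset.prod_insert hi, Finset.sum_insert hi]
    have e : a i * ∏ i ∈ s, a i - b i * ∏ i ∈ s, b i =
        (a i - b i) * ∏ i ∈ s, a i + b i * (∏ i ∈ s, a i - ∏ i ∈ s, b i) := by ring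
    rw [e]
    refine (abs_add_le _ _).trans (add_le_add ?_ ?_)
    · rw [abs_mul]
      refine mul_le_of_le_one_right (abs_nonneg _) ?_
      rw [abs_of_nonneg (Finset.prod_nonneg fun i _ => (ha i).1)]
      exact Finset.prod_le_one (fun i _ => (ha i).1) fun i _ => (ha i).2
    · rw [abs_mul, abs_of_nonneg (hb i).1]
      exact (mul_le_of_le_one_left (abs_nonneg _) (hb i).2).trans ih

/-- The columns of a family of models of a co-induced system show the patterns in the direction
of `G` with almost the right law at most vertices. -/
theorem expect_abs_averageMarginal_sub_le [Nonempty V] (S : PMPSystem G X) {α : X → A}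
    (hα : Measurable α)
    (s : G → Equiv.Perm V) (t : H → Equiv.Perm W) (E : Finset G) {F : Finset H} (hF : F.Nonempty)
    (q : E → A) {U : Finset (W → V → A)} (hU : U.Nonempty) {δ : ℝ}
    (hδ : ∀ x ∈ U, defect (S.coind H) (fun p : G × H => Equiv.prodCongr (s p.1) (t p.2))
        (fun x => α (x 1)) (E ×ˢ F) (fun p => x p.2 p.1) ≤ δ) :
    𝔼 v, |(∑ z, averageMarginal U z * if pattern s E z v = q then (1 : ℝ) else 0) -
      S.μ.real {x | S.orbitPattern α E x = q}| ≤ Real.sqrt (1 / F.card + δ) := by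
  set m := S.μ.real {x | S.orbitPattern α E x = q}
  have hc : (0 : ℝ) < U.card := by exact_mod_cast hU.card_pos
  have hW : (0 : ℝ) < Fintype.card W := by exact_mod_cast Fintype.card_pos
  have h1 : ∀ v, |(∑ z, averageMarginal U z * if pattern s E z v = q then (1 : ℝ) else 0) - m| ≤
      (∑ x ∈ U, |(𝔼 w, if pattern s E (x w) v = q then (1 : ℝ) else 0) - m|) / U.card := by
    intro v
    rw [sum_averageMarginal_mul]
    have : (∑ x ∈ U, ∑ w, if pattern s E (x w) v = q then (1 : ℝ) else 0) /
        (U.card * Fintype.card W) - m =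
        (∑ x ∈ U, ((𝔼 w, if pattern s E (x w) v = q then (1 : ℝ) else 0) - m)) / U.card := by
      rw [Finset.sum_sub_distrib, Finset.sum_const, nsmul_eq_mul]
      simp only [Fintype.expect_eq_sum_div_card]
      rw [← Finset.sum_div]
      field_simp
    rw [this, abs_div, abs_of_pos hc]
    gcongr
    exact Finset.abs_sum_le_sum_abs _ _
  calc _ ≤ 𝔼 v, (∑ x ∈ U, |(𝔼 w, if pattern s E (x w) v = q then (1 : ℝ) else 0) - m|) / U.card :=
        Finset.expect_le_expect fun v _ => h1 v
    _ = (∑ x ∈ U, 𝔼 v, |(𝔼 w, if pattern s E (x w) v = q then (1 : ℝ) else 0) - m|) / U.card := by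
        rw [← Finset.expect_div, Finset.expect_sum_comm]
    _ ≤ (∑ _x ∈ U, Real.sqrt (1 / F.card + δ)) / U.card := by
        gcongr with x hx
        refine Real.le_sqrt_of_sq_le ((sq_expect_le _).trans ?_)
        simp only [sq_abs]
        have := expect_sq_le_of_coind_model S hα s t E hF q (fun p : V × W => x p.2 p.1)
        linarith [hδ x hx]
    _ = _ := by rw [Finset.sum_const, nsmul_eq_mul, mul_div_cancel_left₀ _ hc.ne']

end Coind

/-! ### Random models of products with co-induced systems -/

section RandomModels

open scoped Classical BigOperators

variable {G H : Type*} [Group G] [Group H] {X Y : Type*} [MeasurableSpace X] [MeasurableSpace Y]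
  {A A' : Type*} [Fintype A] [MeasurableSpace A] [MeasurableSingletonClass A]
  [Fintype A'] {V W : Type*} [Fintype V] [Fintype W]

/-- The deviation, for a fixed pattern, from independence between `x` and `y`. -/
noncomputable def patternDeviation (S : PMPSystem G X) (α : X → A) (s : G → Equiv.Perm V)
    (t : H → Equiv.Perm W) (E : Finset G) (F : Finset H) (y : V × W → A')
    (p : (E ×ˢ F : Finset (G × H)) → A × A') (x : W → V → A) : ℝ :=
  𝔼 q : V × W,
    (if pattern (fun p : G × H => Equiv.prodCongr (s p.1) (t p.2)) (E ×ˢ F) y (q.1, q.2) =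
      fun g => (p g).2 then (1 : ℝ) else 0) *
    ((∏ h : F, if pattern s E (x (t h q.2)) q.1 = patternRow (fun g => (p g).1) h
      then (1 : ℝ) else 0) -
      ∏ h : F, S.μ.real {x | S.orbitPattern α E x = patternRow (fun g => (p g).1) h})

theorem defect_prod_coind_le (S : PMPSystem G X) {α : X → A} (hα : Measurable α)
    (B : PMPSystem (G × H) Y) (γ : Y → A') (s : G → Equiv.Perm V) (t : H → Equiv.Perm W)
    (E : Finset G) (F : Finset H) (y : V × W → A') (x : W → V → A) :
    defect ((S.coind H).prod B) (fun p : G × H => Equiv.prodCongr (s p.1) (t p.2))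
        (fun z => (α (z.1 1), γ z.2)) (E ×ˢ F) (fun q => (x q.2 q.1, y q)) ≤
      (∑ p, |patternDeviation S α s t E F y p x|) +
        defect B (fun p : G × H => Equiv.prodCongr (s p.1) (t p.2)) γ (E ×ˢ F) y := by
  set r : G × H → Equiv.Perm (V × W) := fun p => Equiv.prodCongr (s p.1) (t p.2)
  set m : ((E ×ˢ F : Finset (G × H)) → A) → ℝ := fun p =>
    ∏ h : F, S.μ.real {x | S.orbitPattern α E x = patternRow p h}
  set l : ((E ×ˢ F : Finset (G × H)) → A') → ℝ := fun p =>
    B.μ.real {y | B.orbitPattern γ (E ×ˢ F) y = p}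
  have hαe : Measurable fun x : H → X => α (x 1) := hα.comp (measurable_pi_apply 1)
  have hm : ∀ p, m p = (S.coind H).μ.real
      {x | (S.coind H).orbitPattern (fun x => α (x 1)) (E ×ˢ F) x = p} := fun p =>
    (measureReal_coind_orbitPattern S hα E F p).symm
  have hm0 : ∀ p, 0 ≤ m p := fun p => by rw [hm]; exact measureReal_nonneg
  have hm1 : ∑ p, m p = 1 := by
    have := sum_measureReal_eq_mul (S.coind H).μ
      ((S.coind H).measurable_orbitPattern hαe (E ×ˢ F)) fun _ => 1
    simpa [hm] using this
  have hlaw : ∀ p, ((S.coind H).prod B).μ.real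
      {z | ((S.coind H).prod B).orbitPattern (fun z => (α (z.1 1), γ z.2)) (E ×ˢ F) z = p} =
      m (fun g => (p g).1) * l (fun g => (p g).2) := by
    intro p
    have : {z | ((S.coind H).prod B).orbitPattern (fun z => (α (z.1 1), γ z.2)) (E ×ˢ F) z = p} =
        {x | (S.coind H).orbitPattern (fun x => α (x 1)) (E ×ˢ F) x = fun g => (p g).1} ×ˢ
        {y | B.orbitPattern γ (E ×ˢ F) y = fun g => (p g).2} := by
      ext z
      simp only [mem_ofPred_eq, mem_prod, funext_iff, Prod.ext_iff, ← forall_and]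
      rfl
    rw [this, hm]
    exact measureReal_prod_prod _ _
  have hfreq : ∀ p, freq (fun q => pattern r (E ×ˢ F) (fun q => (x q.2 q.1, y q)) q = p) =
      patternDeviation S α s t E F y p x +
        m (fun g => (p g).1) * freq (fun q => pattern r (E ×ˢ F) y q = fun g => (p g).2) := by
    intro p
    rw [freq, freq, Finset.mul_expect, patternDeviation, ← Finset.expect_add_distrib]
    refine Finset.expect_congr rfl fun q _ => ?_
    have h1 : (∏ h : F, if pattern s E (x (t h q.2)) q.1 = patternRow (fun g => (p g).1) h
        then (1 : ℝ) else 0) =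
        if ∀ h : F, pattern s E (x (t h q.2)) q.1 = patternRow (fun g => (p g).1) h
          then (1 : ℝ) else 0 := by
      rw [Finset.prod_boole]; simp
    have h2 : (pattern r (E ×ˢ F) (fun q => (x q.2 q.1, y q)) q = p) ↔
        (∀ h : F, pattern s E (x (t h q.2)) q.1 = patternRow (fun g => (p g).1) h) ∧
          (pattern r (E ×ˢ F) y q = fun g => (p g).2) := by
      have h3 := patternRow_injective (p := pattern r (E ×ˢ F) (fun q : V × W => x q.2 q.1) q)
        (q := fun g => (p g).1)
      have h4 : (∀ h : F, pattern s E (x (t h q.2)) q.1 = patternRow (fun g => (p g).1) h) ↔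
          pattern r (E ×ˢ F) (fun q : V × W => x q.2 q.1) q = fun g => (p g).1 := h3.symm
      rw [h4]
      simp only [funext_iff, ← forall_and, Prod.ext_iff, pattern]
    rw [h1]
    change _ = (if pattern r (E ×ˢ F) y q = fun g => (p g).2 then (1 : ℝ) else 0) * (_ - m _) + _
    by_cases c1 : ∀ h : F, pattern s E (x (t h q.2)) q.1 = patternRow (fun g => (p g).1) h
    · by_cases c2 : pattern r (E ×ˢ F) y q = fun g => (p g).2
      · rw [if_pos (h2.mpr ⟨c1, c2⟩), if_pos c1, if_pos c2, if_pos c2]; ring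
      · rw [if_neg (fun h => c2 (h2.mp h).2), if_neg c2, if_neg c2]; ring
    · rw [if_neg (fun h => c1 (h2.mp h).1), if_neg c1]
      by_cases c2 : pattern r (E ×ˢ F) y q = fun g => (p g).2
      · rw [if_pos c2, if_pos c2]; ring
      · rw [if_neg c2, if_neg c2]; ring
  have hsum : ∑ p : (E ×ˢ F : Finset (G × H)) → A × A', m (fun g => (p g).1) *
      |freq (fun q => pattern r (E ×ˢ F) y q = fun g => (p g).2) - l (fun g => (p g).2)| =
      defect B r γ (E ×ˢ F) y := by
    let e : ((E ×ˢ F : Finset (G × H)) → A × A') ≃ _ := Equiv.arrowProdEquivProdArrow _ _ _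
    calc _ = ∑ pp : ((E ×ˢ F : Finset (G × H)) → A) × ((E ×ˢ F : Finset (G × H)) → A'),
        m pp.1 * |freq (fun q => pattern r (E ×ˢ F) y q = pp.2) - l pp.2| :=
          Fintype.sum_equiv e _ _ fun p => rfl
      _ = (∑ p, m p) * ∑ p', |freq (fun q => pattern r (E ×ˢ F) y q = p') - l p'| := by
          rw [Fintype.sum_prod_type, Finset.sum_mul]
          refine Finset.sum_congr rfl fun p _ => ?_
          rw [Finset.mul_sum]
      _ = _ := by rw [hm1, one_mul, defect_eq_sum]
  rw [defect_eq_sum, ← hsum, ← Finset.sum_add_distrib]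
  refine Finset.sum_le_sum fun p _ => ?_
  rw [hfreq, hlaw, add_sub_assoc, ← mul_sub]
  refine (abs_add_le _ _).trans ?_
  rw [abs_mul, abs_of_nonneg (hm0 _)]

variable [Nonempty V] [Nonempty W]

/-- With high probability, independent random columns with nearly the right pattern frequencies
form, together with a given model of another system, a model of the product. -/
theorem one_sub_le_sum_weight (S : PMPSystem G X) {α : X → A} (hα : Measurable α)
    (B : PMPSystem (G × H) Y) (γ : Y → A') (s : G → Equiv.Perm V) (t : H → Equiv.Perm W)
    (E : Finset G) (F : Finset H) (y : V × W → A') {θ : (V → A) → ℝ} (hθ : ∀ z, 0 ≤ θ z)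
    (hθ1 : ∑ z, θ z = 1) {c ε : ℝ}
    (hc : ∀ q : E → A, 𝔼 v, |(∑ z, θ z * if pattern s E z v = q then (1 : ℝ) else 0) -
      S.μ.real {x | S.orbitPattern α E x = q}| ≤ c) (hε : 0 < ε)
    (hy : defect B (fun p : G × H => Equiv.prodCongr (s p.1) (t p.2)) γ (E ×ˢ F) y < ε / 2) :
    1 - (Fintype.card ((E ×ˢ F : Finset (G × H)) → A × A') : ℝ) ^ 2 * (4 / ε ^ 2) *
        (freq (fun p : W × W => ¬ Function.Injective
          (Sum.elim (fun k : F => t k p.1) (fun k : F => t k p.2))) + F.card * c) ≤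
      ∑ x ∈ Finset.univ.filter (fun x : W → V → A =>
        defect ((S.coind H).prod B) (fun p : G × H => Equiv.prodCongr (s p.1) (t p.2))
          (fun z => (α (z.1 1), γ z.2)) (E ×ˢ F) (fun q => (x q.2 q.1, y q)) < ε),
        ∏ w, θ (x w) := by
  set N : ℝ := (Fintype.card ((E ×ˢ F : Finset (G × H)) → A × A') : ℝ) with hN
  set M : ℝ := freq (fun p : W × W => ¬ Function.Injective
          (Sum.elim (fun k : F => t k p.1) (fun k : F => t k p.2))) + F.card * c
  set q : (W → V → A) → ℝ := fun x => ∏ w, θ (x w)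
  have hq : ∀ x, 0 ≤ q x := fun x => Finset.prod_nonneg fun w _ => hθ _
  have hq1 : ∑ x, q x = 1 := sum_prod_weight hθ1
  set R := fun (x : W → V → A) p => patternDeviation S α s t E F y p x
  have hM : ∀ p, ∑ x, q x * R x p ^ 2 ≤ M := by
    intro p
    have hl : ∀ h : F, 0 ≤ S.μ.real {x | S.orbitPattern α E x = patternRow (fun g => (p g).1) h} ∧
        S.μ.real {x | S.orbitPattern α E x = patternRow (fun g => (p g).1) h} ≤ 1 := fun h =>
      ⟨measureReal_nonneg, measureReal_le_one⟩
    refine (second_moment_le hθ hθ1 (fun k : F => t k)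
      (fun v h z => if pattern s E z v = patternRow (fun g => (p g).1) h then (1 : ℝ) else 0)
      (fun v k z => by split_ifs <;> norm_num) ⟨Finset.prod_nonneg fun h _ => (hl h).1,
        Finset.prod_le_one (fun h _ => (hl h).1) fun h _ => (hl h).2⟩
      (fun v w => if pattern (fun p : G × H => Equiv.prodCongr (s p.1) (t p.2)) (E ×ˢ F) y (v, w) =
        fun g => (p g).2 then (1 : ℝ) else 0)
      (fun v w => by split_ifs <;> norm_num)).trans ?_
    refine add_le_add le_rfl ?_
    calc _ ≤ 𝔼 v, ∑ h : F, |(∑ z, θ z * if pattern s E z v = patternRow (fun g => (p g).1) h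
          then (1 : ℝ) else 0) -
          S.μ.real {x | S.orbitPattern α E x = patternRow (fun g => (p g).1) h}| := by
          refine Finset.expect_le_expect fun v _ => abs_prod_sub_prod_le _ (fun h => ?_) hl
          refine ⟨Finset.sum_nonneg fun z _ => mul_nonneg (hθ z) (by split_ifs <;> norm_num),
            le_of_le_of_eq (Finset.sum_le_sum fun z _ => mul_le_of_le_one_right (hθ z) ?_) hθ1⟩
          split_ifs <;> norm_num
      _ ≤ ∑ _h : F, c := by
          rw [Finset.expect_sum_comm]
          exact Finset.sum_le_sum fun h _ => hc _
      _ = _ := by simp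
  have hbad : ∀ x, q x * (1 - N * (4 / ε ^ 2) * ∑ p, R x p ^ 2) ≤
      if defect ((S.coind H).prod B) (fun p : G × H => Equiv.prodCongr (s p.1) (t p.2))
          (fun z => (α (z.1 1), γ z.2)) (E ×ˢ F) (fun q => (x q.2 q.1, y q)) < ε
        then q x else 0 := by
    intro x
    have hsq : 0 ≤ ∑ p, R x p ^ 2 := Finset.sum_nonneg fun p _ => sq_nonneg _
    have hN0 : 0 ≤ N := Nat.cast_nonneg _
    split_ifs with h
    · exact mul_le_of_le_one_right (hq x) (by
        have : 0 ≤ N * (4 / ε ^ 2) * ∑ p, R x p ^ 2 := by positivity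
        linarith)
    · refine mul_nonpos_of_nonneg_of_nonpos (hq x) ?_
      have h1 := defect_prod_coind_le S hα B γ s t E F y x
      have h2 : ε / 2 ≤ ∑ p, |R x p| := by
        have : ∑ p, |R x p| = ∑ p, |patternDeviation S α s t E F y p x| := rfl
        linarith [not_lt.mp h]
      have h3 : (∑ p, |R x p|) ^ 2 ≤ N * ∑ p, R x p ^ 2 := by
        have := sq_sum_le_card_mul_sum_sq (s := Finset.univ) (f := fun p => |R x p|)
        simpa only [sq_abs, Finset.card_univ, ← hN] using this
      have h4 : (ε / 2) ^ 2 ≤ N * ∑ p, R x p ^ 2 :=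
        (pow_le_pow_left₀ (by positivity) h2 2).trans h3
      have h5 : 4 / ε ^ 2 * (ε / 2) ^ 2 = 1 := by field_simp; norm_num
      have h6 := mul_le_mul_of_nonneg_left h4 (show 0 ≤ 4 / ε ^ 2 by positivity)
      rw [h5] at h6
      linarith [mul_comm N (4 / ε ^ 2), mul_assoc (4 / ε ^ 2) N (∑ p, R x p ^ 2)]
  rw [Finset.sum_filter]
  refine le_trans ?_ (Finset.sum_le_sum fun x _ => hbad x)
  have e : ∑ x, q x * (1 - N * (4 / ε ^ 2) * ∑ p, R x p ^ 2) =
      1 - N * (4 / ε ^ 2) * ∑ p, ∑ x, q x * R x p ^ 2 := by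
    simp only [mul_sub, mul_one, Finset.sum_sub_distrib, hq1]
    congr 1
    rw [Finset.sum_comm, Finset.mul_sum]
    refine Finset.sum_congr rfl fun x _ => ?_
    rw [← Finset.mul_sum]; ring
  rw [e]
  have h7 : ∑ p, ∑ x, q x * R x p ^ 2 ≤ N * M := by
    refine (Finset.sum_le_sum fun p _ => hM p).trans (le_of_eq ?_)
    rw [Finset.sum_const, nsmul_eq_mul, Finset.card_univ]
  have h8 := mul_le_mul_of_nonneg_left h7 (show 0 ≤ N * (4 / ε ^ 2) by positivity)
  nlinarith

end RandomModels

section Counting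

open scoped Classical BigOperators

variable {G H : Type*} [Group G] [Group H] {X Y : Type*} [MeasurableSpace X] [MeasurableSpace Y]
  {A A' D D' : Type*} [Fintype A] [MeasurableSpace A] [MeasurableSingletonClass A]
  [Fintype A'] [Fintype D]

/-- A lower bound for the number of models of the product of a co-induced system with another
system. -/
theorem card_mul_card_le_card_modelImage_prod {V W : Type*} [Fintype V] [Fintype W] [Nonempty V]
    [Nonempty W] (S : PMPSystem G X) {α : X → A} (hα : Measurable α) (π : A → D)
    (B : PMPSystem (G × H) Y) (γ : Y → A') (π' : A' → D') (s : G → Equiv.Perm V)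
    (t : H → Equiv.Perm W) (E : Finset G) (F : Finset H) {F' : Finset H} (hF' : F'.Nonempty)
    {ε δ κ η : ℝ} (hε : 0 < ε) (hκ : κ < 1)
    (hM : (Fintype.card ((E ×ˢ F : Finset (G × H)) → A × A') : ℝ) ^ 2 * (4 / ε ^ 2) *
        (freq (fun p : W × W => ¬ Function.Injective
          (Sum.elim (fun k : F => t k p.1) (fun k : F => t k p.2))) +
          F.card * Real.sqrt (1 / F'.card + δ)) ≤ κ)
    (hη : Real.log 2 + κ * (Fintype.card W * (Fintype.card V * Real.log (Fintype.card D))) ≤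
      η * Fintype.card (V × W)) :
    ((modelImage (S.coind H) (fun p : G × H => Equiv.prodCongr (s p.1) (t p.2))
        (fun x => α (x 1)) π (E ×ˢ F') δ).card : ℝ) *
      (modelImage B (fun p : G × H => Equiv.prodCongr (s p.1) (t p.2)) γ π' (E ×ˢ F)
        (ε / 2)).card ≤
      Real.exp (η * Fintype.card (V × W)) *
        (modelImage ((S.coind H).prod B) (fun p : G × H => Equiv.prodCongr (s p.1) (t p.2))
          (fun z => (α (z.1 1), γ z.2)) (Prod.map π π') (E ×ˢ F) ε).card := by
  set r : G × H → Equiv.Perm (V × W) := fun p => Equiv.prodCongr (s p.1) (t p.2)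
  set U₀ := modelImage (S.coind H) r (fun x => α (x 1)) π (E ×ˢ F') δ
  set UY := modelImage B r γ π' (E ×ˢ F) (ε / 2)
  set R := modelImage ((S.coind H).prod B) r (fun z => (α (z.1 1), γ z.2)) (Prod.map π π') (E ×ˢ F) ε
  rcases U₀.eq_empty_or_nonempty with hU₀ | hU₀
  · rw [hU₀]; simp only [Finset.card_empty, Nat.cast_zero, zero_mul]; positivity
  have : Nonempty (V × W → A) := by
    obtain ⟨b, hb⟩ := hU₀
    exact ⟨(mem_modelImage.mp hb).choose⟩
  choose! f hf hfb using fun (b : V × W → D) (hb : b ∈ U₀) => mem_modelImage.mp hb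
  set U : Finset (W → V → A) := U₀.image fun b w v => f b (v, w)
  set U' : Finset (W → V → D) := U₀.image fun b w v => b (v, w)
  have hinj' : Set.InjOn (fun (b : V × W → D) w v => b (v, w)) U₀ := fun b _ b' _ h =>
    funext fun q => congrFun (congrFun h q.2) q.1
  have hinj : Set.InjOn (fun (b : V × W → D) w v => f b (v, w)) U₀ := by
    intro b hb b' hb' h
    rw [← hfb b hb, ← hfb b' hb']
    funext q
    exact congrArg π (congrFun (congrFun h q.2) q.1)
  have hU : U.Nonempty := hU₀.image _
  have hU' : U'.Nonempty := hU₀.image _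
  have hcard : U.card = U₀.card := Finset.card_image_of_injOn hinj
  have hcard' : U'.card = U₀.card := Finset.card_image_of_injOn hinj'
  have hpush : ∀ d : V → D, ∑ z ∈ Finset.univ.filter (fun z : V → A => (fun v => π (z v)) = d),
      averageMarginal U z = averageMarginal U' d := by
    intro d
    have h1 := sum_averageMarginal_mul U
      fun z => if (fun v => π (z v)) = d then (1 : ℝ) else 0
    simp only [mul_ite, mul_one, mul_zero] at h1
    rw [Finset.sum_filter, h1, averageMarginal, hcard, hcard', Finset.sum_image hinj,
      Finset.sum_image hinj']
    congr 1
    refine Finset.sum_congr rfl fun b hb => Finset.sum_congr rfl fun w _ => ?_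
    have : (fun v => π (f b (v, w))) = fun v => b (v, w) :=
      funext fun v => congrFun (hfb b hb) (v, w)
    by_cases h : (fun v => b (v, w)) = d
    · rw [this, if_pos h, if_pos h]
    · rw [this, if_neg h, if_neg h]
  have hc := fun q : E → A => expect_abs_averageMarginal_sub_le S hα s t E hF' q hU (δ := δ) (by
    intro x hx
    obtain ⟨b, hb, rfl⟩ := Finset.mem_image.mp hx
    exact (hf b hb).le)
  have key : ∀ b ∈ UY, ∃ S' : Finset (W → V → D),
      ((U₀.card : ℝ) ≤ Real.exp (η * Fintype.card (V × W)) * S'.card) ∧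
      ∀ b' ∈ S', (fun q : V × W => (b' q.2 q.1, b q)) ∈ R := by
    intro b hb
    obtain ⟨y, hy, rfl⟩ := mem_modelImage.mp hb
    have hw := one_sub_le_sum_weight S hα B γ s t E F y (averageMarginal_nonneg U)
      (sum_averageMarginal hU) hc hε hy
    set Sy := Finset.univ.filter (fun x : W → V → A =>
        defect ((S.coind H).prod B) r (fun z => (α (z.1 1), γ z.2)) (E ×ˢ F)
          (fun q => (x q.2 q.1, y q)) < ε)
    set S' : Finset (W → V → D) := Sy.image fun x w v => π (x w v)
    have hSy : Sy.Nonempty := by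
      rw [Finset.nonempty_iff_ne_empty]
      intro h
      rw [h, Finset.sum_empty] at hw
      linarith
    have hw' : 1 - κ ≤ ∑ d ∈ S', ∏ w, averageMarginal U' (d w) := by
      calc 1 - κ ≤ ∑ x ∈ Sy, ∏ w, averageMarginal U (x w) := by linarith
        _ = ∑ d ∈ S', ∑ x ∈ Sy.filter (fun x => (fun w v => π (x w v)) = d),
            ∏ w, averageMarginal U (x w) :=
          (Finset.sum_fiberwise_of_maps_to (fun x hx => Finset.mem_image_of_mem _ hx) _).symm
        _ ≤ ∑ d ∈ S', ∏ w, averageMarginal U' (d w) := by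
          refine Finset.sum_le_sum fun d _ => ?_
          have h1 := sum_prod_weight_filter (averageMarginal U) (fun (z : V → A) v => π (z v)) d
          refine le_trans ?_ (le_of_eq (h1.trans (Finset.prod_congr rfl fun w _ =>
            Eq.trans ?_ (hpush (d w)))))
          · refine Finset.sum_le_sum_of_subset_of_nonneg (fun x hx => ?_) fun x _ _ =>
              Finset.prod_nonneg fun w _ => averageMarginal_nonneg U _
            exact (@Finset.mem_filter _ _ _ _ _).mpr ⟨Finset.mem_univ _, (Finset.mem_filter.mp hx).2⟩
          · exact Finset.sum_congr (by ext; simp) fun _ _ => rfl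
    refine ⟨S', ?_, fun b' hb' => ?_⟩
    · have h1 := log_card_le_of_averageMarginal hU' (hSy.image _) hw'
      rw [hcard', Fintype.card_fun, Nat.cast_pow, Real.log_pow] at h1
      have hpos : (0 : ℝ) < U₀.card := by exact_mod_cast hU₀.card_pos
      have hpos' : (0 : ℝ) < S'.card := by exact_mod_cast (hSy.image _).card_pos
      rw [← Real.log_le_log_iff hpos (by positivity), Real.log_mul (Real.exp_pos _).ne' hpos'.ne',
        Real.log_exp]
      linarith
    · obtain ⟨x, hx, rfl⟩ := Finset.mem_image.mp hb'
      exact mem_modelImage.mpr ⟨_, (Finset.mem_filter.mp hx).2, rfl⟩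
  choose! S' hS' hS'R using key
  have hsig : (UY.sigma S').card ≤ R.card := by
    refine Finset.card_le_card_of_injOn (fun p q => (p.2 q.2 q.1, p.1 q)) ?_ ?_
    · intro p hp
      have hp' := Finset.mem_sigma.mp hp
      exact hS'R p.1 hp'.1 p.2 hp'.2
    · rintro ⟨b, d⟩ _ ⟨b', d'⟩ _ h
      have h1 : b = b' := funext fun q => (Prod.ext_iff.mp (congrFun h q)).2
      have h2 : d = d' := funext fun w => funext fun v => (Prod.ext_iff.mp (congrFun h (v, w))).1
      rw [h1, h2]
  rw [Finset.card_sigma] at hsig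
  calc (U₀.card : ℝ) * UY.card = ∑ _b ∈ UY, (U₀.card : ℝ) := by
        rw [Finset.sum_const, nsmul_eq_mul, mul_comm]
    _ ≤ ∑ b ∈ UY, Real.exp (η * Fintype.card (V × W)) * (S' b).card :=
        Finset.sum_le_sum fun b hb => hS' b hb
    _ = Real.exp (η * Fintype.card (V × W)) * ((∑ b ∈ UY, (S' b).card : ℕ) : ℝ) := by
        rw [← Finset.mul_sum, Nat.cast_sum]
    _ ≤ _ := by gcongr

theorem IsSoficApprox.eventually_injective {W : ℕ → Type*} [∀ n, Fintype (W n)]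
    [∀ n, Nonempty (W n)] {t : ∀ n, H → Equiv.Perm (W n)} (ht : IsSoficApprox t) (F : Finset H)
    {κ : ℝ} (hκ : 0 < κ) :
    ∀ᶠ n in atTop, freq (fun w => ¬ Function.Injective fun k : F => t n k w) < κ := by
  have h : ∀ᶠ n in atTop, ∀ p ∈ F.offDiag,
      freq (fun w => t n p.1 w = t n p.2 w) < κ / (F.offDiag.card + 1) :=
    (Finset.eventually_all _).mpr fun p hp =>
      ht.eventually_ne (Finset.mem_offDiag.mp hp).2.2 (by positivity)
  filter_upwards [h] with n hn
  have h1 : freq (fun w => ¬ Function.Injective fun k : F => t n k w) ≤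
      freq (fun w => ∃ p ∈ F.offDiag, t n p.1 w = t n p.2 w) := by
    refine freq_mono fun w hw => ?_
    simp only [Function.Injective, not_forall] at hw
    obtain ⟨k, k', h1, h2⟩ := hw
    exact ⟨(k, k'), Finset.mem_offDiag.mpr ⟨k.2, k'.2, fun h => h2 (Subtype.ext h)⟩, h1⟩
  refine h1.trans_lt ((freq_exists_le _ fun (p : H × H) w => t n p.1 w = t n p.2 w).trans_lt ?_)
  refine (Finset.sum_le_sum fun p hp => (hn p hp).le).trans_lt ?_
  rw [Finset.sum_const, nsmul_eq_mul, mul_div_assoc', div_lt_iff₀ (by positivity)]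
  nlinarith

theorem IsSoficApprox.tendsto_card [Infinite H] {W : ℕ → Type*} [∀ n, Fintype (W n)]
    [∀ n, Nonempty (W n)] {t : ∀ n, H → Equiv.Perm (W n)} (ht : IsSoficApprox t) :
    Tendsto (fun n => Fintype.card (W n)) atTop atTop := by
  refine tendsto_atTop.mpr fun N => ?_
  obtain ⟨F, hF⟩ := Infinite.exists_subset_card_eq H N
  filter_upwards [ht.eventually_injective F zero_lt_one] with n hn
  have : ∃ w, Function.Injective fun k : F => t n k w := by
    by_contra hc
    push Not at hc
    have : freq (fun w => ¬ Function.Injective fun k : F => t n k w) = 1 := by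
      simp [freq, hc]
    linarith
  obtain ⟨w, hw⟩ := this
  have := Fintype.card_le_of_injective _ hw
  rwa [Fintype.card_coe, hF] at this

theorem modelImage_subset_of_subset {Γ Z V : Type*} [Group Γ] [MeasurableSpace Z] [Fintype V]
    [Nonempty V]
    (S : PMPSystem Γ Z) (s : Γ → Equiv.Perm V) {α : Z → A} (hα : Measurable α) (π : A → D')
    {F F' : Finset Γ} (h : F' ⊆ F) {ε ε' : ℝ} (hε : ε ≤ ε') :
    modelImage S s α π F ε ⊆ modelImage S s α π F' ε' := by
  intro b hb
  obtain ⟨a, ha, rfl⟩ := mem_modelImage.mp hb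
  exact mem_modelImage.mpr
    ⟨a, (defect_comp_le S s hα id h a).trans_lt (ha.trans_le hε), rfl⟩

/-- Models of a co-induced system and models of any other system can be combined to models of the
product system, up to a subexponential factor. -/
theorem exists_card_mul_card_le [Infinite H] {V W : ℕ → Type*} [∀ n, Fintype (V n)]
    [∀ n, Nonempty (V n)] [∀ n, Fintype (W n)] [∀ n, Nonempty (W n)]
    [MeasurableSpace A'] [MeasurableSingletonClass A']
    (σ : ∀ n, G → Equiv.Perm (V n)) {τ : ∀ n, H → Equiv.Perm (W n)} (hτ : IsSoficApprox τ)
    (S : PMPSystem G X) {α : X → A} (hα : Measurable α) (π : A → D)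
    (B : PMPSystem (G × H) Y) {γ : Y → A'} (hγ : Measurable γ) (π' : A' → D')
    (Q : Finset (G × H)) {ε η : ℝ} (hε : 0 < ε) (hη : 0 < η) :
    ∃ (Q₁ : Finset (G × H)) (ε₁ : ℝ) (Q₂ : Finset (G × H)) (ε₂ : ℝ), 0 < ε₁ ∧ 0 < ε₂ ∧
      ∀ᶠ n in atTop,
        ((modelImage (S.coind H) (prodApprox σ τ n) (fun x => α (x 1)) π Q₁ ε₁).card : ℝ) *
          (modelImage B (prodApprox σ τ n) γ π' Q₂ ε₂).card ≤
        Real.exp (η * Fintype.card (V n × W n)) *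
          (modelImage ((S.coind H).prod B) (prodApprox σ τ n) (fun z => (α (z.1 1), γ z.2))
            (Prod.map π π') Q ε).card := by
  set E : Finset G := Q.image Prod.fst
  set F : Finset H := Q.image Prod.snd
  have hQ : Q ⊆ E ×ˢ F := fun p hp => Finset.mem_product.mpr
    ⟨Finset.mem_image_of_mem _ hp, Finset.mem_image_of_mem _ hp⟩
  set N : ℝ := (Fintype.card ((E ×ˢ F : Finset (G × H)) → A × A') : ℝ) ^ 2 * (4 / ε ^ 2)
  have hN : 0 ≤ N := by positivity
  have hlD : 0 ≤ Real.log (Fintype.card D) := Real.log_natCast_nonneg _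
  obtain ⟨κ, hκ, hκ1, hκD⟩ : ∃ κ : ℝ, 0 < κ ∧ κ < 1 ∧ κ * Real.log (Fintype.card D) ≤ η / 2 := by
    refine ⟨min (1 / 2) (η / 2 / (Real.log (Fintype.card D) + 1)), by positivity,
      (min_le_left _ _).trans_lt (by norm_num), ?_⟩
    calc _ ≤ η / 2 / (Real.log (Fintype.card D) + 1) * Real.log (Fintype.card D) := by
          gcongr; exact min_le_right _ _
      _ ≤ η / 2 := by
          rw [div_mul_eq_mul_div, div_le_iff₀ (by positivity)]
          nlinarith
  set M : ℝ := κ / (N + 1)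
  have hM : 0 < M := by positivity
  have hNM : N * M ≤ κ := by
    rw [mul_div_assoc', div_le_iff₀ (by positivity)]; nlinarith
  set ρ : ℝ := (M / (2 * (F.card + 1))) ^ 2
  have hρ : 0 < ρ := by positivity
  obtain ⟨k, hk⟩ := exists_nat_gt (2 / ρ)
  have hk0 : (0 : ℝ) < k := lt_trans (by positivity) hk
  obtain ⟨F', hF'⟩ := Infinite.exists_subset_card_eq H k
  have hF'ne : F'.Nonempty := by
    rw [← Finset.card_pos, hF']; exact_mod_cast hk0
  have hsqrt : F.card * Real.sqrt (1 / F'.card + ρ / 2) ≤ M / 2 := by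
    have h1 : (1 : ℝ) / F'.card + ρ / 2 ≤ ρ := by
      rw [hF']
      rw [div_lt_iff₀ hρ] at hk
      have : 1 / (k : ℝ) ≤ ρ / 2 := by
        rw [div_le_iff₀ hk0]; linarith
      linarith
    have h2 : Real.sqrt (1 / F'.card + ρ / 2) ≤ M / (2 * (F.card + 1)) := by
      refine (Real.sqrt_le_sqrt h1).trans (le_of_eq (Real.sqrt_sq (by positivity)))
    calc _ ≤ (F.card : ℝ) * (M / (2 * (F.card + 1))) := by gcongr
      _ ≤ M / 2 := by
        rw [mul_div_assoc', div_le_div_iff₀ (by positivity) (by positivity)]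
        nlinarith
  refine ⟨E ×ˢ F', ρ / 2, E ×ˢ F, ε / 2, by positivity, by positivity, ?_⟩
  have hW : Tendsto (fun n => (Fintype.card (W n) : ℝ)) atTop atTop :=
    tendsto_natCast_atTop_atTop.comp hτ.tendsto_card
  have hW2 : ∀ᶠ n in atTop, (F.card : ℝ) ^ 2 / Fintype.card (W n) < M / 4 :=
    (tendsto_const_nhds.div_atTop hW).eventually_lt_const (by positivity)
  filter_upwards [hW.eventually_ge_atTop (Real.log 2 / (η / 2)),
    hτ.eventually_injective F (show 0 < M / 8 by positivity), hW2] with n h1 h2 h3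
  have hV : (1 : ℝ) ≤ Fintype.card (V n) := by exact_mod_cast Fintype.card_pos
  have hWn : (0 : ℝ) < Fintype.card (W n) := by exact_mod_cast Fintype.card_pos
  have h4 := freq_not_injective_sum_le (fun k : F => τ n k)
  rw [Fintype.card_coe] at h4
  refine (card_mul_card_le_card_modelImage_prod (η := η) S hα π B γ π' (σ n) (τ n) E F hF'ne hε hκ1
    (le_trans (mul_le_mul_of_nonneg_left ?_ hN) hNM) ?_).trans ?_
  · linarith
  · rw [Fintype.card_prod, Nat.cast_mul]
    rw [div_le_iff₀ (by positivity)] at h1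
    have h5 := mul_le_mul_of_nonneg_left hκD (mul_pos hWn (lt_of_lt_of_le one_pos hV)).le
    have h6 := mul_le_mul_of_nonneg_left hV (show 0 ≤ Fintype.card (W n) * (η / 2) by positivity)
    nlinarith
  · gcongr
    refine modelImage_subset_of_subset _ _ ?_ _ hQ le_rfl
    exact (hα.comp ((measurable_pi_apply 1).comp measurable_fst)).prodMk (hγ.comp measurable_snd)

end Counting

/-! ### Approximation of measurable sets and finite observables -/

section Approximation

variable {Z : Type*} [MeasurableSpace Z]

/-- Measurable sets of a generated `σ`-algebra are approximated by sets that depend on finitely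
many generators. -/
theorem exists_determined_set_approx (μ : Measure Z) [IsFiniteMeasure μ] {𝒪 : Set (Set Z)}
    (hO : ∀ c ∈ 𝒪, MeasurableSet c) {D : Set Z} (hD : MeasurableSet[MeasurableSpace.generateFrom 𝒪] D)
    {κ : ℝ} (hκ : 0 < κ) :
    ∃ 𝒟 : Finset (Set Z), ↑𝒟 ⊆ 𝒪 ∧ ∃ D' : Set Z,
      (∀ z z', (∀ c ∈ 𝒟, z ∈ c ↔ z' ∈ c) → (z ∈ D' ↔ z' ∈ D')) ∧
      μ.real {z | ¬ (z ∈ D ↔ z ∈ D')} < κ := by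
  classical
  revert κ
  have hle : MeasurableSpace.generateFrom 𝒪 ≤ ‹MeasurableSpace Z› :=
    MeasurableSpace.generateFrom_le hO
  induction D, hD using MeasurableSpace.generateFrom_induction with
  | hC t ht _ =>
    exact fun hκ => ⟨{t}, by simpa using ht, t, fun z z' h => h t (by simp), by simpa using hκ⟩
  | empty => exact fun hκ => ⟨∅, by simp, ∅, by simp, by simpa using hκ⟩
  | compl t _ ih =>
    intro κ hκ
    obtain ⟨𝒟, h1, D', h2, h3⟩ := ih hκ
    exact ⟨𝒟, h1, D'ᶜ, fun z z' h => not_congr (h2 z z' h), by simpa [not_iff_not] using h3⟩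
  | iUnion f hf ih =>
    intro κ hκ
    have hU : MeasurableSet (⋃ i, f i) := MeasurableSet.iUnion fun i => hle _ (hf i)
    have hacc : ∀ n, MeasurableSet (accumulate f n) := fun n =>
      MeasurableSet.biUnion (to_countable _) fun i _ => hle _ (hf i)
    have hlim : Tendsto (fun n => μ.real (accumulate f n)) atTop (𝓝 (μ.real (⋃ i, f i))) :=
      (ENNReal.tendsto_toReal (measure_ne_top _ _)).comp tendsto_measure_iUnion_accumulate
    obtain ⟨N, hN⟩ := (hlim.eventually_const_lt
      (show μ.real (⋃ i, f i) - κ / 2 < μ.real (⋃ i, f i) by linarith)).exists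
    have hsub : accumulate f N ⊆ ⋃ i, f i := iUnion₂_subset fun i _ => subset_iUnion f i
    have hdiff : μ.real ((⋃ i, f i) \ accumulate f N) < κ / 2 := by
      rw [measureReal_sdiff hsub (hacc N)]; linarith
    choose 𝒟 h1 D' h2 h3 using fun i => ih i (show 0 < κ / 2 / (N + 1) by positivity)
    refine ⟨(Finset.range (N + 1)).biUnion 𝒟, ?_, ⋃ i ∈ Finset.range (N + 1), D' i, ?_, ?_⟩
    · intro c hc
      obtain ⟨i, _, hi⟩ := Finset.mem_biUnion.mp hc
      exact h1 i hi
    · intro z z' h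
      simp only [mem_iUnion, exists_prop]
      refine exists_congr fun i => and_congr_right fun hi => h2 i z z' fun c hc => h c ?_
      exact Finset.mem_biUnion.mpr ⟨i, hi, hc⟩
    · have hcover : {z | ¬ (z ∈ ⋃ i, f i ↔ z ∈ ⋃ i ∈ Finset.range (N + 1), D' i)} ⊆
          ((⋃ i, f i) \ accumulate f N) ∪
            ⋃ i ∈ Finset.range (N + 1), {z | ¬ (z ∈ f i ↔ z ∈ D' i)} := by
        intro z hz
        by_contra hc
        apply hz
        simp only [mem_union, Set.mem_sdiff, mem_iUnion, accumulate_def, not_or, not_and, not_exists,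
          Finset.mem_range, Nat.lt_succ_iff, exists_prop, not_not, mem_ofPred_eq] at hc ⊢
        obtain ⟨c1, c2⟩ := hc
        constructor
        · intro h
          by_contra hc
          refine c1 h fun i hi hz => hc ?_
          exact ⟨i, hi, (c2 i hi).mp hz⟩
        · rintro ⟨i, hi, hz⟩
          exact ⟨i, (c2 i hi).mpr hz⟩
      refine (measureReal_mono hcover).trans_lt ((measureReal_union_le _ _).trans_lt ?_)
      have h4 : μ.real (⋃ i ∈ Finset.range (N + 1), {z | ¬ (z ∈ f i ↔ z ∈ D' i)}) ≤ κ / 2 := by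
        refine (measureReal_biUnion_finset_le _ _).trans
          ((Finset.sum_le_sum fun i _ => (h3 i).le).trans ?_)
        rw [Finset.sum_const, Finset.card_range, nsmul_eq_mul]
        push_cast
        rw [mul_div_cancel₀]
        positivity
      linarith

/-- Finite observables are approximated by observables that depend on finitely many sets of a
generating family. -/
theorem exists_determined_approx (μ : Measure Z) [IsProbabilityMeasure μ] {𝒪 : Set (Set Z)}
    (hO : ∀ c ∈ 𝒪, MeasurableSet c)
    (hgen : ∀ D, MeasurableSet D → ∃ D', MeasurableSet[MeasurableSpace.generateFrom 𝒪] D' ∧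
      D' =ᵐ[μ] D)
    {A : Type*} [Fintype A] [MeasurableSpace A] [MeasurableSingletonClass A] {α : Z → A}
    (hα : Measurable α) {κ : ℝ} (hκ : 0 < κ) :
    ∃ 𝒟 : Finset (Set Z), ↑𝒟 ⊆ 𝒪 ∧ ∃ α' : Z → A,
      (∀ z z', (∀ c ∈ 𝒟, z ∈ c ↔ z' ∈ c) → α' z = α' z') ∧ μ.real {z | α z ≠ α' z} < κ := by
  classical
  obtain ⟨z₀⟩ : Nonempty Z := μ.nonempty_of_neZero
  have happ : ∀ a, ∃ 𝒟 : Finset (Set Z), ↑𝒟 ⊆ 𝒪 ∧ ∃ D' : Set Z,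
      (∀ z z', (∀ c ∈ 𝒟, z ∈ c ↔ z' ∈ c) → (z ∈ D' ↔ z' ∈ D')) ∧
      μ.real {z | ¬ (α z = a ↔ z ∈ D')} < κ / (Fintype.card A + 1) := by
    intro a
    obtain ⟨D, hD, hDa⟩ := hgen (α ⁻¹' {a}) (hα (measurableSet_singleton a))
    obtain ⟨𝒟, h1, D', h2, h3⟩ := exists_determined_set_approx μ hO hD
      (show 0 < κ / (Fintype.card A + 1) by positivity)
    refine ⟨𝒟, h1, D', h2, lt_of_le_of_lt (le_of_eq ?_) h3⟩
    refine measureReal_congr ?_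
    filter_upwards [hDa] with z hz
    have hz' : (z ∈ D) = (α z = a) := hz
    change (¬ (α z = a ↔ z ∈ D')) = (¬ (z ∈ D ↔ z ∈ D'))
    rw [hz']
  choose 𝒟 h1 D' h2 h3 using happ
  set F : Set A → A := fun s => if h : s.Nonempty then h.some else α z₀
  have hF : ∀ a, F {a} = a := fun a => by
    have h : ({a} : Set A).Nonempty := singleton_nonempty a
    simp only [F, dif_pos h]
    exact h.some_mem
  refine ⟨Finset.univ.biUnion 𝒟, ?_, fun z => F {a | z ∈ D' a}, ?_, ?_⟩
  · intro c hc
    obtain ⟨i, _, hi⟩ := Finset.mem_biUnion.mp hc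
    exact h1 i hi
  · intro z z' h
    exact congrArg F (Set.ext fun a => h2 a z z' fun c hc =>
      h c (Finset.mem_biUnion.mpr ⟨a, Finset.mem_univ _, hc⟩))
  · have hcover : {z | α z ≠ F {a | z ∈ D' a}} ⊆ ⋃ a, {z | ¬ (α z = a ↔ z ∈ D' a)} := by
      intro z hz
      by_contra hc
      simp only [mem_iUnion, not_exists, mem_ofPred_eq, not_not] at hc
      apply hz
      have : {a | z ∈ D' a} = {α z} := by
        ext a
        rw [mem_ofPred_eq, ← hc a, mem_singleton_iff, eq_comm]
      rw [this, hF]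
    refine (measureReal_mono hcover).trans_lt ((measureReal_iUnion_fintype_le _).trans_lt
      ((Finset.sum_le_sum fun a _ => (h3 a).le).trans_lt ?_))
    rw [Finset.sum_const, Finset.card_univ, nsmul_eq_mul, mul_div_assoc', div_lt_iff₀ (by positivity)]
    nlinarith

/-- The preimages of the sets in `𝒪` under the elements of the group. -/
def PMPSystem.translates {Γ : Type*} [Group Γ] (S : PMPSystem Γ Z) (𝒪 : Set (Set Z)) :
    Set (Set Z) :=
  {c | ∃ k, ∃ c' ∈ 𝒪, (S.T k : Z → Z) ⁻¹' c' = c}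

/-- Finite observables are approximated by block codes of observables from a family whose
translates generate the `σ`-algebra. -/
theorem exists_blockCode_approx {Γ : Type*} [Group Γ] (S : PMPSystem Γ Z) {𝒪 : Set (Set Z)}
    (hO : ∀ c ∈ 𝒪, MeasurableSet c)
    (hgen : ∀ D, MeasurableSet D → ∃ D', MeasurableSet[MeasurableSpace.generateFrom
      (S.translates 𝒪)] D' ∧ D' =ᵐ[S.μ] D)
    {A : Type*} [Fintype A] [MeasurableSpace A] [MeasurableSingletonClass A] {α : Z → A}
    (hα : Measurable α) {κ : ℝ} (hκ : 0 < κ) :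
    ∃ (E : Finset Γ) (𝒟 : Finset (Set Z)), ↑𝒟 ⊆ 𝒪 ∧ ∀ {A' : Type*} (γ : Z → A'),
      (∀ c ∈ 𝒟, ∀ z z', γ z = γ z' → (z ∈ c ↔ z' ∈ c)) →
      ∃ ρ : (E → A') → A, S.μ.real {z | α z ≠ ρ fun k => γ (S.T k z)} < κ := by
  classical
  obtain ⟨z₀⟩ : Nonempty Z := S.μ.nonempty_of_neZero
  obtain ⟨𝒟, h1, α', h2, h3⟩ := exists_determined_approx S.μ (by
    rintro _ ⟨k, c', hc', rfl⟩
    exact S.measurable_T k (hO c' hc')) hgen hα hκ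
  have h1' : ∀ D ∈ 𝒟, ∃ k, ∃ c' ∈ 𝒪, (S.T k : Z → Z) ⁻¹' c' = D := fun D hD => h1 hD
  choose! k c hc hkc using h1'
  refine ⟨𝒟.image k, 𝒟.image c, ?_, fun {A'} γ hγ => ?_⟩
  · intro c' hc'
    obtain ⟨D, hD, rfl⟩ := Finset.mem_image.mp hc'
    exact hc D hD
  · have hfac : Function.FactorsThrough α' (fun z (j : 𝒟.image k) => γ (S.T j z)) := by
      intro z z' h
      refine h2 z z' fun D hD => ?_
      rw [← hkc D hD]
      exact hγ (c D) (Finset.mem_image_of_mem _ hD) _ _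
        (congrFun h ⟨k D, Finset.mem_image_of_mem _ hD⟩)
    refine ⟨Function.extend (fun z (j : 𝒟.image k) => γ (S.T j z)) α' fun _ => α z₀, ?_⟩
    simpa only [hfac.extend_apply] using h3

end Approximation

section Generators

variable {Γ G H : Type*} [Group Γ] [Group G] [Group H] {X Y : Type*} [mX : MeasurableSpace X]
  [mY : MeasurableSpace Y]

theorem le_generateFrom_translates_coind (S : PMPSystem G X) :
    MeasurableSpace.pi ≤ MeasurableSpace.generateFrom ((S.coind H).translates
      {c | ∃ C : Set X, MeasurableSet C ∧ {x : H → X | x 1 ∈ C} = c}) := by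
  refine iSup_le fun h => ?_
  rintro _ ⟨C, hC, rfl⟩
  refine MeasurableSpace.measurableSet_generateFrom ⟨(1, h), _, ⟨C, hC, rfl⟩, ?_⟩
  ext x
  change S.T 1 (x (1 * h)) ∈ C ↔ x h ∈ C
  rw [one_mul, S.T_one]

theorem le_generateFrom_translates_prod (S : PMPSystem Γ X) (S' : PMPSystem Γ Y)
    {𝒪 : Set (Set X)} {𝒪' : Set (Set Y)} (h : univ ∈ 𝒪) (h' : univ ∈ 𝒪')
    (hgen : mX ≤ MeasurableSpace.generateFrom (S.translates 𝒪))
    (hgen' : mY ≤ MeasurableSpace.generateFrom (S'.translates 𝒪')) :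
    Prod.instMeasurableSpace ≤
      MeasurableSpace.generateFrom ((S.prod S').translates (image2 (· ×ˢ ·) 𝒪 𝒪')) := by
  refine sup_le ?_ ?_
  · refine (MeasurableSpace.comap_mono hgen).trans ?_
    rw [MeasurableSpace.comap_generateFrom]
    refine MeasurableSpace.generateFrom_le ?_
    rintro _ ⟨_, ⟨k, c, hc, rfl⟩, rfl⟩
    refine MeasurableSpace.measurableSet_generateFrom ⟨k, _, ⟨c, hc, univ, h', rfl⟩, ?_⟩
    exact Set.ext fun z => iff_of_eq (and_true _)
  · refine (MeasurableSpace.comap_mono hgen').trans ?_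
    rw [MeasurableSpace.comap_generateFrom]
    refine MeasurableSpace.generateFrom_le ?_
    rintro _ ⟨_, ⟨k, c, hc, rfl⟩, rfl⟩
    refine MeasurableSpace.measurableSet_generateFrom ⟨k, _, ⟨univ, h, c, hc, rfl⟩, ?_⟩
    exact Set.ext fun z => iff_of_eq (true_and _)

theorem le_generateFrom_translates_measurableSet (S : PMPSystem Γ X) :
    mX ≤ MeasurableSpace.generateFrom (S.translates {c | MeasurableSet c}) := fun c hc =>
  MeasurableSpace.measurableSet_generateFrom ⟨1, c, hc, by rw [map_one]; rfl⟩

end Generators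

/-! ### Product approximations -/

section ProdApprox

variable {Γ G H : Type*} [Group Γ] [Group G] [Group H] {V W : ℕ → Type*} [∀ n, Fintype (V n)]
  [∀ n, Nonempty (V n)] [∀ n, Fintype (W n)] [∀ n, Nonempty (W n)]

theorem WHP.of_eventually_freq_not_lt {P : ∀ n, V n → Prop}
    (h : ∀ κ > 0, ∀ᶠ n in atTop, freq (fun v => ¬ P n v) < κ) : WHP P := by
  have : Tendsto (fun n => freq (P n)) atTop (𝓝 1) := by
    refine Metric.tendsto_atTop'.mpr fun κ hκ => ?_
    obtain ⟨N, hN⟩ := eventually_atTop.mp (h κ hκ)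
    refine ⟨N, fun n hn => ?_⟩
    have h1 := hN n hn.le
    rw [freq_not] at h1
    rw [Real.dist_eq, abs_lt]
    constructor <;> linarith [freq_le_one (P n)]
  simp only [freq_eq_card_div] at this
  exact this

theorem IsSoficApprox.prodApprox {σ : ∀ n, G → Equiv.Perm (V n)} {τ : ∀ n, H → Equiv.Perm (W n)}
    (hσ : IsSoficApprox σ) (hτ : IsSoficApprox τ) : IsSoficApprox (prodApprox σ τ) where
  mul g h := by
    refine WHP.of_eventually_freq_not_lt fun κ hκ => ?_
    filter_upwards [hσ.eventually_mul g.1 h.1 (half_pos hκ),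
      hτ.eventually_mul g.2 h.2 (half_pos hκ)] with n h1 h2
    rw [← freq_fst (W := W n)] at h1
    rw [← freq_snd (W := V n)] at h2
    refine lt_of_le_of_lt ((freq_mono fun q hq => ?_).trans (freq_or_le _ _))
      (add_lt_add h1 h2 |>.trans_eq (add_halves κ))
    by_contra hc
    simp only [not_or, not_not] at hc
    exact hq (Prod.ext hc.1 hc.2)
  free g hg := by
    refine WHP.of_eventually_freq_not_lt fun κ hκ => ?_
    by_cases h : g.1 = 1
    · have h' : g.2 ≠ 1 := fun h' => hg (Prod.ext h h')
      filter_upwards [(hτ.free g.2 h').eventually_freq_not_lt hκ] with n h1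
      rw [← freq_snd (W := V n)] at h1
      refine lt_of_le_of_lt (freq_mono fun q hq => ?_) h1
      exact not_not.mpr (congrArg Prod.snd (not_not.mp hq))
    · filter_upwards [(hσ.free g.1 h).eventually_freq_not_lt hκ] with n h1
      rw [← freq_fst (W := W n)] at h1
      refine lt_of_le_of_lt (freq_mono fun q hq => ?_) h1
      exact not_not.mpr (congrArg Prod.fst (not_not.mp hq))

end ProdApprox

section ProductLowerBound

open scoped Classical BigOperators

variable {G H : Type*} [Group G] [Group H] {X Y : Type*} [MeasurableSpace X] [MeasurableSpace Y]
  {V W : ℕ → Type*} [∀ n, Fintype (V n)] [∀ n, Nonempty (V n)] [∀ n, Fintype (W n)]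
  [∀ n, Nonempty (W n)]
  {A D D' : Type*} [Fintype A] [MeasurableSpace A] [MeasurableSingletonClass A]
  [Fintype D] [MeasurableSpace D] [MeasurableSingletonClass D]
  [Fintype D'] [MeasurableSpace D'] [MeasurableSingletonClass D']
  {σ : ∀ n, G → Equiv.Perm (V n)} {τ : ∀ n, H → Equiv.Perm (W n)}

/-- Every observable of the product of a co-induced system with another system is dominated, as
far as the number of models is concerned, by a pair of observables of the factors. -/
theorem exists_eventually_card_mul_card_le [Infinite H] (hσ : IsSoficApprox σ)
    (hτ : IsSoficApprox τ) (S : PMPSystem G X) (B : PMPSystem (G × H) Y) {β₀ : X → D}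
    (hβ₀ : Measurable β₀) {β' : Y → D'} (hβ' : Measurable β') {α : (H → X) × Y → A}
    (hα : Measurable α) {π : A → D × D'} (hπ : ∀ z, π (α z) = (β₀ (z.1 1), β' z.2))
    (F : Finset (G × H)) {ε η : ℝ} (hε : 0 < ε) (hη : 0 < η) :
    ∃ (m : ℕ) (α₁ : X → Fin m) (π₁ : Fin m → D) (F₁ : Finset (G × H)) (ε₁ : ℝ)
      (m' : ℕ) (α₂ : Y → Fin m') (π₂ : Fin m' → D') (F₂ : Finset (G × H)) (ε₂ : ℝ),
      Measurable α₁ ∧ 0 < ε₁ ∧ (∀ x, π₁ (α₁ x) = β₀ x) ∧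
      Measurable α₂ ∧ 0 < ε₂ ∧ (∀ y, π₂ (α₂ y) = β' y) ∧
      ∀ᶠ n in atTop,
        ((modelImage (S.coind H) (prodApprox σ τ n) (fun x => α₁ (x 1)) π₁ F₁ ε₁).card : ℝ) *
          (modelImage B (prodApprox σ τ n) α₂ π₂ F₂ ε₂).card ≤
        Real.exp (η * Fintype.card (V n × W n)) *
          (modelImage ((S.coind H).prod B) (prodApprox σ τ n) α π F ε).card := by
  obtain ⟨κ, hκ, hC⟩ := exists_card_modelImage_le (hσ.prodApprox hτ) ((S.coind H).prod B) hα π F hε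
    (half_pos hη)
  have hO : ∀ c ∈ image2 (· ×ˢ ·) {c | ∃ C : Set X, MeasurableSet C ∧ {x : H → X | x 1 ∈ C} = c}
      {D : Set Y | MeasurableSet D}, MeasurableSet c := by
    rintro _ ⟨_, ⟨C, hC, rfl⟩, E, hE, rfl⟩
    exact (measurable_pi_apply (1 : H) hC).prod hE
  have hgen := le_generateFrom_translates_prod (S.coind H) B
    (𝒪 := {c | ∃ C : Set X, MeasurableSet C ∧ {x : H → X | x 1 ∈ C} = c})
    ⟨univ, MeasurableSet.univ, by simp⟩ (𝒪' := {D | MeasurableSet D}) MeasurableSet.univ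
    (le_generateFrom_translates_coind S) (le_generateFrom_translates_measurableSet B)
  obtain ⟨E, 𝒟, h𝒟, hρ⟩ := exists_blockCode_approx ((S.coind H).prod B) hO (fun D hD =>
    ⟨D, hgen D hD, EventuallyEq.rfl⟩) hα hκ
  have h𝒟' : ∀ c ∈ 𝒟, ∃ (C : Set X) (C' : Set Y), MeasurableSet C ∧ MeasurableSet C' ∧
      ∀ z, z ∈ c ↔ z.1 1 ∈ C ∧ z.2 ∈ C' := by
    intro c hc
    obtain ⟨_, ⟨C, hC, rfl⟩, C', hC', rfl⟩ := h𝒟 hc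
    exact ⟨C, C', hC, hC', fun z => Iff.rfl⟩
  choose! C C' hCm hCm' hCC using h𝒟'
  set e₁ := Fintype.equivFin ((𝒟 → Prop) × D)
  set e₂ := Fintype.equivFin ((𝒟 → Prop) × D')
  set α₁ : X → Fin _ := fun x => e₁ (fun c => x ∈ C c, β₀ x)
  set α₂ : Y → Fin _ := fun y => e₂ (fun c => y ∈ C' c, β' y)
  have hα₁ : Measurable α₁ := (measurable_of_countable e₁).comp
    ((measurable_pi_lambda _ fun c : 𝒟 => measurableSet_setOfPred.mp (hCm c c.2)).prodMk hβ₀)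
  have hα₂ : Measurable α₂ := (measurable_of_countable e₂).comp
    ((measurable_pi_lambda _ fun c : 𝒟 => measurableSet_setOfPred.mp (hCm' c c.2)).prodMk hβ')
  have hγ : Measurable fun z : (H → X) × Y => (α₁ (z.1 1), α₂ z.2) :=
    (hα₁.comp ((measurable_pi_apply 1).comp measurable_fst)).prodMk (hα₂.comp measurable_snd)
  have hπ₁ : ∀ x, (e₁.symm (α₁ x)).2 = β₀ x := fun x => by simp [α₁]
  have hπ₂ : ∀ y, (e₂.symm (α₂ y)).2 = β' y := fun x => by simp [α₂]
  obtain ⟨ρ, hρ⟩ := hρ (fun z : (H → X) × Y => (α₁ (z.1 1), α₂ z.2)) (by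
    intro c hc z z' h
    rw [Prod.mk.injEq] at h
    have h1 := congrFun (Prod.ext_iff.mp (e₁.injective h.1)).1 ⟨c, hc⟩
    have h2 := congrFun (Prod.ext_iff.mp (e₂.injective h.2)).1 ⟨c, hc⟩
    rw [hCC c hc, hCC c hc]
    exact and_congr (iff_of_eq h1) (iff_of_eq h2))
  obtain ⟨F', ε', hε', hcard⟩ := hC (Prod.map (fun i => (e₁.symm i).2) (fun i => (e₂.symm i).2)) hγ
    (fun z => by rw [hπ, Prod.map_apply, hπ₁, hπ₂]) E ρ hρ
  obtain ⟨F₁, ε₁, F₂, ε₂, hε₁, hε₂, hprod⟩ := exists_card_mul_card_le σ hτ S hα₁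
    (fun i => (e₁.symm i).2) B hα₂ (fun i => (e₂.symm i).2) F' hε' (half_pos hη)
  refine ⟨_, α₁, fun i => (e₁.symm i).2, F₁, ε₁, _, α₂, fun i => (e₂.symm i).2, F₂, ε₂,
    hα₁, hε₁, hπ₁, hα₂, hε₂, hπ₂, ?_⟩
  filter_upwards [hcard, hprod] with n h1 h2
  refine h2.trans ((mul_le_mul_of_nonneg_left h1 (Real.exp_pos _).le).trans (le_of_eq ?_))
  rw [← mul_assoc, ← Real.exp_add]
  congr 2
  ring

end ProductLowerBound

/-! ### Entropy inequalities for products -/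

theorem EReal.le_of_forall_pos_le_add_coe {a b : EReal}
    (h : ∀ η : ℝ, 0 < η → a ≤ b + (η : EReal)) : a ≤ b := by
  refine EReal.le_of_forall_lt_iff_le.mp fun z hz => ?_
  induction b with
  | bot => exact (h 1 one_pos).trans (by simp)
  | top => simp at hz
  | coe b =>
    have hz' : b < z := by exact_mod_cast hz
    refine (h (z - b) (by linarith)).trans (le_of_eq ?_)
    rw [← EReal.coe_add]; simp

section Rates

variable {Γ Γ' Γ'' : Type*} [Group Γ] [Group Γ'] [Group Γ''] {X Y Z : Type*} [MeasurableSpace X]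
  [MeasurableSpace Y] [MeasurableSpace Z] {V : ℕ → Type*} [∀ n, Fintype (V n)]
  {A A' A'' D D' D'' : Type*} [Fintype A] [Fintype A'] [Fintype A'']
  {S : PMPSystem Γ X} {S' : PMPSystem Γ' Y} {S'' : PMPSystem Γ'' Z}
  {s : ∀ n, Γ → Equiv.Perm (V n)} {s' : ∀ n, Γ' → Equiv.Perm (V n)}
  {s'' : ∀ n, Γ'' → Equiv.Perm (V n)}
  {α : X → A} {α' : Y → A'} {α'' : Z → A''} {π : A → D} {π' : A' → D'} {π'' : A'' → D''}
  {F : Finset Γ} {F' : Finset Γ'} {F'' : Finset Γ''} {ε ε' ε'' η : ℝ} {n : ℕ}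

theorem modelRate_le_add_modelRate
    (h : (modelImage S'' (s'' n) α'' π'' F'' ε'').card ≤
      (modelImage S (s n) α π F ε).card * (modelImage S' (s' n) α' π' F' ε').card) :
    modelRate S'' s'' α'' π'' F'' ε'' n ≤
      modelRate S s α π F ε n + modelRate S' s' α' π' F' ε' n := by
  have hc : (0 : EReal) ≤ (Fintype.card (V n) : EReal) := by exact_mod_cast Nat.zero_le _
  unfold modelRate
  rw [← EReal.add_div_of_nonneg_right hc, ← ENNReal.log_mul_add]
  exact EReal.div_le_div_right_of_nonneg hc (ENNReal.log_le_log (by exact_mod_cast h))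

variable [∀ n, Nonempty (V n)]

theorem modelRate_add_le_modelRate_add
    (h : ((modelImage S (s n) α π F ε).card : ℝ) * (modelImage S' (s' n) α' π' F' ε').card ≤
      Real.exp (η * Fintype.card (V n)) * (modelImage S'' (s'' n) α'' π'' F'' ε'').card) :
    modelRate S s α π F ε n + modelRate S' s' α' π' F' ε' n ≤
      modelRate S'' s'' α'' π'' F'' ε'' n + (η : EReal) := by
  have hc : (0 : EReal) ≤ (Fintype.card (V n) : EReal) := by exact_mod_cast Nat.zero_le _
  unfold modelRate
  rw [← EReal.add_div_of_nonneg_right hc, ← ENNReal.log_mul_add]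
  refine log_div_le_add Fintype.card_ne_zero ?_
  rw [← ENNReal.ofReal_natCast, ← ENNReal.ofReal_natCast, ← ENNReal.ofReal_natCast,
    ← ENNReal.ofReal_mul (Real.exp_pos _).le, ← ENNReal.ofReal_mul (Nat.cast_nonneg _)]
  exact ENNReal.ofReal_le_ofReal h

theorem mul_modelRate_le_modelRate_add {k : ℕ}
    (h : ((modelImage S (s n) α π F ε).card : ℝ) ^ k ≤
      Real.exp (η * Fintype.card (V n)) * (modelImage S' (s' n) α' π' F' ε').card) :
    (k : EReal) * modelRate S s α π F ε n ≤ modelRate S' s' α' π' F' ε' n + (η : EReal) := by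
  unfold modelRate
  rw [EReal.mul_div, ← ENNReal.log_pow]
  refine log_div_le_add Fintype.card_ne_zero ?_
  rw [← ENNReal.ofReal_natCast, ← ENNReal.ofReal_natCast,
    ← ENNReal.ofReal_mul (Real.exp_pos _).le, ← ENNReal.ofReal_pow (Nat.cast_nonneg _)]
  exact ENNReal.ofReal_le_ofReal h

theorem modelRate_le_log_card [Fintype D] :
    modelRate S s α π F ε n ≤ (Real.log (Fintype.card D) : EReal) := by
  classical
  rcases isEmpty_or_nonempty D with hD | hD
  · have : IsEmpty (V n → D) := ⟨fun f => hD.elim (f (Classical.arbitrary _))⟩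
    have : modelImage S (s n) α π F ε = ∅ := Finset.eq_empty_of_isEmpty _
    have hc : (0 : EReal) < (Fintype.card (V n) : EReal) := by exact_mod_cast Fintype.card_pos
    simp only [modelRate, this, Finset.card_empty, Nat.cast_zero, ENNReal.log_zero]
    rw [EReal.bot_div_of_pos_ne_top hc (EReal.natCast_ne_top _)]
    exact bot_le
  · have h1 : ((modelImage S (s n) α π F ε).card : ℝ≥0∞) ≤
        ENNReal.ofReal (Real.exp (Real.log (Fintype.card D) * Fintype.card (V n))) * 1 := by
      rw [Real.exp_mul, Real.exp_log (by exact_mod_cast Fintype.card_pos), mul_one,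
        Real.rpow_natCast, ENNReal.ofReal_pow (Nat.cast_nonneg _), ENNReal.ofReal_natCast]
      have := Finset.card_le_univ (modelImage S (s n) α π F ε)
      rw [Fintype.card_fun] at this
      exact_mod_cast this
    refine (log_div_le_add Fintype.card_ne_zero h1).trans (le_of_eq ?_)
    rw [ENNReal.log_one, EReal.zero_div, zero_add]

end Rates

section Coinduction

open scoped Classical

variable {G H : Type*} [Group G] [Group H] {X Y : Type*} [MeasurableSpace X] [MeasurableSpace Y]
  {V W : ℕ → Type*} [∀ n, Fintype (V n)] [∀ n, Nonempty (V n)] [∀ n, Fintype (W n)]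
  [∀ n, Nonempty (W n)]
  {D D' : Type*}
  [Fintype D] [MeasurableSpace D] [MeasurableSingletonClass D]
  [Fintype D'] [MeasurableSpace D'] [MeasurableSingletonClass D']
  {σ : ∀ n, G → Equiv.Perm (V n)} {τ : ∀ n, H → Equiv.Perm (W n)}

theorem add_observableEntropy_le_observableEntropy_prod [Infinite H] (hσ : IsSoficApprox σ)
    (hτ : IsSoficApprox τ) (S : PMPSystem G X) (B : PMPSystem (G × H) Y) {β₀ : X → D}
    (hβ₀ : Measurable β₀) {β' : Y → D'} (hβ' : Measurable β') :
    observableEntropy (fun u => limsup u atTop) (S.coind H) (prodApprox σ τ) (fun x => β₀ (x 1)) +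
        observableEntropy (fun u => liminf u atTop) B (prodApprox σ τ) β' ≤
      observableEntropy (fun u => limsup u atTop) ((S.coind H).prod B) (prodApprox σ τ)
        fun z => (β₀ (z.1 1), β' z.2) := by
  refine le_iInf fun m => le_iInf fun α => le_iInf fun π => le_iInf fun F => le_iInf fun ε =>
    le_iInf fun ⟨hα, hε, hπ⟩ => EReal.le_of_forall_pos_le_add_coe fun η hη => ?_
  obtain ⟨m₁, α₁, π₁, F₁, ε₁, m₂, α₂, π₂, F₂, ε₂, hα₁, hε₁, hπ₁, hα₂, hε₂, hπ₂, h⟩ :=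
    exists_eventually_card_mul_card_le hσ hτ S B hβ₀ hβ' hα hπ F hε hη
  have h1 := observableEntropy_le isLimitFunctional_limsup (S.coind H) (prodApprox σ τ)
    (fun x => β₀ (x 1)) (hα₁.comp (measurable_pi_apply 1)) (fun x => hπ₁ (x 1)) F₁ hε₁
  have h2 := observableEntropy_le isLimitFunctional_liminf B (prodApprox σ τ) β' hα₂ hπ₂ F₂ hε₂
  refine (add_le_add h1 h2).trans (EReal.le_limsup_add.trans ?_)
  refine (isLimitFunctional_limsup.mono _ _ ?_).trans (isLimitFunctional_limsup.add_const _ η)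
  filter_upwards [h] with n hn
  exact modelRate_add_le_modelRate_add hn

/-- The entropy of a co-induced system is determined by observables of a single coordinate. -/
theorem partitionEntropy_coind_le {L : (ℕ → EReal) → EReal} (hL : IsLimitFunctional L)
    (hσ : IsSoficApprox σ) (hτ : IsSoficApprox τ) (S : PMPSystem G X) {c : EReal}
    (h : ∀ (m : ℕ) (β₀ : X → Fin m), Measurable β₀ →
      observableEntropy L (S.coind H) (prodApprox σ τ) (fun x => β₀ (x 1)) ≤ c) :
    partitionEntropy L (S.coind H) (prodApprox σ τ) ≤ c := by
  refine iSup_le fun m => iSup_le fun β => iSup_le fun hβ =>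
    EReal.le_of_forall_pos_le_add_coe fun η hη => ?_
  obtain ⟨κ, hκ, hG⟩ := exists_observableEntropy_le_add hL (hσ.prodApprox hτ) (S.coind H) hβ hη
  have hO : ∀ c ∈ {c | ∃ C : Set X, MeasurableSet C ∧ {x : H → X | x 1 ∈ C} = c},
      MeasurableSet c := by
    rintro _ ⟨C, hC, rfl⟩
    exact measurable_pi_apply (1 : H) hC
  obtain ⟨E, 𝒟, h𝒟, hρ⟩ := exists_blockCode_approx (S.coind H) hO (fun D hD =>
    ⟨D, le_generateFrom_translates_coind S D hD, EventuallyEq.rfl⟩) hβ hκ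
  have h𝒟' : ∀ c ∈ 𝒟, ∃ C : Set X, MeasurableSet C ∧ {x : H → X | x 1 ∈ C} = c :=
    fun c hc => h𝒟 hc
  choose! C hC hCc using h𝒟'
  set e := Fintype.equivFin (𝒟 → Prop)
  have hβ₀ : Measurable fun x : X => e fun c => x ∈ C c := (measurable_of_countable e).comp
    (measurable_pi_lambda _ fun c : 𝒟 => measurableSet_setOfPred.mp (hC c c.2))
  obtain ⟨ρ, hρ⟩ := hρ (fun x => e fun c : 𝒟 => x 1 ∈ C c) (by
    intro c hc z z' h
    rw [← hCc c hc]
    exact iff_of_eq (congrFun (e.injective h) ⟨c, hc⟩))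
  exact (hG _ E ρ hρ).trans (add_le_add_left (h _ _ hβ₀) _)

end Coinduction

section Factors

open scoped Classical

variable {Γ : Type*} [Group Γ] {X Y : Type*} [MeasurableSpace X] [MeasurableSpace Y]

theorem defect_comp_factor {V : Type*} [Fintype V] (S : PMPSystem Γ X) (S' : PMPSystem Γ Y)
    {Φ : X → Y} (hΦ : MeasurePreserving Φ S.μ S'.μ) (hT : ∀ g x, Φ (S.T g x) = S'.T g (Φ x))
    {A : Type*} [Fintype A] [MeasurableSpace A] [MeasurableSingletonClass A] {α : Y → A}
    (hα : Measurable α) (s : Γ → Equiv.Perm V) (F : Finset Γ) (a : V → A) :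
    defect S s (fun x => α (Φ x)) F a = defect S' s α F a := by
  rw [defect_eq_sum, defect_eq_sum]
  refine Finset.sum_congr rfl fun p _ => ?_
  have hm : MeasurableSet {y | S'.orbitPattern α F y = p} :=
    S'.measurable_orbitPattern hα F (measurableSet_singleton p)
  rw [← hΦ.measureReal_preimage hm.nullMeasurableSet]
  have : {x | S.orbitPattern (fun x => α (Φ x)) F x = p} =
      Φ ⁻¹' {y | S'.orbitPattern α F y = p} := by
    ext x
    have : S.orbitPattern (fun x => α (Φ x)) F x = S'.orbitPattern α F (Φ x) :=
      funext fun g => congrArg α (hT g x)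
    change S.orbitPattern (fun x => α (Φ x)) F x = p ↔ S'.orbitPattern α F (Φ x) = p
    rw [this]
  rw [this]

variable {V : ℕ → Type*} [∀ n, Fintype (V n)] [∀ n, Nonempty (V n)]
  {s : ∀ n, Γ → Equiv.Perm (V n)}

theorem partitionEntropy_le_of_equiv {L : (ℕ → EReal) → EReal} (hL : IsLimitFunctional L)
    (S : PMPSystem Γ X) (S' : PMPSystem Γ Y) (e : X ≃ᵐ Y)
    (he : MeasurePreserving e S.μ S'.μ) (hT : ∀ g x, e (S.T g x) = S'.T g (e x)) :
    partitionEntropy L S' s ≤ partitionEntropy L S s := by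
  refine iSup_le fun m => iSup_le fun β => iSup_le fun hβ => ?_
  refine le_trans ?_ (observableEntropy_le_partitionEntropy hL S s (hβ.comp e.measurable))
  refine le_iInf fun m' => le_iInf fun α => le_iInf fun π => le_iInf fun F => le_iInf fun ε =>
    le_iInf fun ⟨hα, hε, hπ⟩ => ?_
  have hα' : Measurable fun y => α (e.symm y) := hα.comp e.symm.measurable
  refine (observableEntropy_le hL S' s β hα' (π := π) (fun y => by simp [hπ]) F hε).trans ?_
  refine hL.mono _ _ (Eventually.of_forall fun n => modelRate_mono (Finset.card_le_card ?_))
  intro b hb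
  obtain ⟨a, ha, rfl⟩ := mem_modelImage.mp hb
  refine mem_modelImage.mpr ⟨a, ?_, rfl⟩
  rw [← defect_comp_factor S S' he hT hα'] at ha
  simpa using ha

theorem observableEntropy_limsup_ne_top (S : PMPSystem Γ X) {D : Type*} [Fintype D]
    [MeasurableSpace D] [MeasurableSingletonClass D]
    {β : X → D} (hβ : Measurable β) :
    observableEntropy (fun u => limsup u atTop) S s β ≠ ⊤ := by
  have h := (observableEntropy_le isLimitFunctional_limsup S s β hβ (π := id) (fun _ => rfl) ∅
    one_pos).trans (limsup_le_of_le (h := Eventually.of_forall fun n => modelRate_le_log_card))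
  exact ne_top_of_le_ne_top (EReal.coe_ne_top _) h

theorem observableEntropy_prod_le (S : PMPSystem Γ X) (S' : PMPSystem Γ Y) {D D' : Type*}
    [Fintype D] [MeasurableSpace D] [MeasurableSingletonClass D]
    [Fintype D'] [MeasurableSpace D'] [MeasurableSingletonClass D']
    {β : X → D} (hβ : Measurable β) {β' : Y → D'} (hβ' : Measurable β') :
    observableEntropy (fun u => limsup u atTop) (S.prod S') s (fun z => (β z.1, β' z.2)) ≤
      observableEntropy (fun u => limsup u atTop) S s β +
        observableEntropy (fun u => limsup u atTop) S' s β' := by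
  have hn := observableEntropy_limsup_ne_top (s := s) S hβ
  have hn' := observableEntropy_limsup_ne_top (s := s) S' hβ'
  refine EReal.le_add_of_forall_gt (Or.inr hn') (Or.inl hn) fun c hc c' hc' => ?_
  simp only [observableEntropy, gt_iff_lt, iInf_lt_iff] at hc hc'
  obtain ⟨m₁, α₁, π₁, F₁, ε₁, ⟨hα₁, hε₁, hπ₁⟩, h1⟩ := hc
  obtain ⟨m₂, α₂, π₂, F₂, ε₂, ⟨hα₂, hε₂, hπ₂⟩, h2⟩ := hc'
  have hα : Measurable fun z : X × Y => (α₁ z.1, α₂ z.2) :=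
    (hα₁.comp measurable_fst).prodMk (hα₂.comp measurable_snd)
  refine (observableEntropy_le isLimitFunctional_limsup (S.prod S') s _ hα
    (π := Prod.map π₁ π₂) (fun z => by simp [hπ₁, hπ₂]) (F₁ ∪ F₂) (lt_min hε₁ hε₂)).trans ?_
  have hb : limsup (modelRate S' s α₂ π₂ F₂ ε₂) atTop ≠ ⊤ :=
    ne_top_of_le_ne_top (EReal.coe_ne_top _)
      (limsup_le_of_le (h := Eventually.of_forall fun n => modelRate_le_log_card))
  refine le_trans ?_ ((EReal.limsup_add_le (Or.inr hb)
    (Or.inl (ne_top_of_lt h1))).trans (add_le_add h1.le h2.le))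
  refine isLimitFunctional_limsup.mono _ _ (Eventually.of_forall fun n =>
    modelRate_le_add_modelRate ?_)
  rw [← Finset.card_product]
  refine Finset.card_le_card_of_injOn (fun b => (fun v => (b v).1, fun v => (b v).2)) ?_ ?_
  · intro b hb
    obtain ⟨a, ha, rfl⟩ := mem_modelImage.mp hb
    refine Finset.mem_coe.mpr (Finset.mem_product.mpr ⟨mem_modelImage.mpr ⟨fun v => (a v).1, ?_, rfl⟩,
      mem_modelImage.mpr ⟨fun v => (a v).2, ?_, rfl⟩⟩)
    · rw [← defect_comp_factor (S.prod S') S measurePreserving_fst (fun _ _ => rfl) hα₁]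
      exact (defect_comp_le (S.prod S') (s n) hα Prod.fst Finset.subset_union_left a).trans_lt
        (ha.trans_le (min_le_left _ _))
    · rw [← defect_comp_factor (S.prod S') S' measurePreserving_snd (fun _ _ => rfl) hα₂]
      exact (defect_comp_le (S.prod S') (s n) hα Prod.snd Finset.subset_union_right a).trans_lt
        (ha.trans_le (min_le_right _ _))
  · intro b _ b' _ h
    rw [Prod.mk.injEq] at h
    exact funext fun v => Prod.ext (congrFun h.1 v) (congrFun h.2 v)

theorem partitionEntropy_prod_le (hs : IsSoficApprox s) (S : PMPSystem Γ X) (S' : PMPSystem Γ Y) :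
    partitionEntropy (fun u => limsup u atTop) (S.prod S') s ≤
      partitionEntropy (fun u => limsup u atTop) S s +
        partitionEntropy (fun u => limsup u atTop) S' s := by
  refine iSup_le fun m => iSup_le fun β => iSup_le fun hβ =>
    EReal.le_of_forall_pos_le_add_coe fun η hη => ?_
  obtain ⟨κ, hκ, hG⟩ :=
    exists_observableEntropy_le_add isLimitFunctional_limsup hs (S.prod S') hβ hη
  have hO : ∀ c ∈ image2 (· ×ˢ ·) {c : Set X | MeasurableSet c} {c : Set Y | MeasurableSet c},
      MeasurableSet c := by
    rintro _ ⟨C, hC, C', hC', rfl⟩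
    exact MeasurableSet.prod hC hC'
  have hgen := le_generateFrom_translates_prod S S'
    (𝒪 := {c | MeasurableSet c}) MeasurableSet.univ (𝒪' := {c | MeasurableSet c})
    MeasurableSet.univ (le_generateFrom_translates_measurableSet S)
    (le_generateFrom_translates_measurableSet S')
  obtain ⟨E, 𝒟, h𝒟, hρ⟩ := exists_blockCode_approx (S.prod S') hO (fun D hD =>
    ⟨D, hgen D hD, EventuallyEq.rfl⟩) hβ hκ
  have h𝒟' : ∀ c ∈ 𝒟, ∃ (C : Set X) (C' : Set Y), MeasurableSet C ∧ MeasurableSet C' ∧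
      C ×ˢ C' = c := by
    intro c hc
    obtain ⟨C, hC, C', hC', h⟩ := h𝒟 hc
    exact ⟨C, C', hC, hC', h⟩
  choose! C C' hC hC' hCc using h𝒟'
  have hβ₁ : Measurable fun (x : X) (c : 𝒟) => x ∈ C c :=
    measurable_pi_lambda _ fun c : 𝒟 => measurableSet_setOfPred.mp (hC c c.2)
  have hβ₂ : Measurable fun (y : Y) (c : 𝒟) => y ∈ C' c :=
    measurable_pi_lambda _ fun c : 𝒟 => measurableSet_setOfPred.mp (hC' c c.2)
  obtain ⟨ρ, hρ⟩ := hρ (fun z : X × Y => (fun c : 𝒟 => z.1 ∈ C c, fun c : 𝒟 => z.2 ∈ C' c)) (by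
    intro c hc z z' h
    rw [Prod.mk.injEq] at h
    rw [← hCc c hc]
    exact and_congr (iff_of_eq (congrFun h.1 ⟨c, hc⟩)) (iff_of_eq (congrFun h.2 ⟨c, hc⟩)))
  refine (hG _ E ρ hρ).trans (add_le_add_left ((observableEntropy_prod_le S S' hβ₁ hβ₂).trans ?_) _)
  exact add_le_add (observableEntropy_le_partitionEntropy isLimitFunctional_limsup S s hβ₁)
    (observableEntropy_le_partitionEntropy isLimitFunctional_limsup S' s hβ₂)

/-- A power of a system splits off one factor. -/
noncomputable def PMPSystem.powSuccEquiv (X : Type*) [MeasurableSpace X] (k : ℕ) :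
    (X × (Fin k → X)) ≃ᵐ (Fin (k + 1) → X) :=
  (MeasurableEquiv.piFinSuccAbove (fun _ => X) 0).symm

theorem PMPSystem.measurePreserving_powSuccEquiv (S : PMPSystem Γ X) (k : ℕ) :
    MeasurePreserving (PMPSystem.powSuccEquiv X k) (S.prod (S.pow k)).μ (S.pow (k + 1)).μ :=
  (measurePreserving_piFinSuccAbove (fun _ : Fin (k + 1) => S.μ) 0).symm _

theorem PMPSystem.powSuccEquiv_T (S : PMPSystem Γ X) (k : ℕ) (g : Γ) (z : X × (Fin k → X)) :
    PMPSystem.powSuccEquiv X k ((S.prod (S.pow k)).T g z) =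
      (S.pow (k + 1)).T g (PMPSystem.powSuccEquiv X k z) := by
  funext i
  induction i using Fin.cases <;> rfl

theorem partitionEntropy_pow_le (hs : IsSoficApprox s) (S : PMPSystem Γ X) (k : ℕ) :
    partitionEntropy (fun u => limsup u atTop) (S.pow k) s ≤
      (k : EReal) * partitionEntropy (fun u => limsup u atTop) S s := by
  induction k with
  | zero =>
    rw [Nat.cast_zero, zero_mul]
    refine iSup_le fun m => iSup_le fun β => iSup_le fun hβ =>
      EReal.le_of_forall_pos_le_add_coe fun η hη => ?_
    obtain ⟨κ, hκ, hG⟩ :=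
      exists_observableEntropy_le_add isLimitFunctional_limsup hs (S.pow 0) hβ hη
    refine (hG (fun _ => ()) ∅ (fun _ => β Fin.elim0) ?_).trans (add_le_add_left ?_ _)
    · have : {x | β x ≠ β Fin.elim0} = ∅ :=
        eq_empty_of_forall_notMem fun x hx => hx (by rw [Subsingleton.elim x Fin.elim0])
      rw [this]; simpa using hκ
    · refine (observableEntropy_le isLimitFunctional_limsup (S.pow 0) s _ (α := fun _ => ())
        measurable_const (π := id) (fun _ => rfl) ∅ one_pos).trans
        (limsup_le_of_le (h := Eventually.of_forall fun n => modelRate_le_log_card.trans ?_))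
      simp
  | succ k ih =>
    refine (partitionEntropy_le_of_equiv isLimitFunctional_limsup _ _ (PMPSystem.powSuccEquiv X k)
      (S.measurePreserving_powSuccEquiv k) (S.powSuccEquiv_T k)).trans ?_
    refine (partitionEntropy_prod_le hs S (S.pow k)).trans ((add_le_add_right ih _).trans ?_)
    rw [Nat.cast_succ, EReal.right_distrib_of_nonneg (by exact_mod_cast Nat.zero_le _) zero_le_one,
      one_mul, add_comm]

end Factors

section CoinductionPowers

open scoped Classical

variable {G H : Type*} [Group G] [Group H] {X : Type*} [MeasurableSpace X]
  {V W : ℕ → Type*} [∀ n, Fintype (V n)] [∀ n, Nonempty (V n)] [∀ n, Fintype (W n)]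
  [∀ n, Nonempty (W n)]
  {σ : ∀ n, G → Equiv.Perm (V n)} {τ : ∀ n, H → Equiv.Perm (W n)}

/-- The entropy of a co-induced system is the entropy of a generating partition of the system. -/
theorem partitionEntropy_coind_le_of_generating {L : (ℕ → EReal) → EReal}
    (hL : IsLimitFunctional L) (hσ : IsSoficApprox σ) (hτ : IsSoficApprox τ) (S : PMPSystem G X)
    {m : ℕ} {f : X → Fin m} (hf : Measurable f)
    (hgen : ∀ D : Set X, MeasurableSet D →
      ∃ E : Set X, MeasurableSet[⨆ g : G, MeasurableSpace.comap (fun x => f (S.T g x)) ⊤] E ∧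
        E =ᵐ[S.μ] D) :
    partitionEntropy L (S.coind H) (prodApprox σ τ) ≤
      observableEntropy L (S.coind H) (prodApprox σ τ) fun x => f (x 1) := by
  refine partitionEntropy_coind_le hL hσ hτ S fun m' β₀ hβ₀ =>
    EReal.le_of_forall_pos_le_add_coe fun η hη => ?_
  obtain ⟨κ, hκ, hG⟩ := exists_observableEntropy_le_add hL (hσ.prodApprox hτ) (S.coind H)
    (β := fun x : H → X => β₀ (x 1)) (hβ₀.comp (measurable_pi_apply 1)) hη
  have hO : ∀ c ∈ {c | ∃ P : Set (Fin m), f ⁻¹' P = c}, MeasurableSet c := by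
    rintro _ ⟨P, rfl⟩
    exact hf (MeasurableSet.of_discrete)
  have hle : (⨆ g : G, MeasurableSpace.comap (fun x => f (S.T g x)) ⊤) ≤
      MeasurableSpace.generateFrom (S.translates {c | ∃ P : Set (Fin m), f ⁻¹' P = c}) := by
    refine iSup_le fun g => ?_
    rintro _ ⟨P, _, rfl⟩
    exact MeasurableSpace.measurableSet_generateFrom ⟨g, _, ⟨P, rfl⟩, rfl⟩
  obtain ⟨E, 𝒟, h𝒟, hρ⟩ := exists_blockCode_approx S hO (fun D hD => by
    obtain ⟨D', hD', h⟩ := hgen D hD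
    exact ⟨D', hle D' hD', h⟩) hβ₀ hκ
  obtain ⟨ρ, hρ⟩ := hρ f (by
    intro c hc z z' h
    obtain ⟨P, rfl⟩ := h𝒟 hc
    rw [mem_preimage, mem_preimage, h])
  have hE : ∀ k : E, ((k : G), (1 : H)) ∈ E ×ˢ ({1} : Finset H) := fun k => by simp
  refine hG (fun x => f (x 1)) (E ×ˢ {1}) (fun q => ρ fun k => q ⟨(k, 1), hE k⟩) ?_
  refine lt_of_le_of_lt (le_of_eq ?_) hρ
  have hm : MeasurableSet {x | β₀ x ≠ ρ fun k : E => f (S.T k x)} :=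
    (measurableSet_eq_fun hβ₀ ((measurable_of_countable ρ).comp
      (S.measurable_orbitPattern hf E))).compl
  rw [← (measurePreserving_eval_infinitePi (fun _ : H => S.μ) 1).measureReal_preimage
    hm.nullMeasurableSet]
  refine congrArg (S.coind H).μ.real (Set.ext fun x => ?_)
  have : ∀ k : G, (S.coind H).T (k, 1) x 1 = S.T k (x 1) := fun k => by
    rw [PMPSystem.coind_T]
    simp
  change (β₀ (x 1) ≠ ρ fun k : E => f ((S.coind H).T (k, 1) x 1)) ↔
    (β₀ (x 1) ≠ ρ fun k : E => f (S.T k (x 1)))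
  simp only [this]

variable {D : Type*} [Fintype D] [MeasurableSpace D] [MeasurableSingletonClass D]

/-- Every observable of a power of a co-induced system is dominated, as far as the number of models
is concerned, by an observable of a single coordinate. -/
theorem exists_eventually_card_pow_le [Infinite H] (hσ : IsSoficApprox σ) (hτ : IsSoficApprox τ)
    (S : PMPSystem G X) {β₀ : X → D} (hβ₀ : Measurable β₀) (k : ℕ) :
    ∀ {m : ℕ} {α : (Fin k → H → X) → Fin m}, Measurable α → ∀ {π : Fin m → Fin k → D},
      (∀ z, π (α z) = fun i => β₀ (z i 1)) → ∀ (F : Finset (G × H)) {ε η : ℝ}, 0 < ε → 0 < η →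
      ∃ (m₁ : ℕ) (α₁ : X → Fin m₁) (π₁ : Fin m₁ → D) (F₁ : Finset (G × H)) (ε₁ : ℝ),
        Measurable α₁ ∧ 0 < ε₁ ∧ (∀ x, π₁ (α₁ x) = β₀ x) ∧
        ∀ᶠ n in atTop,
          ((modelImage (S.coind H) (prodApprox σ τ n) (fun x => α₁ (x 1)) π₁ F₁ ε₁).card : ℝ) ^ k ≤
          Real.exp (η * Fintype.card (V n × W n)) *
            (modelImage ((S.coind H).pow k) (prodApprox σ τ n) α π F ε).card := by
  induction k with
  | zero =>
    intro m α hα π hπ F ε η hε hη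
    set e := Fintype.equivFin D
    refine ⟨_, fun x => e (β₀ x), fun i => e.symm i, ∅, 1, (measurable_of_countable e).comp hβ₀,
      one_pos, fun x => e.symm_apply_apply _, Eventually.of_forall fun n => ?_⟩
    have hne : (modelImage ((S.coind H).pow 0) (prodApprox σ τ n) α π F ε).Nonempty := by
      refine ⟨_, mem_modelImage.mpr ⟨fun _ => α Fin.elim0, lt_of_le_of_lt (le_of_eq ?_) hε, rfl⟩⟩
      rw [defect_eq_sum]
      refine Finset.sum_eq_zero fun p _ => ?_
      have h1 : ∀ x, ((S.coind H).pow 0).orbitPattern α F x = fun _ => α Fin.elim0 := fun x =>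
        funext fun g => congrArg α (Subsingleton.elim _ _)
      have h2 : ∀ v, pattern (prodApprox σ τ n) F (fun _ => α Fin.elim0) v =
        fun _ => α Fin.elim0 := fun v => rfl
      simp only [h1, h2]
      by_cases h : (fun _ => α Fin.elim0) = p
      · simp [h, freq]
      · simp [h, freq]
    have h1 : (1 : ℝ) ≤ Real.exp (η * Fintype.card (V n × W n)) :=
      Real.one_le_exp (by positivity)
    have h2 : (1 : ℝ) ≤ (modelImage ((S.coind H).pow 0) (prodApprox σ τ n) α π F ε).card := by
      exact_mod_cast hne.card_pos
    rw [pow_zero]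
    nlinarith
  | succ k ih =>
    intro m α hα π hπ F ε η hε hη
    set e := PMPSystem.powSuccEquiv (H → X) k
    obtain ⟨m₁, α₁, π₁, F₁, ε₁, m₂, α₂, π₂, F₂, ε₂, hα₁, hε₁, hπ₁, hα₂, hε₂, hπ₂, h⟩ :=
      exists_eventually_card_mul_card_le hσ hτ S ((S.coind H).pow k) hβ₀
        (β' := fun z i => β₀ (z i 1)) (measurable_pi_lambda _ fun i => hβ₀.comp
          ((measurable_pi_apply 1).comp (measurable_pi_apply i))) (hα.comp e.measurable)
        (π := fun a => (π a 0, fun i => π a i.succ)) (fun z => by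
          simp only [Function.comp_apply, hπ]; rfl) F hε (half_pos hη)
    obtain ⟨m₃, α₃, π₃, F₃, ε₃, hα₃, hε₃, hπ₃, h'⟩ := ih hα₂ hπ₂ F₂ hε₂ (half_pos hη)
    set K := {p : Fin m₁ × Fin m₃ // π₁ p.1 = π₃ p.2}
    set e' := Fintype.equivFin K
    set α' : X → K := fun x => ⟨(α₁ x, α₃ x), by rw [hπ₁, hπ₃]⟩
    have hα' : Measurable α' := (hα₁.prodMk hα₃).subtype_mk
    have hα'' : Measurable fun x : H → X => e' (α' (x 1)) :=
      (measurable_of_countable e').comp (hα'.comp (measurable_pi_apply 1))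
    refine ⟨_, fun x => e' (α' x), fun i => π₁ (e'.symm i).1.1, F₁ ∪ F₃, min ε₁ ε₃,
      (measurable_of_countable e').comp hα', lt_min hε₁ hε₃, fun x => by simp [α', hπ₁], ?_⟩
    filter_upwards [h, h'] with n hn hn'
    have hc₁ : modelImage (S.coind H) (prodApprox σ τ n) (fun x => e' (α' (x 1)))
          (fun i => π₁ (e'.symm i).1.1) (F₁ ∪ F₃) (min ε₁ ε₃) ⊆
        modelImage (S.coind H) (prodApprox σ τ n) (fun x => α₁ (x 1)) π₁ F₁ ε₁ := by
      intro b hb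
      obtain ⟨a, ha, rfl⟩ := mem_modelImage.mp hb
      refine mem_modelImage.mpr ⟨fun v => (e'.symm (a v)).1.1, ?_, rfl⟩
      have := defect_comp_le (S.coind H) (prodApprox σ τ n) hα''
        (fun i => (e'.symm i).1.1) (Finset.subset_union_left (s₁ := F₁) (s₂ := F₃)) a
      simp only [Equiv.symm_apply_apply] at this
      exact this.trans_lt (ha.trans_le (min_le_left _ _))
    have hc₃ : modelImage (S.coind H) (prodApprox σ τ n) (fun x => e' (α' (x 1)))
          (fun i => π₁ (e'.symm i).1.1) (F₁ ∪ F₃) (min ε₁ ε₃) ⊆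
        modelImage (S.coind H) (prodApprox σ τ n) (fun x => α₃ (x 1)) π₃ F₃ ε₃ := by
      intro b hb
      obtain ⟨a, ha, rfl⟩ := mem_modelImage.mp hb
      refine mem_modelImage.mpr ⟨fun v => (e'.symm (a v)).1.2, ?_,
        funext fun v => (e'.symm (a v)).2.symm⟩
      have := defect_comp_le (S.coind H) (prodApprox σ τ n) hα''
        (fun i => (e'.symm i).1.2) (Finset.subset_union_right (s₁ := F₁) (s₂ := F₃)) a
      simp only [Equiv.symm_apply_apply] at this
      exact this.trans_lt (ha.trans_le (min_le_right _ _))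
    have hc : (modelImage ((S.coind H).prod ((S.coind H).pow k)) (prodApprox σ τ n) (α ∘ e)
          (fun a => (π a 0, fun i : Fin k => π a i.succ)) F ε).card ≤
        (modelImage ((S.coind H).pow (k + 1)) (prodApprox σ τ n) α π F ε).card := by
      refine le_trans (Finset.card_le_card fun b hb => ?_) (Finset.card_image_le
        (s := modelImage ((S.coind H).pow (k + 1)) (prodApprox σ τ n) α π F ε)
        (f := fun b v => (b v 0, fun i : Fin k => b v i.succ)))
      obtain ⟨a, ha, rfl⟩ := mem_modelImage.mp hb
      refine Finset.mem_image.mpr ⟨_, mem_modelImage.mpr ⟨a, ?_, rfl⟩, rfl⟩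
      rw [← defect_comp_factor ((S.coind H).prod ((S.coind H).pow k)) ((S.coind H).pow (k + 1))
        ((S.coind H).measurePreserving_powSuccEquiv k) ((S.coind H).powSuccEquiv_T k) hα]
      exact ha
    set N := (modelImage (S.coind H) (prodApprox σ τ n) (fun x => e' (α' (x 1)))
          (fun i => π₁ (e'.symm i).1.1) (F₁ ∪ F₃) (min ε₁ ε₃)).card
    set c : ℝ := ((Fintype.card (V n × W n) : ℕ) : ℝ)
    have hN₁ : (N : ℝ) ≤
        (modelImage (S.coind H) (prodApprox σ τ n) (fun x => α₁ (x 1)) π₁ F₁ ε₁).card := by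
      exact_mod_cast Finset.card_le_card hc₁
    have hN₃ : (N : ℝ) ≤
        (modelImage (S.coind H) (prodApprox σ τ n) (fun x => α₃ (x 1)) π₃ F₃ ε₃).card := by
      exact_mod_cast Finset.card_le_card hc₃
    calc (N : ℝ) ^ (k + 1) = N * N ^ k := by ring
      _ ≤ (modelImage (S.coind H) (prodApprox σ τ n) (fun x => α₁ (x 1)) π₁ F₁ ε₁).card *
          (Real.exp (η / 2 * c) *
            (modelImage ((S.coind H).pow k) (prodApprox σ τ n) α₂ π₂ F₂ ε₂).card) := by
        refine mul_le_mul hN₁ ((pow_le_pow_left₀ (Nat.cast_nonneg _) hN₃ k).trans hn')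
          (by positivity) (by positivity)
      _ = Real.exp (η / 2 * c) * ((modelImage (S.coind H) (prodApprox σ τ n) (fun x => α₁ (x 1))
          π₁ F₁ ε₁).card * (modelImage ((S.coind H).pow k) (prodApprox σ τ n) α₂ π₂ F₂ ε₂).card) := by
        ring
      _ ≤ Real.exp (η / 2 * c) * (Real.exp (η / 2 * c) *
          (modelImage ((S.coind H).prod ((S.coind H).pow k)) (prodApprox σ τ n) (α ∘ e)
          (fun a => (π a 0, fun i : Fin k => π a i.succ)) F ε).card) := by gcongr
      _ = Real.exp (η * c) * (modelImage ((S.coind H).prod ((S.coind H).pow k)) (prodApprox σ τ n)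
          (α ∘ e) (fun a => (π a 0, fun i : Fin k => π a i.succ)) F ε).card := by
        rw [← mul_assoc, ← Real.exp_add]
        congr 2
        ring
      _ ≤ _ := by gcongr

theorem mul_observableEntropy_le_observableEntropy_pow [Infinite H] (hσ : IsSoficApprox σ)
    (hτ : IsSoficApprox τ) (S : PMPSystem G X) {β₀ : X → D} (hβ₀ : Measurable β₀) (k : ℕ) :
    (k : EReal) * observableEntropy (fun u => limsup u atTop) (S.coind H) (prodApprox σ τ)
        (fun x => β₀ (x 1)) ≤
      observableEntropy (fun u => limsup u atTop) ((S.coind H).pow k) (prodApprox σ τ)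
        fun z i => β₀ (z i 1) := by
  refine le_iInf fun m => le_iInf fun α => le_iInf fun π => le_iInf fun F => le_iInf fun ε =>
    le_iInf fun ⟨hα, hε, hπ⟩ => EReal.le_of_forall_pos_le_add_coe fun η hη => ?_
  obtain ⟨m₁, α₁, π₁, F₁, ε₁, hα₁, hε₁, hπ₁, h⟩ :=
    exists_eventually_card_pow_le hσ hτ S hβ₀ k hα hπ F hε hη
  have h1 := observableEntropy_le isLimitFunctional_limsup (S.coind H) (prodApprox σ τ)
    (fun x => β₀ (x 1)) (hα₁.comp (measurable_pi_apply 1)) (fun x => hπ₁ (x 1)) F₁ hε₁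
  have hk : (0 : EReal) ≤ k := by exact_mod_cast Nat.zero_le k
  refine (mul_le_mul_of_nonneg_left h1 hk).trans ?_
  rw [← EReal.limsup_const_mul_of_nonneg_of_ne_top hk (EReal.natCast_ne_top k)]
  refine (isLimitFunctional_limsup.mono _ _ ?_).trans (isLimitFunctional_limsup.add_const _ η)
  filter_upwards [h] with n hn
  exact mul_modelRate_le_modelRate_add hn

end CoinductionPowers

/-! ### Sofic entropy through metrics and through finite observables -/

section Empirical

open scoped Classical BigOperators

variable {Γ X V : Type*} [MeasurableSpace X] [Fintype V] [Nonempty V]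

theorem measureReal_empiricalDist (s : Γ → Equiv.Perm V) (x : V → X) {D : Set (Γ → X)}
    (hD : MeasurableSet D) :
    (empiricalDist s x : Measure (Γ → X)).real D = freq fun v => pullbackName s v x ∈ D := by
  rw [freq, Fintype.expect_eq_sum_div_card]
  simp only [empiricalDist, ProbabilityMeasure.coe_mk, measureReal_ennreal_smul_apply,
    ENNReal.toReal_inv, ENNReal.toReal_natCast, div_eq_inv_mul]
  congr 1
  rw [Measure.real, Measure.coe_finsetSum, Finset.sum_apply, ENNReal.toReal_sum (by simp)]
  refine Finset.sum_congr rfl fun v _ => ?_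
  rw [Measure.dirac_apply' _ hD, indicator_apply]
  split_ifs <;> simp

theorem integral_empiricalDist (s : Γ → Equiv.Perm V) (x : V → X) {f : (Γ → X) → ℝ}
    (hf : Measurable f) :
    ∫ y, f y ∂(empiricalDist s x : Measure (Γ → X)) = 𝔼 v, f (pullbackName s v x) := by
  rw [Fintype.expect_eq_sum_div_card]
  simp only [empiricalDist, ProbabilityMeasure.coe_mk, integral_smul_measure,
    ENNReal.toReal_inv, ENNReal.toReal_natCast, div_eq_inv_mul, smul_eq_mul]
  congr 1
  rw [integral_finsetSum_measure fun v _ => ?_]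
  · exact Finset.sum_congr rfl fun v _ => integral_dirac' _ _ hf.stronglyMeasurable
  · exact (integrable_const (f (pullbackName s v x))).congr
      (ae_eq_dirac' hf).symm

end Empirical

section CompactMetric

open scoped Classical BigOperators

variable {X : Type*} [MetricSpace X] [CompactSpace X]

theorem exists_pos_forall_dist_lt_imp_eq {A : Type*} [Fintype A] {K : A → Set X}
    (hK : ∀ a, IsClosed (K a)) (hdisj : ∀ a a', a ≠ a' → Disjoint (K a) (K a')) :
    ∃ δ > 0, ∀ a a', ∀ x ∈ K a, ∀ y ∈ K a', dist x y < δ → a = a' := by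
  have h : ∀ᶠ δ in 𝓝[>] (0 : ℝ), ∀ a a', ∀ x ∈ K a, ∀ y ∈ K a', dist x y < δ → a = a' := by
    refine eventually_all.mpr fun a => eventually_all.mpr fun a' => ?_
    by_cases haa : a = a'
    · exact Eventually.of_forall fun δ x _ y _ _ => haa
    · obtain ⟨δ, hδ, hd⟩ := (hdisj a a' haa).exists_thickenings (hK a).isCompact (hK a')
      filter_upwards [Ioo_mem_nhdsGT hδ] with r hr x hx y hy hxy
      exact (Set.disjoint_left.mp hd (Metric.self_subset_thickening hδ _ hx)
        (Metric.mem_thickening_iff.mpr ⟨y, hy, hxy.trans hr.2⟩)).elim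
  obtain ⟨δ, h1, h2⟩ := (h.and self_mem_nhdsWithin).exists
  exact ⟨δ, h2, h1⟩

variable [MeasurableSpace X] [BorelSpace X]

/-- A finite observable is supported, up to small measure, on separated closed pieces of its
cells. -/
theorem exists_isClosed_subset_cells (μ : Measure X) [IsProbabilityMeasure μ] {A : Type*}
    [Fintype A] [MeasurableSpace A] [MeasurableSingletonClass A] {α : X → A} (hα : Measurable α)
    {κ : ℝ} (hκ : 0 < κ) :
    ∃ K : A → Set X, (∀ a, IsClosed (K a)) ∧ (∀ a, ∀ x ∈ K a, α x = a) ∧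
      μ.real {x | x ∉ K (α x)} < κ ∧
      ∃ δ > 0, ∀ a a', ∀ x ∈ K a, ∀ y ∈ K a', dist x y < δ → a = a' := by
  have h : ∀ a, ∃ K ⊆ α ⁻¹' {a}, IsClosed K ∧
      μ (α ⁻¹' {a} \ K) < ENNReal.ofReal (κ / (Fintype.card A + 1)) := fun a =>
    (hα (measurableSet_singleton a)).exists_isClosed_sdiff_lt (measure_ne_top _ _)
      (by rw [ne_eq, ENNReal.ofReal_eq_zero, not_le]; positivity)
  choose K hKα hK hKμ using h
  refine ⟨K, hK, fun a x hx => hKα a hx, ?_, exists_pos_forall_dist_lt_imp_eq hK ?_⟩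
  · have hsub : {x | x ∉ K (α x)} ⊆ ⋃ a, (α ⁻¹' {a} \ K a) := fun x hx =>
      mem_iUnion.mpr ⟨α x, rfl, hx⟩
    refine (measureReal_mono hsub).trans_lt ((measureReal_iUnion_fintype_le _).trans_lt
      ((Finset.sum_le_sum (g := fun _ => κ / (Fintype.card A + 1)) fun a _ => ?_).trans_lt ?_))
    · exact ENNReal.toReal_le_of_le_ofReal (by positivity) (hKμ a).le
    · rw [Finset.sum_const, Finset.card_univ, nsmul_eq_mul, mul_div_assoc',
        div_lt_iff₀ (by positivity)]
      nlinarith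
  · intro a a' haa
    refine Set.disjoint_left.mpr fun x hx hx' => haa ?_
    rw [← show α x = a from hKα a hx, ← show α x = a' from hKα a' hx']

/-- There are finite observables with cells of small diameter. -/
theorem exists_measurable_dist_lt {r : ℝ} (hr : 0 < r) :
    ∃ (m : ℕ) (β : X → Fin m), Measurable β ∧ ∀ x y, β x = β y → dist x y < r := by
  obtain ⟨t, -, ht, hcov⟩ := finite_cover_balls_of_compact (isCompact_univ (X := X)) (half_pos hr)
  have : Fintype t := ht.fintype
  set e := Fintype.equivFin (t → Prop)
  refine ⟨_, fun x => e fun c => x ∈ Metric.ball (c : X) (r / 2),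
    (measurable_of_countable e).comp (measurable_pi_lambda _ fun c =>
      measurableSet_setOfPred.mp Metric.isOpen_ball.measurableSet), fun x y hxy => ?_⟩
  have h := e.injective hxy
  obtain ⟨c, hc, hx⟩ := mem_iUnion₂.mp (hcov (mem_univ x))
  have hy : y ∈ Metric.ball c (r / 2) := (iff_of_eq (congrFun h ⟨c, hc⟩)).mp hx
  rw [Metric.mem_ball] at hx hy
  calc dist x y ≤ dist x c + dist y c := dist_triangle_right x y c
    _ < r := by linarith

end CompactMetric

section WeakTopology

open scoped Classical BigOperators

variable {Γ X : Type*} [MetricSpace X] [CompactSpace X]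

/-- Continuous functions on `X ^ Γ` are nearly determined by finitely many coordinates. -/
theorem eventually_abs_sub_le_of_forall_dist_le {E : ℕ → Finset Γ} (hE : Tendsto E atTop atTop)
    {f : (Γ → X) → ℝ} (hf : Continuous f) {θ : ℝ} (hθ : 0 < θ) :
    ∀ᶠ j : ℕ in atTop, ∀ y y' : Γ → X, (∀ g ∈ E j, dist (y g) (y' g) ≤ 1 / ((j : ℝ) + 1)) →
      |f y - f y'| ≤ θ := by
  rcases isEmpty_or_nonempty (Γ → X) with h | ⟨⟨y₀⟩⟩
  · exact Eventually.of_forall fun j y => h.elim y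
  have hex : ∀ j : ℕ, ∃ p : (Γ → X) × (Γ → X),
      (∀ g ∈ E j, dist (p.1 g) (p.2 g) ≤ 1 / ((j : ℝ) + 1)) ∧
      (|f p.1 - f p.2| ≤ θ → ∀ y y' : Γ → X,
        (∀ g ∈ E j, dist (y g) (y' g) ≤ 1 / ((j : ℝ) + 1)) → |f y - f y'| ≤ θ) := by
    intro j
    by_cases hj : ∀ y y' : Γ → X, (∀ g ∈ E j, dist (y g) (y' g) ≤ 1 / ((j : ℝ) + 1)) →
      |f y - f y'| ≤ θ
    · exact ⟨(y₀, y₀), fun g _ => by rw [dist_self]; positivity, fun _ => hj⟩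
    · push Not at hj
      obtain ⟨y, y', h1, h2⟩ := hj
      exact ⟨(y, y'), h1, fun h => absurd h (not_le.mpr h2)⟩
  choose p hp hpf using hex
  have hlim : Tendsto p atTop (uniformity (Γ → X)) := by
    rw [Pi.uniformity, tendsto_iInf]
    intro g
    rw [tendsto_comap_iff, tendsto_uniformity_iff_dist_tendsto_zero]
    refine squeeze_zero' (Eventually.of_forall fun j => dist_nonneg) ?_
      (tendsto_one_div_add_atTop_nhds_zero_nat (𝕜 := ℝ))
    filter_upwards [hE.eventually_ge_atTop {g}] with j hj
    exact hp j g (Finset.singleton_subset_iff.mp hj)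
  have h := tendsto_uniformity_iff_dist_tendsto_zero.mp
    (Tendsto.comp (CompactSpace.uniformContinuous_of_continuous hf) hlim)
  filter_upwards [h.eventually_lt_const hθ] with j hj
  exact hpf j (by simpa [Real.dist_eq] using hj.le)

variable [Countable Γ] [MeasurableSpace X] [BorelSpace X]

/-- A weak-star neighbourhood contains all measures that give almost the same integrals to
the continuous functions with a sufficiently good modulus of continuity. -/
theorem exists_forall_abs_integral_sub_le_imp_mem {m : ProbabilityMeasure (Γ → X)}
    {O : Set (ProbabilityMeasure (Γ → X))} (hO : O ∈ 𝓝 m) :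
    ∃ (F : Finset Γ) (r ε : ℝ), 0 < r ∧ 0 < ε ∧ ∀ P : ProbabilityMeasure (Γ → X),
      (∀ (f : (Γ → X) → ℝ) (θ M : ℝ), Continuous f →
        (∀ y y', (∀ g ∈ F, dist (y g) (y' g) ≤ r) → |f y - f y'| ≤ θ) → (∀ y, |f y| ≤ M) →
        |∫ y, f y ∂(P : Measure (Γ → X)) - ∫ y, f y ∂(m : Measure (Γ → X))| ≤ 2 * θ + M * ε) →
      P ∈ O := by
  by_contra hcon
  push Not at hcon
  obtain ⟨E, hE⟩ := exists_seq_tendsto (atTop : Filter (Finset Γ))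
  choose P hP hPO using fun j : ℕ => hcon (E j) (1 / ((j : ℝ) + 1)) (1 / ((j : ℝ) + 1))
    (by positivity) (by positivity)
  have hlim : Tendsto P atTop (𝓝 m) := by
    refine ProbabilityMeasure.tendsto_iff_forall_integral_tendsto.mpr fun f => ?_
    refine Metric.tendsto_atTop'.mpr fun θ hθ => ?_
    have h1 := eventually_abs_sub_le_of_forall_dist_le hE f.continuous
      (show 0 < θ / 6 by positivity)
    have h2 : Tendsto (fun j : ℕ => ‖f‖ * (1 / ((j : ℝ) + 1))) atTop (𝓝 (‖f‖ * 0)) :=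
      tendsto_one_div_add_atTop_nhds_zero_nat.const_mul _
    rw [mul_zero] at h2
    obtain ⟨N, hN⟩ := eventually_atTop.mp (h1.and (h2.eventually_lt_const
      (show 0 < θ / 3 by positivity)))
    refine ⟨N, fun j hj => ?_⟩
    have h3 := hP j f (θ / 6) ‖f‖ f.continuous (hN j hj.le).1 fun y => f.norm_coe_le_norm y
    rw [Real.dist_eq]
    linarith [(hN j hj.le).2]
  obtain ⟨j, hj⟩ := (hlim.eventually hO).exists
  exact hPO j hj

theorem eventually_measureReal_gt {m : ProbabilityMeasure (Γ → X)} {U : Set (Γ → X)}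
    (hU : IsOpen U) {c : ℝ} (hc : c < (m : Measure (Γ → X)).real U) :
    ∀ᶠ P : ProbabilityMeasure (Γ → X) in 𝓝 m, c < (P : Measure (Γ → X)).real U := by
  rcases lt_or_ge c 0 with h0 | h0
  · exact Eventually.of_forall fun P => h0.trans_le measureReal_nonneg
  have h := ProbabilityMeasure.le_liminf_measure_open_of_tendsto (tendsto_id (x := 𝓝 m)) hU
  have h1 : ENNReal.ofReal c < (m : Measure (Γ → X)) U :=
    (ENNReal.ofReal_lt_iff_lt_toReal h0 (measure_ne_top _ _)).mpr hc
  filter_upwards [eventually_lt_of_lt_liminf (h1.trans_le h)] with P hP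
  exact (ENNReal.ofReal_lt_iff_lt_toReal h0 (measure_ne_top _ _)).mp hP

end WeakTopology

section Hamming

open scoped Classical BigOperators

variable {X : Type*} [MetricSpace X]

theorem hammingAvg_eq_expect {V : Type*} [Fintype V] (x y : V → X) :
    hammingAvg x y = 𝔼 v, dist (x v) (y v) := by
  rw [hammingAvg, Fintype.expect_eq_sum_div_card]

theorem freq_le_dist_mul_le {V : Type*} [Fintype V] (x y : V → X) (r : ℝ) :
    freq (fun v => r ≤ dist (x v) (y v)) * r ≤ hammingAvg x y := by
  rw [hammingAvg_eq_expect, freq, Finset.expect_mul]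
  refine Finset.expect_le_expect fun v _ => ?_
  split_ifs with h
  · rwa [one_mul]
  · rw [zero_mul]; exact dist_nonneg

theorem covNum_eq_top_or_exists {E : Type*} (ρ : E → E → ℝ) (δ : ℝ) (Z : Set E) :
    covNum ρ δ Z = ⊤ ∨ ∃ F : Finset E, ((F : Set E) ⊆ Z ∧ ∀ z ∈ Z, ∃ y ∈ F, ρ y z < δ) ∧
      covNum ρ δ Z = F.card := by
  rw [covNum, iInf_subtype']
  rcases isEmpty_or_nonempty
    {F : Finset E // (F : Set E) ⊆ Z ∧ ∀ z ∈ Z, ∃ y ∈ F, ρ y z < δ} with h | h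
  · exact Or.inl (iInf_of_empty _)
  · obtain ⟨F, hF⟩ := ENat.exists_eq_iInf
      fun F : {F : Finset E // (F : Set E) ⊆ Z ∧ ∀ z ∈ Z, ∃ y ∈ F, ρ y z < δ} =>
        ((F : Finset E).card : ℕ∞)
    exact Or.inr ⟨F, F.2, hF.symm⟩

end Hamming

section MetricLower

open scoped Classical BigOperators

variable {Γ X : Type*} [Group Γ] [Countable Γ] [MetricSpace X] [CompactSpace X] [MeasurableSpace X]
  [BorelSpace X]

/-- Good models of a fine observable give rise to good models of the process. -/
theorem exists_forall_defect_lt_imp_empiricalDist_mem (S : PMPSystem Γ X)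
    {O : Set (ProbabilityMeasure (Γ → X))} (hO : O ∈ 𝓝 S.processLaw) :
    ∃ (F : Finset Γ) (r ε : ℝ), 0 < r ∧ 0 < ε ∧ ∀ {A V : Type*} [Fintype A] [MeasurableSpace A]
      [MeasurableSingletonClass A] [Fintype V] [Nonempty V] {α : X → A}, Measurable α →
      ∀ p : A → X, (∀ x, dist x (p (α x)) ≤ r) → ∀ (s : Γ → Equiv.Perm V) (a : V → A),
        defect S s α F a < ε → empiricalDist s (fun v => p (a v)) ∈ O := by
  obtain ⟨F, r, ε, hr, hε, h⟩ := exists_forall_abs_integral_sub_le_imp_mem hO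
  refine ⟨F, r, ε, hr, hε, fun {A V} _ _ _ _ _ α hα p hp s a ha => h _ fun f θ M hf hθ hM => ?_⟩
  obtain ⟨x₀⟩ : Nonempty X := S.μ.nonempty_of_neZero
  set f' : (F → A) → ℝ := fun q => f fun g => if h : g ∈ F then p (q ⟨g, h⟩) else x₀
  have hM0 : 0 ≤ M := (abs_nonneg _).trans (hM fun _ => x₀)
  have h1 : |𝔼 v, f (pullbackName s v fun v => p (a v)) - 𝔼 v, f' (pattern s F a v)| ≤ θ := by
    rw [← Finset.expect_sub_distrib]
    refine (Finset.abs_expect_le _ _).trans (Finset.expect_le Finset.univ_nonempty fun v _ => ?_)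
    refine hθ _ _ fun g hg => ?_
    simp only [dif_pos hg, pullbackName, pattern, dist_self]
    exact hr.le
  have h2 : |∫ x, f' (S.orbitPattern α F x) ∂S.μ - ∫ x, f (S.orbitMap x) ∂S.μ| ≤ θ := by
    have hi : Integrable (fun x => f' (S.orbitPattern α F x)) S.μ :=
      Integrable.of_bound ((measurable_of_countable f').comp
        (S.measurable_orbitPattern hα F)).aestronglyMeasurable M
        (Eventually.of_forall fun x => hM _)
    have hi' : Integrable (fun x => f (S.orbitMap x)) S.μ :=
      Integrable.of_bound (hf.measurable.comp S.measurable_orbitMap).aestronglyMeasurable M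
        (Eventually.of_forall fun x => hM _)
    rw [← integral_sub hi hi', ← Real.norm_eq_abs]
    refine (norm_integral_le_of_norm_le_const (C := θ) (Eventually.of_forall fun x => ?_)).trans
      (by simp)
    refine hθ _ _ fun g hg => ?_
    simp only [dif_pos hg, PMPSystem.orbitPattern, PMPSystem.orbitMap]
    rw [dist_comm]
    exact hp _
  have h3 := abs_expect_sub_integral_le S s hα F a f' (M := M) fun q => hM _
  have h4 : ∫ y, f y ∂(S.processLaw : Measure (Γ → X)) = ∫ x, f (S.orbitMap x) ∂S.μ :=
    integral_map S.measurable_orbitMap.aemeasurable hf.measurable.aestronglyMeasurable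
  rw [integral_empiricalDist s _ hf.measurable, h4]
  have h5 : M * defect S s α F a ≤ M * ε := mul_le_mul_of_nonneg_left ha.le hM0
  rw [abs_le] at h1 h2 h3 ⊢
  constructor <;> linarith [h1.1, h1.2, h2.1, h2.2, h3.1, h3.2]

variable {V : ℕ → Type*} [∀ n, Fintype (V n)] [∀ n, Nonempty (V n)] {s : ∀ n, Γ → Equiv.Perm (V n)}

theorem exists_observableEntropy_le_covRate_add {L : (ℕ → EReal) → EReal} (hL : IsLimitFunctional L)
    (S : PMPSystem Γ X) {B : Type*} [Fintype B] [MeasurableSpace B] [MeasurableSingletonClass B]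
    {β : X → B} (hβ : Measurable β) {η : ℝ} (hη : 0 < η) :
    ∃ δ > 0, ∀ O ∈ 𝓝 S.processLaw,
      observableEntropy L S s β ≤ L (covRate s δ O) + (η : EReal) := by
  obtain ⟨x₀⟩ : Nonempty X := S.μ.nonempty_of_neZero
  obtain ⟨κ, hκ, hball⟩ := exists_card_le_of_hamming_cover B hη
  obtain ⟨K, hK, hKβ, hKμ, δ₀, hδ₀, hsep⟩ :=
    exists_isClosed_subset_cells S.μ hβ (show 0 < κ / 4 by positivity)
  refine ⟨κ / 2 * (δ₀ / 2), by positivity, fun O hO => ?_⟩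
  obtain ⟨F, r, ε, hr, hε, hF⟩ := exists_forall_defect_lt_imp_empiricalDist_mem S hO
  obtain ⟨m, φ, hφ, hφr⟩ := exists_measurable_dist_lt (X := X) hr
  set α : X → (B × Prop) × Fin m := fun x => ((β x, x ∈ K (β x)), φ x)
  have hKm : MeasurableSet {x | x ∈ K (β x)} := by
    have : {x | x ∈ K (β x)} = ⋃ b, (β ⁻¹' {b} ∩ K b) := by
      ext x; simp
    rw [this]
    exact MeasurableSet.iUnion fun b =>
      (hβ (measurableSet_singleton b)).inter (hK b).measurableSet
  have hα : Measurable α := (hβ.prodMk (measurableSet_setOfPred.mp hKm)).prodMk hφ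
  set p : (B × Prop) × Fin m → X := fun c => if h : ∃ x, α x = c then h.choose else x₀
  have hp : ∀ x, α (p (α x)) = α x := fun x => by
    have h : ∃ y, α y = α x := ⟨x, rfl⟩
    simp only [p, dif_pos h]
    exact h.choose_spec
  have hpr : ∀ x, dist x (p (α x)) ≤ r := fun x =>
    (hφr _ _ (Prod.ext_iff.mp (hp x)).2.symm).le
  have hpK : ∀ x, x ∈ K (β x) → p (α x) ∈ K (α x).1.1 := fun x hx => by
    have h1 := (Prod.ext_iff.mp (Prod.ext_iff.mp (hp x)).1).1
    have h2 := (Prod.ext_iff.mp (Prod.ext_iff.mp (hp x)).1).2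
    have h3 : p (α x) ∈ K (β (p (α x))) := (iff_of_eq h2).mpr hx
    rwa [show β (p (α x)) = (α x).1.1 from h1] at h3
  refine (observableEntropy_le hL S s β hα (π := fun c => c.1.1) (fun x => rfl) (F ∪ {1})
    (lt_min hε (show 0 < κ / 4 by positivity))).trans ((hL.mono _ _
      (Eventually.of_forall fun n => ?_)).trans (hL.add_const _ η))
  refine log_div_le_add Fintype.card_ne_zero ?_
  rcases covNum_eq_top_or_exists hammingAvg (κ / 2 * (δ₀ / 2)) (goodModels O (s n)) with
    htop | ⟨R, ⟨-, hR⟩, hcov⟩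
  · rw [htop, ENat.toENNReal_top, ENNReal.mul_top (by simp [Real.exp_pos])]
    exact le_top
  rw [hcov, ENat.toENNReal_coe, ← ENNReal.ofReal_natCast, ← ENNReal.ofReal_natCast,
    ← ENNReal.ofReal_mul (Real.exp_pos _).le]
  refine ENNReal.ofReal_le_ofReal (hball (V n) _ R
    (fun y v => if h : ∃ b, ∃ k ∈ K b, dist (y v) k < δ₀ / 2 then h.choose else β x₀) ?_)
  intro b hb
  obtain ⟨a, ha, rfl⟩ := mem_modelImage.mp hb
  have haF : defect S (s n) α F a < ε :=
    (defect_comp_le S (s n) hα id (Finset.subset_union_left (s₁ := F) (s₂ := {1})) a).trans_lt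
      (ha.trans_le (min_le_left _ _))
  obtain ⟨y, hy, hyd⟩ := hR _ (hF hα p hpr (s n) a haF)
  refine ⟨y, hy, ?_⟩
  have hbad : freq (fun v => p (a v) ∉ K (a v).1.1) ≤ κ / 2 := by
    have h1 : (1 : Γ) ∈ F ∪ {1} := by simp
    have h2 := abs_freq_sub_measureReal_le S (s n) hα (F ∪ {1}) a
      fun q => p (q ⟨1, h1⟩) ∉ K (q ⟨1, h1⟩).1.1
    have h3 : freq (fun v => p (pattern (s n) (F ∪ {1}) a v ⟨1, h1⟩) ∉
        K (pattern (s n) (F ∪ {1}) a v ⟨1, h1⟩).1.1) = freq fun v => p (a v) ∉ K (a v).1.1 :=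
      freq_comp_equiv (s n 1) fun v => p (a v) ∉ K (a v).1.1
    have h4 : S.μ.real {x | p (S.orbitPattern α (F ∪ {1}) x ⟨1, h1⟩) ∉
        K (S.orbitPattern α (F ∪ {1}) x ⟨1, h1⟩).1.1} ≤ κ / 4 := by
      refine le_trans (measureReal_mono ?_) hKμ.le
      intro x hx
      have hx' : p (α (S.T 1 x)) ∉ K (α (S.T 1 x)).1.1 := hx
      rw [S.T_one] at hx'
      exact fun hxK => hx' (hpK x hxK)
    rw [h3] at h2
    have h5 := (abs_le.mp (h2.trans (ha.le.trans (min_le_right _ _)))).2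
    linarith
  have hfar : freq (fun v => δ₀ / 2 ≤ dist (y v) (p (a v))) ≤ κ / 2 := by
    have h1 := freq_le_dist_mul_le y (fun v => p (a v)) (δ₀ / 2)
    exact le_of_mul_le_mul_right (h1.trans hyd.le) (by positivity)
  refine (freq_mono (Q := fun v => p (a v) ∉ K (a v).1.1 ∨ δ₀ / 2 ≤ dist (y v) (p (a v)))
    fun v hv => ?_).trans ((freq_or_le _ _).trans (by linarith))
  by_contra hc
  push Not at hc
  obtain ⟨hc1, hc2⟩ := hc
  have h : ∃ b, ∃ k ∈ K b, dist (y v) k < δ₀ / 2 := ⟨_, _, hc1, hc2⟩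
  rw [dif_pos h] at hv
  obtain ⟨k, hk, hkd⟩ := h.choose_spec
  refine hv (hsep _ _ _ hc1 _ hk ?_)
  calc dist (p (a v)) k ≤ dist (y v) (p (a v)) + dist (y v) k := dist_triangle_left _ _ _
    _ < δ₀ := by linarith

end MetricLower

theorem isOpen_forall_mem {ι A X : Type*} [TopologicalSpace X] (F : Finset ι)
    {U : A → Set X} (hU : ∀ a, IsOpen (U a))
    (p : F → A) : IsOpen {y : ι → X | ∀ g : F, y g ∈ U (p g)} := by
  simp only [ofPred_forall]
  exact isOpen_iInter_of_finite fun g => (hU _).preimage (continuous_apply (g : ι))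

section MetricUpper

open scoped Classical BigOperators

variable {Γ X : Type*} [Group Γ] [MeasurableSpace X]

/-- A lower bound for the frequencies of all patterns bounds the defect. -/
theorem defect_le_of_forall_sub_le {V A : Type*} [Fintype V] [Nonempty V] [Fintype A]
    [MeasurableSpace A] [MeasurableSingletonClass A] (S : PMPSystem Γ X) (s : Γ → Equiv.Perm V)
    {α : X → A} (hα : Measurable α) (F : Finset Γ) (a : V → A) {c : ℝ} (hc : 0 ≤ c)
    (h : ∀ p, S.μ.real {x | S.orbitPattern α F x = p} - c ≤
      freq fun v => pattern s F a v = p) :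
    defect S s α F a ≤ 2 * (Fintype.card (F → A) * c) := by
  have h1 := sum_freq_eq_mul (fun v => pattern s F a v) fun _ => (1 : ℝ)
  have h2 := sum_measureReal_eq_mul S.μ (S.measurable_orbitPattern hα F) fun _ => (1 : ℝ)
  simp only [mul_one, Fintype.expect_const, integral_const, probReal_univ, smul_eq_mul] at h1 h2
  have h3 : ∀ p, |freq (fun v => pattern s F a v = p) -
      S.μ.real {x | S.orbitPattern α F x = p}| ≤ (freq (fun v => pattern s F a v = p) -
      S.μ.real {x | S.orbitPattern α F x = p}) + 2 * c := fun p => by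
    rw [abs_le]
    constructor <;> linarith [h p]
  refine (Finset.sum_le_sum fun p _ => h3 p).trans (le_of_eq ?_)
  rw [Finset.sum_add_distrib, Finset.sum_sub_distrib, h1, h2, Finset.sum_const, nsmul_eq_mul,
    Finset.card_univ]
  ring

variable [Countable Γ] [MetricSpace X] [CompactSpace X] [BorelSpace X]

/-- The letters of a good model of the process can be rounded to a good model of a finite
observable. -/
theorem exists_nhds_forall_exists_defect_lt (S : PMPSystem Γ X) {A : Type*} [Fintype A]
    [MeasurableSpace A] [MeasurableSingletonClass A] {α : X → A} (hα : Measurable α)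
    (F : Finset Γ) {ε r : ℝ} (hε : 0 < ε) (hr : 0 < r) :
    ∃ O ∈ 𝓝 S.processLaw, ∀ {V : Type*} [Fintype V] [Nonempty V] (s : Γ → Equiv.Perm V)
      (x : V → X), empiricalDist s x ∈ O → ∃ a : V → A, defect S s α F a < ε ∧
        freq (fun v => ¬ ∃ k, α k = a v ∧ dist (x v) k < r) < ε := by
  obtain ⟨x₀⟩ : Nonempty X := S.μ.nonempty_of_neZero
  set F' := insert 1 F
  set N : ℝ := ((Fintype.card (F' → A) : ℕ) : ℝ)
  set κ : ℝ := ε / (2 * (N * (F'.card + 1)) + 1)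
  have hκ : 0 < κ := by positivity
  set c : ℝ := (F'.card + 1) * κ
  have hc : 0 ≤ c := by positivity
  have hNc : 2 * (N * c) < ε := by
    have : 2 * (N * c) = 2 * (N * (F'.card + 1)) * κ := by ring
    rw [this, mul_div_assoc', div_lt_iff₀ (by positivity)]
    nlinarith
  obtain ⟨K, hK, hKα, hKμ, δ₀, hδ₀, hsep⟩ := exists_isClosed_subset_cells S.μ hα hκ
  set ρ := min (δ₀ / 2) r
  have hρ : 0 < ρ := by positivity
  set U : A → Set X := fun a => Metric.thickening ρ (K a)
  have hU : ∀ a, IsOpen (U a) := fun a => Metric.isOpen_thickening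
  have hUdisj : ∀ x a a', x ∈ U a → x ∈ U a' → a = a' := by
    intro x a a' h h'
    obtain ⟨k, hk, hkd⟩ := Metric.mem_thickening_iff.mp h
    obtain ⟨k', hk', hkd'⟩ := Metric.mem_thickening_iff.mp h'
    refine hsep a a' k hk k' hk' ?_
    calc dist k k' ≤ dist x k + dist x k' := dist_triangle_left _ _ _
      _ < δ₀ := by linarith [min_le_left (δ₀ / 2) r]
  set D : (F' → A) → Set (Γ → X) := fun p => {y | ∀ g : F', y g ∈ U (p g)}
  have hD : ∀ p, IsOpen (D p) := fun p => isOpen_forall_mem F' hU p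
  have hlaw : ∀ p, S.μ.real {x | S.orbitPattern α F' x = p} - c <
      (S.processLaw : Measure (Γ → X)).real (D p) := by
    intro p
    have h1 : (S.processLaw : Measure (Γ → X)).real (D p) = S.μ.real (S.orbitMap ⁻¹' D p) :=
      map_measureReal_apply S.measurable_orbitMap (hD p).measurableSet
    have hKm : MeasurableSet {x | x ∉ K (α x)} := by
      have : {x | x ∉ K (α x)} = (⋃ a, (α ⁻¹' {a} ∩ K a))ᶜ := by
        ext x; simp
      rw [this]
      exact (MeasurableSet.iUnion fun a =>
        (hα (measurableSet_singleton a)).inter (hK a).measurableSet).compl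
    have h2 : {x | S.orbitPattern α F' x = p} ⊆ (S.orbitMap ⁻¹' D p) ∪
        ⋃ g ∈ F', {x | S.T g x ∈ {x | x ∉ K (α x)}} := by
      intro x hx
      by_contra hcon
      simp only [mem_union, mem_iUnion, exists_prop, not_or, not_exists, not_and,
        mem_ofPred_eq, not_not] at hcon
      refine hcon.1 fun g => ?_
      have h3 : α (S.T g x) = p g := congrFun hx g
      have h4 := hcon.2 g g.2
      rw [h3] at h4
      exact Metric.self_subset_thickening hρ _ h4
    have h3 : S.μ.real (⋃ g ∈ F', {x | S.T g x ∈ {x | x ∉ K (α x)}}) ≤ F'.card * κ := by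
      refine (measureReal_biUnion_finset_le _ _).trans
        ((Finset.sum_le_sum (g := fun _ => κ) fun g _ => ?_).trans (by simp))
      rw [S.measureReal_preimage_T g hKm]
      exact hKμ.le
    have h4 := (measureReal_mono (μ := S.μ) h2).trans (measureReal_union_le _ _)
    rw [h1]
    have h5 : c = F'.card * κ + κ := by ring
    linarith
  refine ⟨{P | ∀ p, S.μ.real {x | S.orbitPattern α F' x = p} - c <
    (P : Measure (Γ → X)).real (D p)}, eventually_all.mpr fun p =>
      eventually_measureReal_gt (hD p) (hlaw p), ?_⟩
  intro V _ _ s x hx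
  set a : V → A := fun v => if h : ∃ a, x v ∈ U a then h.choose else α x₀
  have ha : ∀ v b, x v ∈ U b → a v = b := fun v b hb => by
    have h : ∃ a, x v ∈ U a := ⟨b, hb⟩
    simp only [a, dif_pos h]
    exact hUdisj _ _ _ h.choose_spec hb
  have hpat : ∀ p v, pullbackName s v x ∈ D p → pattern s F' a v = p := fun p v hv =>
    funext fun g => ha _ _ (hv g)
  have hx' : ∀ p, S.μ.real {x | S.orbitPattern α F' x = p} - c <
      freq fun v => pullbackName s v x ∈ D p := fun p => by
    rw [← measureReal_empiricalDist s x (hD p).measurableSet]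
    exact hx p
  refine ⟨a, ?_, ?_⟩
  · refine lt_of_le_of_lt ((defect_comp_le S s hα id (Finset.subset_insert 1 F) a).trans
      (defect_le_of_forall_sub_le S s hα F' a hc fun p =>
        (hx' p).le.trans (freq_mono fun v => hpat p v))) hNc
  · set P : V → Prop := fun v => ∃ k, α k = a v ∧ dist (x v) k < r
    have h1 : ∑ p, freq (fun v => pullbackName s v x ∈ D p) ≤ freq fun v => P (s 1 v) := by
      simp only [freq]
      rw [← Finset.expect_sum_comm]
      refine Finset.expect_le_expect fun v _ => ?_
      refine (Finset.sum_eq_single (pattern s F' a v) (fun p _ hp =>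
        if_neg fun h => hp (hpat p v h).symm) fun h => absurd (Finset.mem_univ _) h).trans_le ?_
      split_ifs with h h'
      · exact le_rfl
      · refine absurd ?_ h'
        have hv := h ⟨1, Finset.mem_insert_self 1 F⟩
        obtain ⟨k, hk, hkd⟩ := Metric.mem_thickening_iff.mp hv
        exact ⟨k, hKα _ k hk, hkd.trans_le (min_le_right _ _)⟩
      · exact zero_le_one
      · exact le_rfl
    have h2 := Finset.sum_le_sum fun p (_ : p ∈ Finset.univ) => (hx' p).le
    have h3 := sum_measureReal_eq_mul S.μ (S.measurable_orbitPattern hα F') fun _ => (1 : ℝ)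
    simp only [mul_one, integral_const, probReal_univ, smul_eq_mul] at h3
    rw [Finset.sum_sub_distrib, h3, Finset.sum_const, nsmul_eq_mul, Finset.card_univ] at h2
    rw [freq_comp_equiv (s 1) P] at h1
    rw [freq_not]
    have h4 : 0 ≤ N * c := by positivity
    linarith

variable {V : ℕ → Type*} [∀ n, Fintype (V n)] [∀ n, Nonempty (V n)] {s : ∀ n, Γ → Equiv.Perm (V n)}

theorem iInf_covRate_le_partitionEntropy {L : (ℕ → EReal) → EReal} (hL : IsLimitFunctional L)
    (S : PMPSystem Γ X) {δ : ℝ} (hδ : 0 < δ) :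
    ⨅ (O : Set (ProbabilityMeasure (Γ → X))) (_ : O ∈ 𝓝 S.processLaw), L (covRate s δ O) ≤
      partitionEntropy L S s := by
  obtain ⟨m, β, hβ, hβd⟩ := exists_measurable_dist_lt (X := X) (show 0 < δ / 8 by positivity)
  refine le_trans ?_ (le_iSup_of_le m (le_iSup_of_le β (le_iSup_of_le hβ le_rfl)))
  refine le_iInf fun m' => le_iInf fun α => le_iInf fun π => le_iInf fun F => le_iInf fun ε =>
    le_iInf fun ⟨hα, hε, hπ⟩ => ?_
  obtain ⟨C, hC0, hC⟩ : ∃ C : ℝ, 0 < C ∧ ∀ x y : X, dist x y ≤ C :=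
    ⟨Metric.diam (univ : Set X) + 1, by positivity, fun x y =>
      (Metric.dist_le_diam_of_mem isCompact_univ.isBounded (mem_univ x) (mem_univ y)).trans
        (by linarith)⟩
  obtain ⟨O, hO, hOa⟩ := exists_nhds_forall_exists_defect_lt S hα F
    (lt_min hε (show 0 < δ / (4 * C) by positivity)) (show 0 < δ / 8 by positivity)
  refine iInf₂_le_of_le O hO (hL.mono _ _ (Eventually.of_forall fun n => ?_))
  refine EReal.div_le_div_right_of_nonneg (by exact_mod_cast Nat.zero_le _) (ENNReal.log_le_log ?_)
  obtain ⟨x₀⟩ : Nonempty X := S.μ.nonempty_of_neZero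
  have : Nonempty (V n → X) := ⟨fun _ => x₀⟩
  have : Nonempty (V n → Fin m') := ⟨fun _ => α x₀⟩
  choose! a ha hax using fun (x : V n → X) (hx : x ∈ goodModels O (s n)) => hOa (s n) x hx
  have hdist : ∀ x ∈ goodModels O (s n), ∀ y ∈ goodModels O (s n),
      (fun v => π (a x v)) = (fun v => π (a y v)) → hammingAvg x y < δ := by
    intro x hx y hy hxy
    have h1 : hammingAvg x y ≤ 𝔼 v, (δ / 2 +
        C * ((if ¬ ∃ k, α k = a x v ∧ dist (x v) k < δ / 8 then (1 : ℝ) else 0) +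
          if ¬ ∃ k, α k = a y v ∧ dist (y v) k < δ / 8 then (1 : ℝ) else 0)) := by
      rw [hammingAvg_eq_expect]
      refine Finset.expect_le_expect fun v _ => ?_
      by_cases h : ∃ k, α k = a x v ∧ dist (x v) k < δ / 8
      · by_cases h' : ∃ k, α k = a y v ∧ dist (y v) k < δ / 8
        · rw [if_neg (not_not.mpr h), if_neg (not_not.mpr h'), add_zero, mul_zero, add_zero]
          obtain ⟨k, hk, hkd⟩ := h
          obtain ⟨k', hk', hkd'⟩ := h'
          have hkk : β k = β k' := by
            rw [← hπ, ← hπ, hk, hk']; exact congrFun hxy v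
          have h2 := hβd k k' hkk
          have h3 := dist_triangle4_right (x v) (y v) k k'
          linarith
        · rw [if_neg (not_not.mpr h), if_pos h', zero_add, mul_one]
          linarith [hC (x v) (y v)]
      · rw [if_pos h]
        split_ifs <;> nlinarith [hC (x v) (y v)]
    rw [Finset.expect_add_distrib, ← Finset.mul_expect, Finset.expect_add_distrib,
      Fintype.expect_const, ← freq_eq_expect, ← freq_eq_expect] at h1
    have h2 := (hax x hx).trans_le (min_le_right _ _)
    have h3 := (hax y hy).trans_le (min_le_right _ _)
    rw [lt_div_iff₀ (by positivity)] at h2 h3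
    nlinarith
  set M := (modelImage S (s n) α π F ε).filter
    fun b => ∃ x ∈ goodModels O (s n), (fun v => π (a x v)) = b
  have hM : ∀ b ∈ M, ∃ x ∈ goodModels O (s n), (fun v => π (a x v)) = b := fun b hb =>
    (Finset.mem_filter.mp hb).2
  choose! z hz hzb using hM
  have hcov : covNum hammingAvg δ (goodModels O (s n)) ≤ ((M.image z).card : ℕ∞) := by
    refine iInf₂_le_of_le (M.image z) ⟨?_, fun x hx => ?_⟩ le_rfl
    · intro x hx
      obtain ⟨b, hb, rfl⟩ := Finset.mem_image.mp hx
      exact hz b hb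
    · have hb : (fun v => π (a x v)) ∈ M := Finset.mem_filter.mpr
        ⟨mem_modelImage.mpr ⟨a x, (ha x hx).trans_le (min_le_left _ _), rfl⟩, x, hx, rfl⟩
      exact ⟨_, Finset.mem_image_of_mem z hb, hdist _ (hz _ hb) _ hx (hzb _ hb)⟩
  have hcard : (M.image z).card ≤ (modelImage S (s n) α π F ε).card :=
    Finset.card_image_le.trans (Finset.card_filter_le _ _)
  calc (covNum hammingAvg δ (goodModels O (s n)) : ℝ≥0∞) ≤ (((M.image z).card : ℕ∞) : ℝ≥0∞) :=
        ENat.toENNReal_le.mpr hcov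
    _ = ((M.image z).card : ℝ≥0∞) := ENat.toENNReal_coe _
    _ ≤ _ := by exact_mod_cast hcard

/-- The sofic entropy computed from a metric agrees with the one computed from finite
observables. -/
theorem iSup_iInf_covRate_eq_partitionEntropy {L : (ℕ → EReal) → EReal}
    (hL : IsLimitFunctional L) (S : PMPSystem Γ X) :
    ⨆ (δ : ℝ) (_ : 0 < δ), ⨅ (O : Set (ProbabilityMeasure (Γ → X))) (_ : O ∈ 𝓝 S.processLaw),
      L (covRate s δ O) = partitionEntropy L S s := by
  refine le_antisymm (iSup₂_le fun δ hδ => iInf_covRate_le_partitionEntropy hL S hδ) ?_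
  refine iSup_le fun m => iSup_le fun β => iSup_le fun hβ =>
    EReal.le_of_forall_pos_le_add_coe fun η hη => ?_
  obtain ⟨δ, hδ, h⟩ := exists_observableEntropy_le_covRate_add (s := s) hL S hβ hη
  rw [← EReal.sub_le_iff_le_add (Or.inl (by simp)) (Or.inl (by simp))]
  refine le_iSup₂_of_le δ hδ (le_iInf₂ fun O hO => ?_)
  rw [EReal.sub_le_iff_le_add (Or.inl (by simp)) (Or.inl (by simp))]
  exact h O hO

end MetricUpper

section SoficEntropy

variable {Γ X : Type*} [Group Γ] [Countable Γ] [MeasurableSpace X] {V : ℕ → Type*}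
  [∀ n, Fintype (V n)] [∀ n, Nonempty (V n)]

theorem soficEntropy_eq_partitionEntropy (s : ∀ n, Γ → Equiv.Perm (V n)) (d : CompactGenMetric X)
    (S : PMPSystem Γ X) :
    soficEntropy s d S = partitionEntropy (fun u => limsup u atTop) S s := by
  let := d.metric
  have := d.compact
  have := d.borel
  exact iSup_iInf_covRate_eq_partitionEntropy isLimitFunctional_limsup S

theorem lowerSoficEntropy_eq_partitionEntropy (s : ∀ n, Γ → Equiv.Perm (V n))
    (d : CompactGenMetric X) (S : PMPSystem Γ X) :
    lowerSoficEntropy s d S = partitionEntropy (fun u => liminf u atTop) S s := by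
  let := d.metric
  have := d.compact
  have := d.borel
  exact iSup_iInf_covRate_eq_partitionEntropy isLimitFunctional_liminf S

end SoficEntropy

theorem mainTheorem9
    {G : Type*} [Group G] [Countable G] {H : Type*} [Group H] [Countable H] [Infinite H]
    {V : ℕ → Type*} [∀ n, Fintype (V n)] [∀ n, Nonempty (V n)]
    {W : ℕ → Type*} [∀ n, Fintype (W n)] [∀ n, Nonempty (W n)]
    (σ : ∀ n, G → Equiv.Perm (V n)) (hσ : IsSoficApprox σ)
    (τ : ∀ n, H → Equiv.Perm (W n)) (hτ : IsSoficApprox τ)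
    {X : Type*} [MeasurableSpace X] [StandardBorelSpace X] (A : PMPSystem G X)
    (d : CompactGenMetric (H → X)) :
    (∀ (Y : Type*) [MeasurableSpace Y] [StandardBorelSpace Y] (B : PMPSystem (G × H) Y)
        (dY : CompactGenMetric Y) (dP : CompactGenMetric ((H → X) × Y)),
        soficEntropy (prodApprox σ τ) dY B = lowerSoficEntropy (prodApprox σ τ) dY B →
          soficEntropy (prodApprox σ τ) dP ((A.coind H).prod B) =
            soficEntropy (prodApprox σ τ) d (A.coind H) + soficEntropy (prodApprox σ τ) dY B) ∧
      (A.HasFiniteGeneratingPartition →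
        ∀ (k : ℕ), 1 ≤ k → ∀ dk : CompactGenMetric (Fin k → H → X),
          soficEntropy (prodApprox σ τ) dk ((A.coind H).pow k) =
            (k : EReal) * soficEntropy (prodApprox σ τ) d (A.coind H)) := by
  simp only [soficEntropy_eq_partitionEntropy, lowerSoficEntropy_eq_partitionEntropy]
  have hs := hσ.prodApprox hτ
  refine ⟨fun Y _ _ B _ _ hB => le_antisymm (partitionEntropy_prod_le hs _ B) ?_,
    fun hgen k _ _ => le_antisymm (partitionEntropy_pow_le hs _ k) ?_⟩
  · rw [hB]
    refine EReal.add_le_of_forall_lt fun a ha b hb => ?_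
    obtain ⟨m, β₀, hβ₀, h₀⟩ : ∃ (m : ℕ) (β₀ : X → Fin m), Measurable β₀ ∧
        a < observableEntropy (fun u => limsup u atTop) (A.coind H) (prodApprox σ τ)
          fun x => β₀ (x 1) := by
      by_contra hc
      push Not at hc
      exact not_le.mpr ha (partitionEntropy_coind_le isLimitFunctional_limsup hσ hτ A hc)
    simp only [partitionEntropy, lt_iSup_iff] at hb
    obtain ⟨m', β', hβ', h'⟩ := hb
    refine (add_le_add h₀.le h'.le).trans
      ((add_observableEntropy_le_observableEntropy_prod hσ hτ A B hβ₀ hβ').trans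
        (observableEntropy_le_partitionEntropy isLimitFunctional_limsup _ _ ?_))
    exact (hβ₀.comp ((measurable_pi_apply 1).comp measurable_fst)).prodMk (hβ'.comp measurable_snd)
  · obtain ⟨m, f, hf, hgen⟩ := hgen
    refine (mul_le_mul_of_nonneg_left (partitionEntropy_coind_le_of_generating
      isLimitFunctional_limsup hσ hτ A hf hgen) (by exact_mod_cast Nat.zero_le k)).trans
      ((mul_observableEntropy_le_observableEntropy_pow hσ hτ A hf k).trans
        (observableEntropy_le_partitionEntropy isLimitFunctional_limsup _ _ ?_))
    exact measurable_pi_lambda _ fun i =>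
      hf.comp ((measurable_pi_apply 1).comp (measurable_pi_apply i))
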